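/- Let $n\ge 2$ and let $S\subset\mathbb{R}^n$ be a compact, convex (not necessarily smooth) hypersurface, i.e. a compact subset of the boundary of a convex set with nonempty interior (for example, the whole boundary of a convex body). Let $\mu$ be the induced $(n-1)$-dimensional surface measure on $S$. For $\theta\in SO(n)$ let $\mu_\theta$ be the rotated measure defined by $\int g\,d\mu_\theta=\int g(\theta^{-1}y)\,d\mu(y)$, and let $f*\mu_\theta(x)=\int f(x-y)\,d\mu_\theta(y)$. Let $d\theta$ be the normalized Haar measure on $SO(n)$. Then there is a constant $C$, depending only on $n$ and $S$, such that for every complex-valued $f\in L^{\frac{n+1}{n}}(\mathbb{R}^n)$ the integral defining $f*\mu_\theta(x)$ converges absolutely for almost every $(x,\theta)\in\mathbb{R}^n\times SO(n)$, the function $(x,\theta)\mapsto f*\mu_\theta(x)$ belongs to $L^{n+1}(\mathbb{R}^n\times SO(n))$, and $$\Bigl(\int_{SO(n)}\int_{\mathbb{R}^n}|f*\mu_\theta(x)|^{n+1}\,dx\,d\theta\Bigr)^{\frac1{n+1}}\le C\Bigl(\int_{\mathbb{R}^n}|f(y)|^{\frac{n+1}{n}}\,dy\Bigr)^{\frac n{n+1}}.$$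 -/

import Mathlib

open MeasureTheory
open scoped ENNReal NNReal

noncomputable section

/-- The rotation group of `ℝⁿ`: real orthogonal `n × n` matrices of determinant one, with the
topology inherited from the space of matrices. -/
abbrev SO (n : ℕ) : Type := Matrix.specialOrthogonalGroup (Fin n) ℝ

namespace SO

variable {n : ℕ}

theorem coe_inv_apply (A : SO n) (i j : Fin n) : (A⁻¹ : SO n).1 i j = A.1 j i := rfl

theorem mem_iff (A : Matrix (Fin n) (Fin n) ℝ) :
    A ∈ Matrix.specialOrthogonalGroup (Fin n) ℝ ↔ A * A.transpose = 1 ∧ A.det = 1 := by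
  rw [Matrix.mem_specialOrthogonalGroup_iff, Matrix.mem_orthogonalGroup_iff]

instance instIsTopologicalGroup : IsTopologicalGroup (SO n) where
  continuous_mul := by
    refine Continuous.subtype_mk ?_ _
    exact (continuous_subtype_val.comp continuous_fst).mul
      (continuous_subtype_val.comp continuous_snd)
  continuous_inv := by
    refine continuous_induced_rng.2 (continuous_matrix fun i j => ?_)
    exact (continuous_apply_apply j i).comp continuous_subtype_val

instance instCompactSpace : CompactSpace (SO n) := by
  refine isCompact_iff_compactSpace.1 ?_
  have hsub : (Matrix.specialOrthogonalGroup (Fin n) ℝ : Set (Matrix (Fin n) (Fin n) ℝ)) ⊆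
      Set.univ.pi fun _ => Set.univ.pi fun _ => Set.Icc (-1 : ℝ) 1 := by
    intro A hA i _ j _
    have h := congrFun (congrFun ((mem_iff A).1 hA).1 i) i
    rw [Matrix.mul_apply, Matrix.one_apply_eq] at h
    have h1 : A i j * A i j ≤ 1 := by
      rw [← h]
      exact Finset.single_le_sum (f := fun k => A i k * A.transpose k i)
        (fun k _ => mul_self_nonneg (A i k)) (Finset.mem_univ j)
    exact ⟨by nlinarith, by nlinarith⟩
  have hcl : IsClosed
      (Matrix.specialOrthogonalGroup (Fin n) ℝ : Set (Matrix (Fin n) (Fin n) ℝ)) := by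
    have : (Matrix.specialOrthogonalGroup (Fin n) ℝ : Set (Matrix (Fin n) (Fin n) ℝ)) =
        {A | A * A.transpose = 1} ∩ {A | A.det = 1} := by
      ext A
      exact mem_iff A
    rw [this]
    exact (isClosed_eq (by fun_prop) continuous_const).inter
      (isClosed_eq (by fun_prop) continuous_const)
  exact (isCompact_univ_pi fun _ => isCompact_univ_pi fun _ => isCompact_Icc).of_isClosed_subset
    hcl hsub

/-- The Borel σ-algebra on the rotation group. -/
instance instMeasurableSpace : MeasurableSpace (SO n) := borel _

instance instBorelSpace : BorelSpace (SO n) := ⟨rfl⟩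

/-- The Haar measure of the rotation group, normalized to have total mass one. -/
def haar (n : ℕ) : Measure (SO n) := Measure.haarMeasure ⊤

/-- The action of a rotation on a vector of `ℝⁿ`. -/
def rotate (θ : SO n) (x : EuclideanSpace ℝ (Fin n)) : EuclideanSpace ℝ (Fin n) :=
  Matrix.toEuclideanLin θ.1 x

end SO

/-- The surface measure induced by Euclidean space on `S ⊆ ℝⁿ`: the `(n-1)`-dimensional Hausdorff
measure, normalized to agree with `(n-1)`-dimensional Lebesgue measure on hyperplanes,
restricted to `S`. -/
def surfaceMeasure {n : ℕ} (S : Set (EuclideanSpace ℝ (Fin n))) :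
    Measure (EuclideanSpace ℝ (Fin n)) :=
  (Measure.euclideanHausdorffMeasure (n - 1)).restrict S

/-- The rotated measure `μ_θ`, given by `∫ f dμ_θ = ∫ f (θ⁻¹ y) dμ(y)`. -/
def rotatedMeasure {n : ℕ} (μ : Measure (EuclideanSpace ℝ (Fin n))) (θ : SO n) :
    Measure (EuclideanSpace ℝ (Fin n)) :=
  μ.map (SO.rotate θ⁻¹)

/-- The convolution `(f * ν)(x) = ∫ f (x - y) dν(y)` of a function with a measure. -/
def convMeasure {n : ℕ} (f : EuclideanSpace ℝ (Fin n) → ℂ)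
    (ν : Measure (EuclideanSpace ℝ (Fin n))) (x : EuclideanSpace ℝ (Fin n)) : ℂ :=
  ∫ y, f (x - y) ∂ν

end

/-!
The estimate is proved by Stein's complex interpolation between an `L¹ → L^∞` and an `L² → L²` bound,
after a decomposition of the surface measure into dyadic frequency pieces. Write `n = m + 1`.

*Reduction to graphs.* Every point of `S` has a supporting unit normal. Sorting the points by the
direction of such a normal splits `S` into finitely many pieces, each of which, after a rotation,
lies on the graph of the infimum `h` of its supporting affine functions: a concave function on `ℝᵐ`
with small Lipschitz constant `η` (`exists_concave_graph`). The surface measure is dominated by the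
Lebesgue measure of the base, and all bounds are stable under domination, rotation and finite sums
(`RotationAveragedBound`). So the measure may be taken to be `graphMeasure h L`.

*Averaged decay.* The Fourier transform of a convex surface need not decay in a given direction, but
its mean square over rotations is `O(‖ξ‖⁻ᵐ)` (`exists_lintegral_graphFourier_ball_le`). For the
rotations which bring `ξ` near the normal direction, the square is expanded as a double integral, and
the average over rotations in coordinate planes is integrated by parts
(`exists_lintegral_poleCutoff_le`). For the other rotations some tangential coordinate of the
frequency is large, and the transform is compared with that of a translate by `τ ~ 1 / ‖ξ‖` in this
direction (`exists_setLIntegral_graphFourier_le`). This produces translation differences, which are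
small in `L²` and are estimated by a trace inequality (`exists_lintegral_graphFourier_le`), and
densities of the same kind multiplied by the increments of `h`. The latter have size `η`, and by
concavity they are monotone along `τ`, so that these densities belong to `η` times the same class.
Hence the best constant of the class is bounded by an admissible term plus half of itself.

*The analytic family.* Let `P_j` be the regularization of the surface measure at scale `2⁻ʲ`
(`dyadicKernel`). The kernels `stripKernel` are
`K_z = P_0 + (2^{1 - z} - 1) ∑_{j < J} 2^{-jz} (P_{j+1} - P_j)`, so that `K_0 = P_J`. For
`Re z = -m / 2` the averaged decay bounds the averages over rotations of the squared Fourier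
transform of `K_z` (`exists_lintegral_stripKernel_le`). For `Re z = 1` the kernels are bounded
pointwise: `2⁻ʲ P_j(x)` is an average over `w` of the indicator function of the convex set below the
graph at `x - 2⁻ʲ w`, and the sequence of these points, moving along a line, crosses the boundary of
a convex set at most twice (`norm_stripKernel_le`). Thus the sequence has bounded variation, and the
factor `2^{1 - z} - 1` allows a summation by parts. The bounds do not depend on `J`.

*Interpolation and limits.* The three lines theorem gives the bound from `L^{(m+2)/(m+1)}` to `L^{m+2}`
for `P_J`, uniformly in `J` (`lintegral_enorm_rotConv_pow_le`). Letting `J` tend to infinity for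
continuous functions of compact support, and then passing to general functions by density and Fatou's
lemma, yields the bound for `|f|` (`RotationAveragedBound.of_hasCompactSupport`), which contains the
absolute convergence for almost every point and rotation (`RotationAveragedBound.exists_memLp`).
-/

noncomputable section

/-! ### The rotation group acting on Euclidean space -/

namespace SO

variable {n : ℕ}

instance instSecondCountable : SecondCountableTopology (SO n) :=
  inferInstanceAs (SecondCountableTopology
    (Subtype fun A : Fin n → Fin n → ℝ => A ∈ Matrix.specialOrthogonalGroup (Fin n) ℝ))

instance instIsHaarMeasure : (haar n).IsHaarMeasure := by
  unfold haar; infer_instance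

instance instIsProbabilityMeasure : IsProbabilityMeasure (haar n) :=
  ⟨Measure.haarMeasure_self (K₀ := (⊤ : TopologicalSpace.PositiveCompacts (SO n)))⟩

instance instIsMulRightInvariant : (haar n).IsMulRightInvariant := by
  refine ⟨fun g => ?_⟩
  have : IsProbabilityMeasure ((haar n).map (· * g)) :=
    Measure.isProbabilityMeasure_map (measurable_mul_const g).aemeasurable
  have : ((haar n).map (· * g)).IsHaarMeasure := inferInstance
  exact Measure.isHaarMeasure_eq_of_isProbabilityMeasure _ _

theorem rotate_apply (θ : SO n) (x : EuclideanSpace ℝ (Fin n)) (i : Fin n) :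
    rotate θ x i = ∑ j, θ.1 i j * x j := rfl

theorem rotate_mul (θ φ : SO n) (x : EuclideanSpace ℝ (Fin n)) :
    rotate (θ * φ) x = rotate θ (rotate φ x) := by
  ext i
  simp [rotate_apply, Matrix.mul_apply, Finset.sum_mul, Finset.mul_sum, mul_assoc]
  rw [Finset.sum_comm]

@[simp] theorem rotate_one (x : EuclideanSpace ℝ (Fin n)) : rotate (1 : SO n) x = x := by
  simp [rotate]

theorem rotate_add (θ : SO n) (x y : EuclideanSpace ℝ (Fin n)) :
    rotate θ (x + y) = rotate θ x + rotate θ y := by simp [rotate]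

theorem rotate_sub (θ : SO n) (x y : EuclideanSpace ℝ (Fin n)) :
    rotate θ (x - y) = rotate θ x - rotate θ y := by simp [rotate]

theorem rotate_smul (θ : SO n) (c : ℝ) (x : EuclideanSpace ℝ (Fin n)) :
    rotate θ (c • x) = c • rotate θ x := by simp [rotate]

@[simp] theorem rotate_inv_rotate (θ : SO n) (x : EuclideanSpace ℝ (Fin n)) :
    rotate θ⁻¹ (rotate θ x) = x := by rw [← rotate_mul]; simp

@[simp] theorem rotate_rotate_inv (θ : SO n) (x : EuclideanSpace ℝ (Fin n)) :
    rotate θ (rotate θ⁻¹ x) = x := by rw [← rotate_mul]; simp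

theorem inner_rotate_left (θ : SO n) (x y : EuclideanSpace ℝ (Fin n)) :
    inner ℝ (rotate θ x) y = inner ℝ x (rotate θ⁻¹ y) := by
  simp only [PiLp.inner_apply, rotate_apply, coe_inv_apply, RCLike.inner_apply, conj_trivial,
    Finset.mul_sum, Finset.sum_mul]
  rw [Finset.sum_comm]
  refine Finset.sum_congr rfl fun i _ => Finset.sum_congr rfl fun j _ => by ring

theorem inner_rotate_rotate (θ : SO n) (x y : EuclideanSpace ℝ (Fin n)) :
    inner ℝ (rotate θ x) (rotate θ y) = inner ℝ x y := by
  rw [inner_rotate_left, rotate_inv_rotate]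

@[simp] theorem norm_rotate (θ : SO n) (x : EuclideanSpace ℝ (Fin n)) :
    ‖rotate θ x‖ = ‖x‖ := by
  rw [@norm_eq_sqrt_real_inner _ _ _ (rotate θ x), inner_rotate_rotate,
    ← @norm_eq_sqrt_real_inner]

/-- A rotation as a linear isometry of Euclidean space. -/
def rotateIso (θ : SO n) : EuclideanSpace ℝ (Fin n) ≃ₗᵢ[ℝ] EuclideanSpace ℝ (Fin n) where
  toFun := rotate θ
  invFun := rotate θ⁻¹
  left_inv := rotate_inv_rotate θ
  right_inv := rotate_rotate_inv θ
  map_add' := rotate_add θ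
  map_smul' := rotate_smul θ
  norm_map' := norm_rotate θ

theorem measurePreserving_rotate (θ : SO n) :
    MeasurePreserving (rotate θ) (volume : Measure (EuclideanSpace ℝ (Fin n))) volume :=
  (rotateIso θ).measurePreserving

theorem measurableEmbedding_rotate (θ : SO n) : MeasurableEmbedding (rotate θ) :=
  (rotateIso θ).toMeasurableEquiv.measurableEmbedding

theorem continuous_entry (i j : Fin n) : Continuous fun A : SO n => A.1 i j := by
  have h : Continuous fun A : Matrix (Fin n) (Fin n) ℝ => A i j := continuous_apply_apply i j
  exact h.comp (continuous_subtype_val (p := fun A : Matrix (Fin n) (Fin n) ℝ =>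
    A ∈ Matrix.specialOrthogonalGroup (Fin n) ℝ))

theorem continuous_rotate_uncurry :
    Continuous fun p : SO n × EuclideanSpace ℝ (Fin n) => rotate p.1 p.2 := by
  refine (PiLp.continuous_toLp 2 _).comp ?_
  refine continuous_pi fun i => ?_
  change Continuous fun p : SO n × EuclideanSpace ℝ (Fin n) => ∑ j, p.1.1 i j * p.2 j
  refine continuous_finsetSum _ fun j _ => Continuous.mul ?_ ?_
  · have h : Continuous fun A : SO n => A.1 i j := continuous_entry i j
    exact h.comp continuous_fst
  · exact (EuclideanSpace.proj (𝕜 := ℝ) j).continuous.comp continuous_snd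

@[fun_prop] theorem continuous_rotate {X : Type*} [TopologicalSpace X] {a : X → SO n}
    {b : X → EuclideanSpace ℝ (Fin n)} (ha : Continuous a) (hb : Continuous b) :
    Continuous fun x => rotate (a x) (b x) :=
  continuous_rotate_uncurry.comp (ha.prodMk hb)

/-! ### Rotations in coordinate planes -/

/-- The matrix of the rotation by the angle `t` in the plane of the coordinates `i` and `j`. -/
def planeMatrix (i j : Fin n) (t : ℝ) : Matrix (Fin n) (Fin n) ℝ :=
  1 + (Real.cos t - 1) • (Matrix.single i i 1 + Matrix.single j j 1)
    + Real.sin t • (Matrix.single j i 1 - Matrix.single i j 1)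

theorem planeMatrix_mul {i j : Fin n} (h : i ≠ j) (s t : ℝ) :
    planeMatrix i j s * planeMatrix i j t = planeMatrix i j (s + t) := by
  set P : Matrix (Fin n) (Fin n) ℝ := Matrix.single i i 1 + Matrix.single j j 1 with hP
  set J : Matrix (Fin n) (Fin n) ℝ := Matrix.single j i 1 - Matrix.single i j 1 with hJ
  have h1 : P * P = P := by
    simp [hP, mul_add, add_mul, Matrix.single_mul_single_of_ne, h, h.symm]
  have h2 : P * J = J := by
    simp [hP, hJ, mul_sub, add_mul, Matrix.single_mul_single_of_ne, h, h.symm]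
  have h3 : J * P = J := by
    simp [hP, hJ, mul_add, sub_mul, Matrix.single_mul_single_of_ne, h, h.symm]
    abel
  have h4 : J * J = -P := by
    simp [hP, hJ, mul_sub, sub_mul, Matrix.single_mul_single_of_ne, h, h.symm]
    abel
  simp only [planeMatrix, ← hP, ← hJ, mul_add, add_mul, one_mul, mul_one, smul_mul_assoc,
    mul_smul_comm, h1, h2, h3, h4, Real.cos_add, Real.sin_add]
  module

theorem planeMatrix_transpose (i j : Fin n) (t : ℝ) :
    (planeMatrix i j t).transpose = planeMatrix i j (-t) := by
  simp only [planeMatrix, Matrix.transpose_add, Matrix.transpose_smul, Matrix.transpose_sub,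
    Matrix.transpose_single, Matrix.transpose_one, Real.cos_neg, Real.sin_neg]
  module

theorem planeMatrix_zero (i j : Fin n) : planeMatrix i j 0 = 1 := by simp [planeMatrix]

/-- The rotation by the angle `t` in the plane of the coordinates `i ≠ j`. -/
def planeRot {i j : Fin n} (h : i ≠ j) (t : ℝ) : SO n := by
  refine ⟨planeMatrix i j t, (mem_iff _).2 ?_⟩
  have ho : ∀ s, planeMatrix i j s * (planeMatrix i j s).transpose = 1 := fun s => by
    rw [planeMatrix_transpose, planeMatrix_mul h, add_neg_cancel, planeMatrix_zero]
  refine ⟨ho t, ?_⟩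
  -- an orthogonal matrix has determinant `±1`, and this one is a square
  have hd : (planeMatrix i j (t / 2)).det * (planeMatrix i j (t / 2)).det = 1 := by
    have := congrArg Matrix.det (ho (t / 2))
    rwa [Matrix.det_mul, Matrix.det_transpose, Matrix.det_one] at this
  rw [← hd, ← Matrix.det_mul, planeMatrix_mul h, add_halves]

theorem rotate_planeRot {i j : Fin n} (h : i ≠ j) (t : ℝ) (x : EuclideanSpace ℝ (Fin n))
    (k : Fin n) : rotate (planeRot h t) x k =
      if k = i then Real.cos t * x i - Real.sin t * x j
      else if k = j then Real.sin t * x i + Real.cos t * x j else x k := by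
  change ((planeMatrix i j t).mulVec x.ofLp) k = _
  simp only [planeMatrix, Matrix.add_mulVec, Matrix.sub_mulVec, Matrix.smul_mulVec,
    Matrix.one_mulVec, Matrix.single_mulVec, Pi.add_apply, Pi.smul_apply, Pi.sub_apply,
    Function.update_apply, Pi.zero_apply, smul_eq_mul, one_mul]
  split_ifs with h1 h2 h3
  all_goals first | (exact absurd (h1.symm.trans h2) h) | (subst_vars; ring)

/-! ### Transitivity on spheres and averages over the rotation group -/

theorem exists_planeRot_eq_zero {i j : Fin n} (h : i ≠ j) (x : EuclideanSpace ℝ (Fin n)) :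
    ∃ t, rotate (planeRot h t) x j = 0 ∧ 0 ≤ rotate (planeRot h t) x i := by
  set z : ℂ := ⟨x i, -x j⟩ with hz
  have h1 : ‖z‖ * Real.cos z.arg = x i := Complex.norm_mul_cos_arg z
  have h2 : ‖z‖ * Real.sin z.arg = -x j := Complex.norm_mul_sin_arg z
  refine ⟨z.arg, ?_, ?_⟩
  · rw [rotate_planeRot, if_neg h.symm, if_pos rfl]
    linear_combination Real.cos z.arg * h2 - Real.sin z.arg * h1
  · rw [rotate_planeRot, if_pos rfl]
    have : Real.cos z.arg * x i - Real.sin z.arg * x j = ‖z‖ := by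
      linear_combination -Real.cos z.arg * h1 - Real.sin z.arg * h2
        + ‖z‖ * Real.sin_sq_add_cos_sq z.arg
    rw [this]; exact norm_nonneg _

theorem exists_rotate_eq_single {m : ℕ} (hm : 1 ≤ m) (x : EuclideanSpace ℝ (Fin (m + 1))) :
    ∃ θ : SO (m + 1), rotate θ x = EuclideanSpace.single 0 ‖x‖ := by
  -- plane rotations annihilate the coordinates one after the other
  have key : ∀ s : Finset (Fin m), ∃ θ : SO (m + 1), (∀ i ∈ s, rotate θ x i.succ = 0) ∧
      (s.Nonempty → 0 ≤ rotate θ x 0) := by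
    intro s
    induction s using Finset.induction_on with
    | empty => exact ⟨1, by simp, by simp⟩
    | insert j s hj ih =>
      obtain ⟨θ, h1, -⟩ := ih
      have h0 : (0 : Fin (m + 1)) ≠ j.succ := (Fin.succ_ne_zero j).symm
      obtain ⟨t, h2, h3⟩ := exists_planeRot_eq_zero h0 (rotate θ x)
      refine ⟨planeRot h0 t * θ, fun i hi => ?_, fun _ => by rwa [rotate_mul]⟩
      rw [rotate_mul]
      rcases Finset.mem_insert.1 hi with rfl | hi
      · exact h2
      · have hij : i ≠ j := fun h => hj (h ▸ hi)
        rw [rotate_planeRot, if_neg (Fin.succ_ne_zero i),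
          if_neg (fun h => hij (Fin.succ_injective _ h)), h1 i hi]
  obtain ⟨θ, h1, h2⟩ := key Finset.univ
  have : Nonempty (Fin m) := ⟨⟨0, hm⟩⟩
  have h3 : rotate θ x = EuclideanSpace.single 0 (rotate θ x 0) := by
    ext i
    refine Fin.cases ?_ (fun i => ?_) i
    · simp
    · simp [h1 i (Finset.mem_univ i)]
  refine ⟨θ, ?_⟩
  have h4 : ‖x‖ = rotate θ x 0 := by
    rw [← norm_rotate θ x, h3]
    simp [abs_of_nonneg (h2 Finset.univ_nonempty)]
  rw [h4]; exact h3

theorem exists_rotate_eq {m : ℕ} (hm : 1 ≤ m) {x y : EuclideanSpace ℝ (Fin (m + 1))}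
    (h : ‖x‖ = ‖y‖) : ∃ θ : SO (m + 1), rotate θ x = y := by
  obtain ⟨θ, hθ⟩ := exists_rotate_eq_single hm x
  obtain ⟨φ, hφ⟩ := exists_rotate_eq_single hm y
  refine ⟨φ⁻¹ * θ, ?_⟩
  rw [rotate_mul, hθ, h, ← hφ, rotate_inv_rotate]

/-- Averages over the rotation group depend only on the norm of the rotated vector. -/
theorem lintegral_rotate_eq_of_norm_eq {m : ℕ} (hm : 1 ≤ m)
    {x y : EuclideanSpace ℝ (Fin (m + 1))} (h : ‖x‖ = ‖y‖)
    (H : EuclideanSpace ℝ (Fin (m + 1)) → ℝ≥0∞) :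
    ∫⁻ θ, H (rotate θ x) ∂haar (m + 1) = ∫⁻ θ, H (rotate θ y) ∂haar (m + 1) := by
  obtain ⟨φ, hφ⟩ := exists_rotate_eq hm h
  rw [← lintegral_mul_right_eq_self (fun θ => H (rotate θ x)) φ]
  simp only [rotate_mul, hφ]

/-- The push-forward of the Haar measure to the sphere of radius `R` has mass `O(R⁻ᵐ)` in unit
balls, in the form of a bound for Gaussian averages. -/
theorem exists_lintegral_gaussian_le {m : ℕ} (hm : 1 ≤ m) : ∃ C : ℝ≥0,
    ∀ ξ η : EuclideanSpace ℝ (Fin (m + 1)), 1 ≤ ‖ξ‖ →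
      ∫⁻ θ, ENNReal.ofReal (Real.exp (-(Real.pi / 2) * ‖rotate θ ξ - η‖ ^ 2)) ∂haar (m + 1) ≤
        C * ENNReal.ofReal (‖ξ‖ ^ m)⁻¹ := by
  set E := EuclideanSpace ℝ (Fin (m + 1))
  set g : E → ℝ≥0∞ := fun x => ENNReal.ofReal (Real.exp (-(Real.pi / 4) * ‖x‖ ^ 2)) with hg
  have hgc : Continuous g := by
    refine ENNReal.continuous_ofReal.comp (Real.continuous_exp.comp ?_)
    fun_prop
  have hgi : ∫⁻ x, g x ≠ ⊤ := by
    have h := (GaussianFourier.integrable_cexp_neg_mul_sq_norm_add (V := E)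
      (b := ((Real.pi / 4 : ℝ) : ℂ)) (by simp [Real.pi_pos]) 0 0).hasFiniteIntegral
    rw [HasFiniteIntegral] at h
    refine ne_of_lt (lt_of_eq_of_lt (lintegral_congr fun x => ?_) h)
    rw [← ofReal_norm, Complex.norm_exp]
    simp [← Complex.ofReal_pow, hg]
  set v : ℝ≥0∞ := volume (Metric.ball (0 : E) 1) with hv
  have hv0 : v ≠ 0 := (Metric.measure_ball_pos _ _ one_pos).ne'
  have hvt : v ≠ ⊤ := measure_ball_lt_top.ne
  refine ⟨(ENNReal.ofReal (Real.exp (Real.pi / 2)) * (∫⁻ x, g x) * v⁻¹).toNNReal,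
    fun ξ η hξ => ?_⟩
  rw [ENNReal.coe_toNNReal (by finiteness)]
  set R := ‖ξ‖ with hR
  have hR0 : 0 < R := by linarith
  set W := ∫⁻ θ, ENNReal.ofReal (Real.exp (-(Real.pi / 2) * ‖rotate θ ξ - η‖ ^ 2)) ∂haar (m + 1)
    with hW
  set A : Set E := Metric.ball 0 (R + 1) \ Metric.ball 0 R with hA
  have hAm : MeasurableSet A := Metric.isOpen_ball.measurableSet.diff Metric.isOpen_ball.measurableSet
  have hvol : ENNReal.ofReal (R ^ m) * v ≤ volume A := by
    rw [hA, measure_sdiff (Metric.ball_subset_ball (by linarith))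
      Metric.isOpen_ball.measurableSet.nullMeasurableSet measure_ball_lt_top.ne,
      Measure.addHaar_ball _ _ (by linarith), Measure.addHaar_ball _ _ hR0.le, ← hv,
      ← ENNReal.sub_mul (fun _ _ => hvt), ← ENNReal.ofReal_sub _ (by positivity)]
    gcongr
    rw [finrank_euclideanSpace_fin, pow_succ, pow_succ]
    have : R ^ m ≤ (R + 1) ^ m := by gcongr; linarith
    nlinarith
  -- `W` is compared with the same average at every point of a shell of unit thickness
  have hpt : ∀ x ∈ A, W ≤ ENNReal.ofReal (Real.exp (Real.pi / 2)) *
      ∫⁻ θ, g (rotate θ x - η) ∂haar (m + 1) := by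
    intro x hx
    have hx1 : R ≤ ‖x‖ := by simpa using hx.2
    have hx2 : ‖x‖ < R + 1 := by simpa using hx.1
    have hx0 : 0 < ‖x‖ := by linarith
    set y : E := (R / ‖x‖) • x with hy
    have hyn : ‖ξ‖ = ‖y‖ := by
      rw [hy, norm_smul, Real.norm_of_nonneg (by positivity), div_mul_cancel₀ _ hx0.ne']
    have hxy : ‖x - y‖ ≤ 1 := by
      have : x - y = (1 - R / ‖x‖) • x := by rw [hy, sub_smul, one_smul]
      rw [this, norm_smul, Real.norm_of_nonneg
        (by rw [sub_nonneg, div_le_one hx0]; exact hx1), sub_mul, one_mul,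
        div_mul_cancel₀ _ hx0.ne']
      linarith
    rw [hW, lintegral_rotate_eq_of_norm_eq hm hyn (fun u =>
      ENNReal.ofReal (Real.exp (-(Real.pi / 2) * ‖u - η‖ ^ 2))),
      ← lintegral_const_mul' _ _ ENNReal.ofReal_ne_top]
    refine lintegral_mono fun θ => ?_
    rw [hg, ← ENNReal.ofReal_mul (Real.exp_pos _).le, ← Real.exp_add]
    refine ENNReal.ofReal_le_ofReal (Real.exp_le_exp.2 ?_)
    have h1 : ‖rotate θ x - η‖ ≤ ‖rotate θ y - η‖ + 1 := by
      calc ‖rotate θ x - η‖ = ‖(rotate θ y - η) + rotate θ (x - y)‖ := by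
            rw [rotate_sub]; congr 1; abel
        _ ≤ _ := (norm_add_le _ _).trans (by rw [norm_rotate]; linarith)
    have h2 : ‖rotate θ x - η‖ ^ 2 ≤ 2 * ‖rotate θ y - η‖ ^ 2 + 2 := by
      have := norm_nonneg (rotate θ x - η)
      nlinarith [sq_nonneg (‖rotate θ y - η‖ - 1)]
    nlinarith [Real.pi_pos]
  have hint : W * volume A ≤ ENNReal.ofReal (Real.exp (Real.pi / 2)) * ∫⁻ x, g x := by
    have hmeas : Measurable fun p : E × SO (m + 1) => g (rotate p.2 p.1 - η) :=
      (hgc.comp (by fun_prop)).measurable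
    calc W * volume A = ∫⁻ _ in A, W := by rw [setLIntegral_const]
      _ ≤ ∫⁻ x in A, ENNReal.ofReal (Real.exp (Real.pi / 2)) *
          ∫⁻ θ, g (rotate θ x - η) ∂haar (m + 1) := setLIntegral_mono' hAm hpt
      _ ≤ ∫⁻ x, ENNReal.ofReal (Real.exp (Real.pi / 2)) *
          ∫⁻ θ, g (rotate θ x - η) ∂haar (m + 1) := setLIntegral_le_lintegral _ _
      _ = ENNReal.ofReal (Real.exp (Real.pi / 2)) *
          ∫⁻ θ, ∫⁻ x : E, g (rotate θ x - η) ∂volume ∂haar (m + 1) := by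
        rw [lintegral_const_mul' _ _ ENNReal.ofReal_ne_top, lintegral_lintegral_swap]
        exact hmeas.aemeasurable
      _ = ENNReal.ofReal (Real.exp (Real.pi / 2)) * ∫⁻ _ : SO (m + 1), (∫⁻ x, g x ∂volume) ∂haar (m + 1) := by
        congr 1
        refine lintegral_congr fun θ => ?_
        rw [(measurePreserving_rotate θ).lintegral_comp
          (f := fun x => g (x - η)) (by fun_prop), lintegral_sub_right_eq_self]
      _ = _ := by simp
  have hRm : 0 < R ^ m := by positivity
  rw [ENNReal.ofReal_inv_of_pos hRm, mul_assoc, ← ENNReal.mul_inv (Or.inl hv0) (Or.inl hvt),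
    ← div_eq_mul_inv, ENNReal.le_div_iff_mul_le]
  · refine le_trans ?_ hint
    rw [mul_comm v]
    gcongr
  · left; exact mul_ne_zero hv0 (by simpa using hRm)
  · left; exact ENNReal.mul_ne_top hvt ENNReal.ofReal_ne_top

end SO

end

noncomputable section

/-! ### Plancherel's identity for integrable square-integrable functions -/

section Plancherel

open FourierTransform SchwartzMap

variable {V : Type*} [NormedAddCommGroup V] [InnerProductSpace ℝ V] [FiniteDimensional ℝ V]
  [MeasurableSpace V] [BorelSpace V]

/-- On `L¹ ∩ L²` the Fourier integral represents the `L²` Fourier transform. -/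
theorem coeFn_fourier_toLp_ae_eq {f : V → ℂ} (hf : Integrable f) (hf2 : MemLp f 2) :
    (𝓕 (hf2.toLp f) : Lp ℂ 2 (volume : Measure V)) =ᵐ[volume] 𝓕 f := by
  have hcont : Continuous (𝓕 f) :=
    VectorFourier.fourierIntegral_continuous Real.continuous_fourierChar
      (by exact continuous_inner) hf
  refine ae_eq_of_integral_contDiff_smul_eq
    ((Lp.memLp _).locallyIntegrable one_le_two) hcont.locallyIntegrable fun g hg hgc => ?_
  have hgc' : HasCompactSupport fun x => (g x : ℂ) := hgc.comp_left (g := fun t : ℝ => (t : ℂ)) rfl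
  have hg' : ContDiff ℝ (⊤ : ℕ∞) fun x => (g x : ℂ) := Complex.ofRealCLM.contDiff.comp hg
  set φ : 𝓢(V, ℂ) := hgc'.toSchwartzMap hg' with hφ
  have h1 := congrArg (fun T => T φ) (Lp.fourier_toTemperedDistribution_eq (hf2.toLp f))
  simp only [TemperedDistribution.fourier_apply, Lp.toTemperedDistribution_apply] at h1
  have h2 : ∫ ξ, (𝓕 f) ξ • φ ξ = ∫ x, f x • (𝓕 (φ : V → ℂ)) x :=
    VectorFourier.integral_fourierIntegral_smul_eq_flip (L := innerₗ V)
      Real.continuous_fourierChar (by exact continuous_inner) hf φ.integrable |>.trans (by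
        simp only [flip_innerₗ]; rfl)
  have h3 : ∫ x, (𝓕 φ) x • (hf2.toLp f) x = ∫ x, f x • (𝓕 (φ : V → ℂ)) x := by
    refine integral_congr_ae ?_
    filter_upwards [hf2.coeFn_toLp] with x hx
    rw [hx, SchwartzMap.fourier_coe, smul_eq_mul, smul_eq_mul, mul_comm]
  calc ∫ x, g x • (𝓕 (hf2.toLp f) : Lp ℂ 2 (volume : Measure V)) x
      = ∫ x, φ x • (𝓕 (hf2.toLp f) : Lp ℂ 2 (volume : Measure V)) x := by
        refine integral_congr_ae (.of_forall fun x => ?_)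
        simp [hφ]
    _ = ∫ x, (𝓕 f) x • φ x := by rw [← h1, h3, h2]
    _ = _ := by
        refine integral_congr_ae (.of_forall fun x => ?_)
        simp [hφ, mul_comm]

theorem lintegral_enorm_sq_fourier {f : V → ℂ} (hf : Integrable f) (hf2 : MemLp f 2) :
    ∫⁻ ξ, ‖𝓕 f ξ‖ₑ ^ 2 = ∫⁻ x, ‖f x‖ₑ ^ 2 := by
  have key : ∀ g : Lp ℂ 2 (volume : Measure V), ∫⁻ x, ‖g x‖ₑ ^ 2 = ENNReal.ofReal ‖g‖ ^ 2 := by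
    intro g
    have h := eLpNorm_nnreal_pow_eq_lintegral (f := g) (μ := (volume : Measure V))
      (p := 2) two_ne_zero
    have h' : ENNReal.ofReal ‖g‖ = eLpNorm g 2 volume := by
      rw [Lp.norm_def, ENNReal.ofReal_toReal (Lp.eLpNorm_ne_top g)]
    rw [h']
    simpa using h.symm
  calc ∫⁻ ξ, ‖𝓕 f ξ‖ₑ ^ 2
      = ∫⁻ ξ, ‖(𝓕 (hf2.toLp f) : Lp ℂ 2 (volume : Measure V)) ξ‖ₑ ^ 2 := by
        refine lintegral_congr_ae ?_
        filter_upwards [coeFn_fourier_toLp_ae_eq hf hf2] with ξ hξ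
        rw [hξ]
    _ = ∫⁻ x, ‖(hf2.toLp f) x‖ₑ ^ 2 := by rw [key, key, Lp.norm_fourier_eq]
    _ = _ := by
        refine lintegral_congr_ae ?_
        filter_upwards [hf2.coeFn_toLp] with x hx
        rw [hx]

end Plancherel

/-! ### Splitting off the first coordinate -/

/-- The point of `ℝᵐ⁺¹` with first coordinate `s` and remaining coordinates `y`. -/
def consE {m : ℕ} (s : ℝ) (y : EuclideanSpace ℝ (Fin m)) : EuclideanSpace ℝ (Fin (m + 1)) :=
  WithLp.toLp 2 (Fin.cons s y.ofLp)

section consE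

variable {m : ℕ}

@[simp] theorem consE_zero (s : ℝ) (y : EuclideanSpace ℝ (Fin m)) : consE s y 0 = s := rfl

@[simp] theorem consE_succ (s : ℝ) (y : EuclideanSpace ℝ (Fin m)) (i : Fin m) :
    consE s y i.succ = y i := rfl

/-- The coordinates of a point of `ℝᵐ⁺¹` other than the first one. -/
def tailE (x : EuclideanSpace ℝ (Fin (m + 1))) : EuclideanSpace ℝ (Fin m) :=
  WithLp.toLp 2 fun i => x i.succ

@[simp] theorem tailE_apply (x : EuclideanSpace ℝ (Fin (m + 1))) (i : Fin m) :
    tailE x i = x i.succ := rfl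

@[simp] theorem consE_tailE (x : EuclideanSpace ℝ (Fin (m + 1))) : consE (x 0) (tailE x) = x := by
  ext i
  refine Fin.cases ?_ (fun i => ?_) i <;> simp

@[simp] theorem tailE_consE (s : ℝ) (y : EuclideanSpace ℝ (Fin m)) : tailE (consE s y) = y := by
  ext i; simp

theorem inner_consE (x : EuclideanSpace ℝ (Fin (m + 1))) (s : ℝ) (y : EuclideanSpace ℝ (Fin m)) :
    inner ℝ x (consE s y) = x 0 * s + inner ℝ (tailE x) y := by
  simp [PiLp.inner_apply, Fin.sum_univ_succ, mul_comm]

theorem inner_consE_consE (s t : ℝ) (y z : EuclideanSpace ℝ (Fin m)) :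
    inner ℝ (consE s y) (consE t z) = s * t + inner ℝ y z := by
  rw [inner_consE]; simp

theorem norm_consE_sq (s : ℝ) (y : EuclideanSpace ℝ (Fin m)) :
    ‖consE s y‖ ^ 2 = s ^ 2 + ‖y‖ ^ 2 := by
  rw [← real_inner_self_eq_norm_sq, inner_consE_consE, real_inner_self_eq_norm_sq, sq s]

theorem consE_add (s t : ℝ) (y z : EuclideanSpace ℝ (Fin m)) :
    consE (s + t) (y + z) = consE s y + consE t z := by
  ext i; refine Fin.cases ?_ (fun i => ?_) i <;> simp

theorem consE_sub (s t : ℝ) (y z : EuclideanSpace ℝ (Fin m)) :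
    consE (s - t) (y - z) = consE s y - consE t z := by
  ext i; refine Fin.cases ?_ (fun i => ?_) i <;> simp

theorem consE_smul (c s : ℝ) (y : EuclideanSpace ℝ (Fin m)) :
    consE (c * s) (c • y) = c • consE s y := by
  ext i; refine Fin.cases ?_ (fun i => ?_) i <;> simp

@[fun_prop] theorem Continuous.consE {X : Type*} [TopologicalSpace X] {a : X → ℝ}
    {b : X → EuclideanSpace ℝ (Fin m)} (ha : Continuous a) (hb : Continuous b) :
    Continuous fun x => consE (a x) (b x) := by
  refine (PiLp.continuous_toLp 2 _).comp (continuous_pi fun i => ?_)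
  refine Fin.cases ?_ (fun i => ?_) i
  · exact ha
  · exact (EuclideanSpace.proj (𝕜 := ℝ) i).continuous.comp hb

@[fun_prop] theorem continuous_tailE :
    Continuous (tailE : EuclideanSpace ℝ (Fin (m + 1)) → EuclideanSpace ℝ (Fin m)) := by
  refine (PiLp.continuous_toLp 2 _).comp (continuous_pi fun i => ?_)
  exact (EuclideanSpace.proj (𝕜 := ℝ) i.succ).continuous

theorem measurePreserving_consE :
    MeasurePreserving (fun p : ℝ × EuclideanSpace ℝ (Fin m) => consE p.1 p.2) := by
  have h1 := (volume_preserving_piFinSuccAbove (fun _ : Fin (m + 1) => ℝ) 0).symm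
  have h2 := PiLp.volume_preserving_toLp (Fin (m + 1))
  have h3 : MeasurePreserving (fun p : ℝ × EuclideanSpace ℝ (Fin m) => (p.1, p.2.ofLp)) :=
    (MeasurePreserving.id volume).prod (PiLp.volume_preserving_ofLp (Fin m))
  have h := h2.comp (h1.comp h3)
  convert! h using 1
  funext p
  ext i
  refine Fin.cases ?_ (fun i => ?_) i <;>
    simp [MeasurableEquiv.piFinSuccAbove_symm_apply, Fin.insertNthEquiv, Fin.insertNth_zero']

theorem measurableEmbedding_consE :
    MeasurableEmbedding (fun p : ℝ × EuclideanSpace ℝ (Fin m) => consE p.1 p.2) := by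
  have h1 : Continuous fun p : ℝ × EuclideanSpace ℝ (Fin m) => consE p.1 p.2 := by fun_prop
  have h2 : Continuous fun x : EuclideanSpace ℝ (Fin (m + 1)) => (x 0, tailE x) := by fun_prop
  exact MeasurableEquiv.measurableEmbedding
    (e := { toFun := fun p : ℝ × EuclideanSpace ℝ (Fin m) => consE p.1 p.2
            invFun := fun x => (x 0, tailE x)
            left_inv := fun p => by simp
            right_inv := fun x => by simp
            measurable_toFun := h1.measurable
            measurable_invFun := h2.measurable })

theorem lintegral_consE {f : EuclideanSpace ℝ (Fin (m + 1)) → ℝ≥0∞} (hf : Measurable f) :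
    ∫⁻ x, f x = ∫⁻ s : ℝ, ∫⁻ y, f (consE s y) := by
  rw [← measurePreserving_consE.lintegral_comp hf, Measure.volume_eq_prod, lintegral_prod]
  exact (hf.comp measurePreserving_consE.measurable).aemeasurable

theorem integral_consE {F : Type*} [NormedAddCommGroup F] [NormedSpace ℝ F]
    {f : EuclideanSpace ℝ (Fin (m + 1)) → F} (hf : Integrable f) :
    ∫ x, f x = ∫ y, ∫ s : ℝ, f (consE s y) := by
  rw [← measurePreserving_consE.integral_comp measurableEmbedding_consE, Measure.volume_eq_prod,
    integral_prod_symm]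
  exact (measurePreserving_consE.integrable_comp_emb measurableEmbedding_consE).2 hf

end consE

end

noncomputable section

/-! ### Fourier transforms of densities on graphs -/

/-- The character `x ↦ exp (-2πi⟨ξ, x⟩)`. -/
def fchar {V : Type*} [NormedAddCommGroup V] [InnerProductSpace ℝ V] (ξ x : V) : ℂ :=
  Complex.exp (((-(2 * Real.pi * inner ℝ ξ x) : ℝ) : ℂ) * Complex.I)

section fchar

variable {V : Type*} [NormedAddCommGroup V] [InnerProductSpace ℝ V]

@[simp] theorem norm_fchar (ξ x : V) : ‖fchar ξ x‖ = 1 := Complex.norm_exp_ofReal_mul_I _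

@[simp] theorem enorm_fchar (ξ x : V) : ‖fchar ξ x‖ₑ = 1 := by
  rw [← ofReal_norm, norm_fchar, ENNReal.ofReal_one]

theorem fchar_sub_left (ξ η x : V) : fchar (ξ - η) x = fchar ξ x * fchar (-η) x := by
  simp only [fchar, ← Complex.exp_add, ← add_mul, ← Complex.ofReal_add, inner_sub_left,
    inner_neg_left]
  congr 3; ring

theorem fchar_add_right (ξ x y : V) : fchar ξ (x + y) = fchar ξ x * fchar ξ y := by
  simp only [fchar, ← Complex.exp_add, ← add_mul, ← Complex.ofReal_add, inner_add_right]
  congr 3; ring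

theorem fchar_sub_right (ξ x y : V) : fchar ξ (x - y) = fchar ξ x * star (fchar ξ y) := by
  simp only [fchar, RCLike.star_def, ← Complex.exp_conj, map_mul, Complex.conj_ofReal,
    Complex.conj_I, ← Complex.exp_add, inner_sub_right]
  congr 1; push_cast; ring

@[fun_prop] theorem continuous_fchar {X : Type*} [TopologicalSpace X] {a b : X → V}
    (ha : Continuous a) (hb : Continuous b) : Continuous fun x => fchar (a x) (b x) := by
  unfold fchar; fun_prop

open FourierTransform in
theorem fourier_eq_integral_fchar [MeasurableSpace V] [BorelSpace V] [FiniteDimensional ℝ V]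
    (f : V → ℂ) (ξ : V) : 𝓕 f ξ = ∫ x, f x * fchar ξ x := by
  rw [Real.fourier_eq']
  refine integral_congr_ae (.of_forall fun x => ?_)
  simp only [fchar, smul_eq_mul]
  rw [mul_comm, real_inner_comm]
  congr 3
  push_cast; ring

/-- The Gaussian `exp (-π‖x‖²)` is its own Fourier transform. -/
theorem integral_gaussian_mul_fchar [MeasurableSpace V] [BorelSpace V] [FiniteDimensional ℝ V]
    (ξ : V) : ∫ x, (Real.exp (-Real.pi * ‖x‖ ^ 2) : ℂ) * fchar ξ x =
      (Real.exp (-Real.pi * ‖ξ‖ ^ 2) : ℂ) := by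
  have hπ : (Real.pi : ℂ) ≠ 0 := by exact_mod_cast Real.pi_ne_zero
  have h := fourier_gaussian_innerProductSpace (V := V) (b := (Real.pi : ℂ))
    (by simpa using Real.pi_pos) ξ
  rw [fourier_eq_integral_fchar] at h
  rw [div_self hπ, Complex.one_cpow, one_mul] at h
  push_cast
  rw [h]
  congr 1
  field_simp

theorem integrable_gaussian [MeasurableSpace V] [BorelSpace V] [FiniteDimensional ℝ V]
    {b : ℝ} (hb : 0 < b) : Integrable fun x : V => Real.exp (-b * ‖x‖ ^ 2) := by
  have h := (GaussianFourier.integrable_cexp_neg_mul_sq_norm_add (V := V)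
      (b := (b : ℂ)) (by simpa using hb) 0 0).norm
  refine h.congr (.of_forall fun x => ?_)
  simp only [Complex.norm_exp]
  simp [← Complex.ofReal_pow]

end fchar

/-- The Cauchy–Schwarz inequality for an integral against a finite measure. -/
theorem sq_lintegral_le {α : Type*} [MeasurableSpace α] (ν : Measure α) {u : α → ℝ≥0∞}
    (hu : AEMeasurable u ν) : (∫⁻ x, u x ∂ν) ^ 2 ≤ ν Set.univ * ∫⁻ x, u x ^ 2 ∂ν := by
  have h := ENNReal.lintegral_mul_le_Lp_mul_Lq ν Real.HolderConjugate.two_two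
    (f := fun _ => 1) aemeasurable_const hu
  simp only [Pi.mul_apply, one_mul, ENNReal.one_rpow, lintegral_one] at h
  calc (∫⁻ x, u x ∂ν) ^ 2
      ≤ (ν Set.univ ^ (1 / 2 : ℝ) * (∫⁻ x, u x ^ (2 : ℝ) ∂ν) ^ (1 / 2 : ℝ)) ^ 2 := by gcongr
    _ = _ := by
        rw [mul_pow, ← ENNReal.rpow_natCast, ← ENNReal.rpow_natCast, ← ENNReal.rpow_mul,
          ← ENNReal.rpow_mul]
        norm_num

theorem sq_lintegral_mul_le {α : Type*} [MeasurableSpace α] (μ : Measure α) {ρ u : α → ℝ≥0∞}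
    (hρ : Measurable ρ) (hu : Measurable u) :
    (∫⁻ x, ρ x * u x ∂μ) ^ 2 ≤ (∫⁻ x, ρ x ∂μ) * ∫⁻ x, ρ x * u x ^ 2 ∂μ := by
  have h := sq_lintegral_le (μ.withDensity ρ) hu.aemeasurable
  rwa [lintegral_withDensity_eq_lintegral_mul _ hρ hu,
    lintegral_withDensity_eq_lintegral_mul _ hρ (hu.pow_const 2), withDensity_apply _ .univ,
    setLIntegral_univ] at h

section Graph

variable {m : ℕ}

/-- The parametrization `y ↦ (h y, y)` of the graph of `h`. -/
def graphMap (h : EuclideanSpace ℝ (Fin m) → ℝ) (y : EuclideanSpace ℝ (Fin m)) :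
    EuclideanSpace ℝ (Fin (m + 1)) := consE (h y) y

@[fun_prop] theorem continuous_graphMap {h : EuclideanSpace ℝ (Fin m) → ℝ} (hh : Continuous h) :
    Continuous (graphMap h) := by
  unfold graphMap; fun_prop

/-- The Fourier transform of the measure on the graph of `h` whose density with respect to the
Lebesgue measure of the parameter domain is `A`. -/
def graphFourier (h : EuclideanSpace ℝ (Fin m) → ℝ) (A : EuclideanSpace ℝ (Fin m) → ℂ)
    (ξ : EuclideanSpace ℝ (Fin (m + 1))) : ℂ :=
  ∫ y, A y * fchar ξ (graphMap h y)

variable {h : EuclideanSpace ℝ (Fin m) → ℝ} {A : EuclideanSpace ℝ (Fin m) → ℂ}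

theorem integrable_mul_fchar (hh : Continuous h) (hA : Integrable A)
    (ξ : EuclideanSpace ℝ (Fin (m + 1))) :
    Integrable fun y => A y * fchar ξ (graphMap h y) := by
  refine hA.mono (hA.aestronglyMeasurable.mul
    (by fun_prop : Continuous _).aestronglyMeasurable) (.of_forall fun y => ?_)
  simp

theorem continuous_graphFourier (hh : Continuous h) (hA : Integrable A) :
    Continuous (graphFourier h A) := by
  refine continuous_of_dominated (bound := fun y => ‖A y‖)
    (fun ξ => (integrable_mul_fchar hh hA ξ).aestronglyMeasurable)
    (fun ξ => .of_forall fun y => by simp) hA.norm (.of_forall fun y => ?_)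
  fun_prop

/-- Plancherel's identity in the variables other than the first one. -/
theorem lintegral_enorm_sq_graphFourier (hh : Continuous h) (hA : Integrable A) (hA2 : MemLp A 2)
    (s : ℝ) : ∫⁻ v, ‖graphFourier h A (consE s v)‖ₑ ^ 2 = ∫⁻ y, ‖A y‖ₑ ^ 2 := by
  set e : EuclideanSpace ℝ (Fin m) → ℂ :=
    fun y => Complex.exp (((-(2 * Real.pi * (s * h y)) : ℝ) : ℂ) * Complex.I) with he
  have hen : ∀ y, ‖e y‖ = 1 := fun y => Complex.norm_exp_ofReal_mul_I _
  have hec : Continuous e := by fun_prop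
  have h1 : Integrable fun y => A y * e y :=
    hA.mono (hA.aestronglyMeasurable.mul hec.aestronglyMeasurable) (.of_forall fun y => by simp [hen])
  have h2 : MemLp (fun y => A y * e y) 2 :=
    hA2.mono (hA.aestronglyMeasurable.mul hec.aestronglyMeasurable) (.of_forall fun y => by simp [hen])
  have h3 := lintegral_enorm_sq_fourier h1 h2
  calc ∫⁻ v, ‖graphFourier h A (consE s v)‖ₑ ^ 2
      = ∫⁻ v, ‖FourierTransform.fourier (fun y => A y * e y) v‖ₑ ^ 2 := by
        refine lintegral_congr fun v => ?_
        rw [fourier_eq_integral_fchar, graphFourier]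
        congr 3
        funext y
        simp only [he, fchar, graphMap, inner_consE_consE, mul_assoc, ← Complex.exp_add]
        congr 2
        push_cast; ring
    _ = _ := by
        rw [h3]
        refine lintegral_congr fun y => ?_
        rw [enorm_mul, ← ofReal_norm (e y), hen]; simp

/-- Inserting a Gaussian exhibits the Fourier transform as an average at unit scale. -/
theorem graphFourier_eq_integral (hh : Continuous h)
    (hA : Integrable fun y => A y * (Real.exp (Real.pi * ‖graphMap h y‖ ^ 2) : ℂ))
    (ξ : EuclideanSpace ℝ (Fin (m + 1))) :
    graphFourier h A ξ = ∫ η, (Real.exp (-Real.pi * ‖ξ - η‖ ^ 2) : ℂ) *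
      graphFourier h (fun y => A y * (Real.exp (Real.pi * ‖graphMap h y‖ ^ 2) : ℂ)) η := by
  set B : EuclideanSpace ℝ (Fin m) → ℂ :=
    fun y => A y * (Real.exp (Real.pi * ‖graphMap h y‖ ^ 2) : ℂ) with hB
  have hg : Integrable fun η : EuclideanSpace ℝ (Fin (m + 1)) =>
      (Real.exp (-Real.pi * ‖ξ - η‖ ^ 2) : ℂ) :=
    ((integrable_gaussian Real.pi_pos).comp_sub_left ξ).ofReal
  have hF : Integrable (Function.uncurry fun (η : EuclideanSpace ℝ (Fin (m + 1)))
      (y : EuclideanSpace ℝ (Fin m)) => (Real.exp (-Real.pi * ‖ξ - η‖ ^ 2) : ℂ) *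
        (B y * fchar η (graphMap h y))) := by
    have h1 := hg.mul_prod hA
    refine h1.mono ?_ (.of_forall fun p => ?_)
    · have h2 : Continuous fun p : EuclideanSpace ℝ (Fin (m + 1)) × EuclideanSpace ℝ (Fin m) =>
          fchar p.1 (graphMap h p.2) :=
        continuous_fchar continuous_fst ((continuous_graphMap hh).comp continuous_snd)
      refine (h1.aestronglyMeasurable.mul h2.aestronglyMeasurable).congr (.of_forall fun p => ?_)
      simp [Function.uncurry, mul_assoc]
    · simp [Function.uncurry]
  symm
  calc ∫ η, (Real.exp (-Real.pi * ‖ξ - η‖ ^ 2) : ℂ) * graphFourier h B η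
      = ∫ η, ∫ y, (Real.exp (-Real.pi * ‖ξ - η‖ ^ 2) : ℂ) * (B y * fchar η (graphMap h y)) := by
        refine integral_congr_ae (.of_forall fun η => ?_)
        simp only [graphFourier, integral_const_mul]
    _ = ∫ y, ∫ η, (Real.exp (-Real.pi * ‖ξ - η‖ ^ 2) : ℂ) * (B y * fchar η (graphMap h y)) :=
        integral_integral_swap hF
    _ = _ := by
        refine integral_congr_ae (.of_forall fun y => ?_)
        have h1 : ∫ η, (Real.exp (-Real.pi * ‖ξ - η‖ ^ 2) : ℂ) * fchar η (graphMap h y) =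
            fchar ξ (graphMap h y) * (Real.exp (-Real.pi * ‖graphMap h y‖ ^ 2) : ℂ) := by
          rw [← integral_sub_left_eq_self _ _ ξ]
          simp only [sub_sub_cancel, fchar_sub_left ξ]
          have h2 := integral_gaussian_mul_fchar (-graphMap h y)
          rw [norm_neg] at h2
          rw [← h2, ← integral_const_mul]
          refine integral_congr_ae (.of_forall fun u => ?_)
          have : fchar (-u) (graphMap h y) = fchar (-graphMap h y) u := by
            simp [fchar, real_inner_comm]
          simp only [this]; ring
        calc ∫ η, (Real.exp (-Real.pi * ‖ξ - η‖ ^ 2) : ℂ) * (B y * fchar η (graphMap h y))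
            = B y * ∫ η, (Real.exp (-Real.pi * ‖ξ - η‖ ^ 2) : ℂ) * fchar η (graphMap h y) := by
              rw [← integral_const_mul]
              refine integral_congr_ae (.of_forall fun η => ?_)
              ring
          _ = A y * fchar ξ (graphMap h y) := by
              rw [h1]
              have h3 : (Real.exp (Real.pi * ‖graphMap h y‖ ^ 2) : ℂ) *
                  (Real.exp (-Real.pi * ‖graphMap h y‖ ^ 2) : ℂ) = 1 := by
                rw [← Complex.ofReal_mul, ← Real.exp_add]; simp
              simp only [hB]
              linear_combination A y * fchar ξ (graphMap h y) * h3

/-- A weight which localizes the first coordinate to an interval of length `O(R)`. -/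
theorem exists_lintegral_slab_le : ∃ C : ℝ≥0, ∀ R : ℝ, 1 ≤ R →
    ∫⁻ s : ℝ, ENNReal.ofReal (Real.exp (-(Real.pi / 2) * max (|s| - R) 0 ^ 2)) ≤
      C * ENNReal.ofReal R := by
  set g : ℝ → ℝ≥0∞ := fun s => ENNReal.ofReal (Real.exp (-(Real.pi / 2) * s ^ 2)) with hg
  have hgi : ∫⁻ s, g s ≠ ⊤ := by
    have h : Integrable fun s : ℝ => Real.exp (-(Real.pi / 2) * s ^ 2) :=
      integrable_exp_neg_mul_sq (by positivity)
    rw [← ofReal_integral_eq_lintegral_ofReal h (.of_forall fun s => (Real.exp_pos _).le)]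
    exact ENNReal.ofReal_ne_top
  have hgm : Measurable g := by fun_prop
  set I := ∫⁻ s, g s with hI
  refine ⟨(2 + 2 * I).toNNReal, fun R hR => ?_⟩
  rw [ENNReal.coe_toNNReal (by finiteness)]
  have hpt : ∀ s : ℝ, ENNReal.ofReal (Real.exp (-(Real.pi / 2) * max (|s| - R) 0 ^ 2)) ≤
      (Set.Icc (-R) R).indicator 1 s + (g (s - R) + g (s + R)) := by
    intro s
    by_cases hs : s ∈ Set.Icc (-R) R
    · rw [Set.indicator_of_mem hs]
      refine le_trans ?_ le_self_add
      rw [Pi.one_apply, ENNReal.ofReal_le_one, Real.exp_le_one_iff]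
      have := Real.pi_pos
      have := sq_nonneg (max (|s| - R) 0)
      nlinarith
    · rw [Set.indicator_of_notMem hs, zero_add]
      have h1 : R < |s| := by
        by_contra hc
        exact hs (abs_le.1 (not_lt.1 hc))
      rw [max_eq_left (by linarith)]
      rcases abs_cases s with ⟨h2, _⟩ | ⟨h2, _⟩
      · rw [h2]; exact le_self_add
      · rw [h2]
        have : (-s - R) ^ 2 = (s + R) ^ 2 := by ring
        rw [this]; exact le_add_self
  calc _ ≤ ∫⁻ s : ℝ, (Set.Icc (-R) R).indicator 1 s + (g (s - R) + g (s + R)) :=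
        lintegral_mono hpt
    _ = ENNReal.ofReal (2 * R) + (I + I) := by
        rw [lintegral_add_left (measurable_one.indicator measurableSet_Icc),
          lintegral_add_left (by fun_prop), lintegral_indicator_one measurableSet_Icc,
          Real.volume_Icc, lintegral_sub_right_eq_self, lintegral_add_right_eq_self]
        congr 2; ring
    _ ≤ _ := by
        have h1 : (1 : ℝ≥0∞) ≤ ENNReal.ofReal R := by simpa using ENNReal.ofReal_le_ofReal hR
        rw [add_mul, ENNReal.ofReal_mul (by norm_num), ← two_mul]
        exact add_le_add (by simp) (le_mul_of_one_le_right zero_le h1)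

/-- Averages of the Fourier transform over spheres of radius `R` lose at most a factor `R` over
the decay `R⁻ᵐ`. No regularity of the density enters: the average over the sphere is controlled by
the integral over a neighbourhood of it, which meets `O(R)` unit slabs orthogonal to the first
axis, and Plancherel's identity holds in each of them. -/
theorem exists_lintegral_graphFourier_le (hm : 1 ≤ m) (hh : Continuous h) (L : ℝ) : ∃ C : ℝ≥0,
    ∀ A : EuclideanSpace ℝ (Fin m) → ℂ, Integrable A → MemLp A 2 →
      (∀ y, L < ‖y‖ → A y = 0) → ∀ ξ : EuclideanSpace ℝ (Fin (m + 1)), 1 ≤ ‖ξ‖ →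
      ∫⁻ θ, ‖graphFourier h A (SO.rotate θ ξ)‖ₑ ^ 2 ∂SO.haar (m + 1) ≤
        C * ENNReal.ofReal (‖ξ‖ * (‖ξ‖ ^ m)⁻¹) * ∫⁻ y, ‖A y‖ₑ ^ 2 := by
  obtain ⟨C₁, hC₁⟩ := SO.exists_lintegral_gaussian_le hm
  obtain ⟨C₂, hC₂⟩ := exists_lintegral_slab_le
  obtain ⟨M, hM⟩ := (isCompact_closedBall (0 : EuclideanSpace ℝ (Fin m)) L).exists_bound_of_continuousOn
    (f := fun y => Real.exp (Real.pi * ‖graphMap h y‖ ^ 2)) (by fun_prop)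
  have hM' : ∀ y : EuclideanSpace ℝ (Fin m), ‖y‖ ≤ L →
      Real.exp (Real.pi * ‖graphMap h y‖ ^ 2) ≤ M := fun y hy => by
    have := hM y (by simpa using hy)
    rwa [Real.norm_of_nonneg (Real.exp_pos _).le] at this
  refine ⟨C₁ * C₂ * (M ^ 2).toNNReal, fun A hA hA2 hAL ξ hξ => ?_⟩
  set R := ‖ξ‖ with hR
  -- on the support of `A` the inserted Gaussian can be divided out again
  set B : EuclideanSpace ℝ (Fin m) → ℂ :=
    fun y => A y * (Real.exp (Real.pi * ‖graphMap h y‖ ^ 2) : ℂ) with hB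
  have hBm : AEStronglyMeasurable B volume :=
    hA.aestronglyMeasurable.mul (by fun_prop : Continuous fun y =>
      (Real.exp (Real.pi * ‖graphMap h y‖ ^ 2) : ℂ)).aestronglyMeasurable
  have hBA : ∀ y, ‖B y‖ ≤ M * ‖A y‖ := by
    intro y
    by_cases hy : ‖y‖ ≤ L
    · rw [hB, norm_mul, Complex.norm_real, Real.norm_of_nonneg (Real.exp_pos _).le, mul_comm]
      gcongr; exact hM' y hy
    · simp [hB, hAL y (not_le.1 hy)]
  have hBi : Integrable B := (hA.norm.const_mul M).mono' hBm (.of_forall hBA)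
  have hB2 : MemLp B 2 := hA2.of_le_mul hBm (.of_forall hBA)
  have hBsq : ∫⁻ y, ‖B y‖ₑ ^ 2 ≤ ENNReal.ofReal (M ^ 2) * ∫⁻ y, ‖A y‖ₑ ^ 2 := by
    rw [← lintegral_const_mul' _ _ ENNReal.ofReal_ne_top]
    refine lintegral_mono fun y => ?_
    simp only [← ofReal_norm]
    rw [← ENNReal.ofReal_pow (norm_nonneg _), ← ENNReal.ofReal_pow (norm_nonneg _),
      ← ENNReal.ofReal_mul (sq_nonneg _), ← mul_pow]
    exact ENNReal.ofReal_le_ofReal (pow_le_pow_left₀ (norm_nonneg _) (hBA y) 2)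
  set U := graphFourier h B with hU
  have hUc : Continuous U := continuous_graphFourier hh hBi
  have hUm : Measurable fun η => ‖U η‖ₑ := hUc.measurable.enorm
  set ρ : EuclideanSpace ℝ (Fin (m + 1)) → ℝ≥0∞ :=
    fun x => ENNReal.ofReal (Real.exp (-Real.pi * ‖x‖ ^ 2)) with hρ
  have hρc : Continuous ρ := ENNReal.continuous_ofReal.comp (by fun_prop)
  have hρ1 : ∫⁻ x, ρ x = 1 := by
    rw [← ofReal_integral_eq_lintegral_ofReal (integrable_gaussian Real.pi_pos)
      (.of_forall fun s => (Real.exp_pos _).le)]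
    have h1 := integral_gaussian_mul_fchar (0 : EuclideanSpace ℝ (Fin (m + 1)))
    simp only [fchar, inner_zero_left, mul_zero, neg_zero, Complex.ofReal_zero, zero_mul,
      Complex.exp_zero, mul_one, norm_zero, ne_eq, OfNat.ofNat_ne_zero, not_false_eq_true,
      zero_pow, Real.exp_zero, integral_complex_ofReal] at h1
    have h2 : (∫ x : EuclideanSpace ℝ (Fin (m + 1)), Real.exp (-Real.pi * ‖x‖ ^ 2)) = 1 := by
      exact_mod_cast h1
    rw [h2, ENNReal.ofReal_one]
  -- the Cauchy–Schwarz inequality for the Gaussian average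
  have hstep : ∀ ζ, ‖graphFourier h A ζ‖ₑ ^ 2 ≤ ∫⁻ η, ρ (ζ - η) * ‖U η‖ₑ ^ 2 := by
    intro ζ
    rw [graphFourier_eq_integral hh hBi]
    calc _ ≤ (∫⁻ η, ρ (ζ - η) * ‖U η‖ₑ) ^ 2 := by
          gcongr
          refine (enorm_integral_le_lintegral_enorm _).trans (lintegral_mono fun η => ?_)
          rw [enorm_mul]
          gcongr
          rw [hρ, ← ofReal_norm, Complex.norm_real, Real.norm_of_nonneg (Real.exp_pos _).le]
      _ ≤ (∫⁻ η, ρ (ζ - η)) * ∫⁻ η, ρ (ζ - η) * ‖U η‖ₑ ^ 2 :=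
          sq_lintegral_mul_le _ (hρc.comp (by fun_prop)).measurable hUm
      _ = _ := by rw [lintegral_sub_left_eq_self, hρ1, one_mul]
  -- half of the Gaussian is spent on the decay off the slab `|s| ≤ R`, the other half on the
  -- average over the sphere
  set w : ℝ → ℝ≥0∞ :=
    fun s => ENNReal.ofReal (Real.exp (-(Real.pi / 2) * max (|s| - R) 0 ^ 2)) with hw
  have hwm : Measurable w := by
    refine (ENNReal.continuous_ofReal.comp ?_).measurable
    fun_prop
  have hW : ∀ η : EuclideanSpace ℝ (Fin (m + 1)),
      ∫⁻ θ, ρ (SO.rotate θ ξ - η) ∂SO.haar (m + 1) ≤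
        w (η 0) * (C₁ * ENNReal.ofReal (R ^ m)⁻¹) := by
    intro η
    refine le_trans ?_ (mul_le_mul_right (hC₁ ξ η hξ) _)
    rw [← lintegral_const_mul' _ _ ENNReal.ofReal_ne_top]
    refine lintegral_mono fun θ => ?_
    rw [← ENNReal.ofReal_mul (Real.exp_pos _).le, ← Real.exp_add]
    refine ENNReal.ofReal_le_ofReal (Real.exp_le_exp.2 ?_)
    have h1 : |η 0| ≤ ‖η‖ := by simpa using PiLp.norm_apply_le η 0
    have h2 : ‖η‖ ≤ ‖SO.rotate θ ξ‖ + ‖SO.rotate θ ξ - η‖ := by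
      have := norm_sub_le (SO.rotate θ ξ) (SO.rotate θ ξ - η)
      rwa [sub_sub_cancel] at this
    rw [SO.norm_rotate] at h2
    have h3 : max (|η 0| - R) 0 ≤ ‖SO.rotate θ ξ - η‖ :=
      max_le (by linarith) (norm_nonneg _)
    have h4 : max (|η 0| - R) 0 ^ 2 ≤ ‖SO.rotate θ ξ - η‖ ^ 2 :=
      pow_le_pow_left₀ (le_max_right _ _) h3 2
    have := Real.pi_pos
    nlinarith
  calc ∫⁻ θ, ‖graphFourier h A (SO.rotate θ ξ)‖ₑ ^ 2 ∂SO.haar (m + 1)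
      ≤ ∫⁻ θ, ∫⁻ η, ρ (SO.rotate θ ξ - η) * ‖U η‖ₑ ^ 2 ∂volume ∂SO.haar (m + 1) :=
        lintegral_mono fun θ => hstep _
    _ = ∫⁻ η, ∫⁻ θ, ρ (SO.rotate θ ξ - η) * ‖U η‖ₑ ^ 2 ∂SO.haar (m + 1) := by
        refine lintegral_lintegral_swap (Measurable.aemeasurable ?_)
        refine Measurable.mul ?_ ((hUm.comp measurable_snd).pow_const 2)
        exact (hρc.comp (by fun_prop)).measurable
    _ ≤ ∫⁻ η, w (η 0) * (C₁ * ENNReal.ofReal (R ^ m)⁻¹) * ‖U η‖ₑ ^ 2 := by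
        refine lintegral_mono fun η => ?_
        rw [lintegral_mul_const' _ _ (by finiteness)]
        gcongr
        exact hW η
    _ = ∫⁻ s, w s * (C₁ * ENNReal.ofReal (R ^ m)⁻¹) * ∫⁻ y, ‖B y‖ₑ ^ 2 := by
        rw [lintegral_consE]
        · refine lintegral_congr fun s => ?_
          simp only [consE_zero]
          have h1 : Measurable fun y => ‖U (consE s y)‖ₑ :=
            hUm.comp (by fun_prop : Continuous fun y => consE s y).measurable
          rw [lintegral_const_mul _ (h1.pow_const 2), lintegral_enorm_sq_graphFourier hh hBi hB2]
        · refine Measurable.mul ((hwm.comp ?_).mul_const _) (hUm.pow_const 2)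
          exact (by fun_prop : Continuous fun η : EuclideanSpace ℝ (Fin (m + 1)) => η 0).measurable
    _ ≤ (C₂ * ENNReal.ofReal R) * (C₁ * ENNReal.ofReal (R ^ m)⁻¹) *
          (ENNReal.ofReal (M ^ 2) * ∫⁻ y, ‖A y‖ₑ ^ 2) := by
        simp only [mul_assoc (w _)]
        rw [lintegral_mul_const _ hwm, mul_assoc (_ * _)]
        exact mul_le_mul' (hC₂ R hξ) (mul_le_mul' le_rfl hBsq)
    _ = _ := by
        have h1 : ENNReal.ofReal (M ^ 2) = ((M ^ 2).toNNReal : ℝ≥0∞) := rfl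
        rw [ENNReal.ofReal_mul (by positivity), h1]
        push_cast
        ring

end Graph

end

noncomputable section

/-! ### Averaged decay in tangential directions -/

theorem ENNReal.add_sq_le_two_mul (a b : ℝ≥0∞) : (a + b) ^ 2 ≤ 2 * a ^ 2 + 2 * b ^ 2 := by
  have h := ENNReal.rpow_add_le_mul_rpow_add_rpow a b (p := 2) one_le_two
  norm_num at h
  rwa [mul_add] at h

theorem norm_exp_mul_I_sub_exp_mul_I_le (a b : ℝ) :
    ‖Complex.exp (a * Complex.I) - Complex.exp (b * Complex.I)‖ ≤ |a - b| := by
  have h : Complex.exp (a * Complex.I) - Complex.exp (b * Complex.I) =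
      Complex.exp (b * Complex.I) * (Complex.exp (Complex.I * (a - b : ℝ)) - 1) := by
    rw [mul_sub, ← Complex.exp_add, mul_one]
    congr 2; push_cast; ring
  rw [h, norm_mul, Complex.norm_exp_ofReal_mul_I, one_mul]
  simpa using Real.norm_exp_I_mul_ofReal_sub_one_le (x := a - b)

theorem half_abs_le_norm_one_sub_exp {x : ℝ} (hx : |x| ≤ 1) :
    |x| / 2 ≤ ‖1 - Complex.exp ((-x : ℝ) * Complex.I)‖ := by
  rw [norm_sub_rev, mul_comm, Complex.norm_exp_I_mul_ofReal_sub_one, norm_mul, Real.norm_eq_abs,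
    Real.norm_eq_abs, abs_two]
  have h2 : |-x / 2| = |x| / 2 := by rw [abs_div, abs_neg, abs_two]
  have h1 := Real.mul_abs_le_abs_sin (x := -x / 2) (by rw [h2]; linarith [Real.pi_gt_three])
  rw [h2] at h1
  have h3 : 1 / 2 ≤ 2 / Real.pi := by
    rw [div_le_div_iff₀ two_pos Real.pi_pos]; linarith [Real.pi_le_four]
  nlinarith [abs_nonneg x, mul_le_mul_of_nonneg_right h3 (abs_nonneg x)]

section Tangential

variable {m : ℕ}

/-- The measure of the symmetric difference of a ball and its translate is at most proportional to
the length of the translation. -/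
theorem exists_lintegral_indicator_ball_sub_le {L : ℝ} (hL : 1 ≤ L) : ∃ C : ℝ≥0,
    ∀ τ : EuclideanSpace ℝ (Fin m), ‖τ‖ ≤ 1 →
      ∫⁻ y, ‖(Metric.closedBall 0 L).indicator (1 : EuclideanSpace ℝ (Fin m) → ℂ) y -
        (Metric.closedBall 0 L).indicator (1 : EuclideanSpace ℝ (Fin m) → ℂ) (y - τ)‖ₑ ≤
        C * ENNReal.ofReal ‖τ‖ := by
  set Y := EuclideanSpace ℝ (Fin m)
  refine ⟨Real.toNNReal (2 * (m * (L + 1) ^ (m - 1))) *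
    (volume (Metric.ball (0 : Y) 1)).toNNReal, fun τ hτ => ?_⟩
  set t := ‖τ‖
  have ht : 0 ≤ t := norm_nonneg _
  set D : Set Y := Metric.closedBall 0 (L + t) \ Metric.closedBall 0 (L - t)
  have h1 : ∀ y, ‖(Metric.closedBall 0 L).indicator (1 : Y → ℂ) y -
      (Metric.closedBall 0 L).indicator (1 : Y → ℂ) (y - τ)‖ₑ ≤ D.indicator 1 y := by
    intro y
    have n1 : ‖y‖ ≤ ‖y - τ‖ + t := by simpa using norm_add_le (y - τ) τ
    have n2 : ‖y - τ‖ ≤ ‖y‖ + t := norm_sub_le _ _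
    by_cases ha : ‖y‖ ≤ L <;> by_cases hb : ‖y - τ‖ ≤ L <;>
      simp only [Set.indicator, Metric.mem_closedBall, dist_zero_right, ha, hb, if_true, if_false,
        sub_self, enorm_zero, zero_le, Pi.one_apply, sub_zero, zero_sub, enorm_neg, enorm_one]
    · rw [if_pos]; refine ⟨?_, ?_⟩ <;> simp only [Metric.mem_closedBall, dist_zero_right] <;> linarith
    · rw [if_pos]; refine ⟨?_, ?_⟩ <;> simp only [Metric.mem_closedBall, dist_zero_right] <;> linarith
  calc _ ≤ ∫⁻ y, D.indicator 1 y := lintegral_mono h1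
    _ = volume D := lintegral_indicator_one
        (measurableSet_closedBall.diff measurableSet_closedBall)
    _ = volume (Metric.closedBall (0 : Y) (L + t)) - volume (Metric.closedBall (0 : Y) (L - t)) :=
        measure_sdiff (Metric.closedBall_subset_closedBall (by linarith))
          measurableSet_closedBall.nullMeasurableSet measure_closedBall_lt_top.ne
    _ = ENNReal.ofReal ((L + t) ^ m - (L - t) ^ m) * volume (Metric.ball (0 : Y) 1) := by
        rw [Measure.addHaar_closedBall _ _ (by linarith), Measure.addHaar_closedBall _ _ (by linarith),
          finrank_euclideanSpace_fin, ← ENNReal.sub_mul (fun _ _ => measure_ball_lt_top.ne),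
          ENNReal.ofReal_sub _ (by have : 0 ≤ L - t := by linarith
                                   positivity)]
    _ ≤ ENNReal.ofReal (2 * (m * (L + 1) ^ (m - 1)) * t) * volume (Metric.ball (0 : Y) 1) := by
        gcongr
        have h := abs_pow_sub_pow_le (L + t) (L - t) m
        rw [abs_of_nonneg (a := L + t) (by linarith), abs_of_nonneg (a := L - t) (by linarith),
          max_eq_left (by linarith)] at h
        have e : |L + t - (L - t)| = 2 * t := by rw [abs_of_nonneg] <;> linarith
        rw [e] at h
        have : (L + t) ^ (m - 1) ≤ (L + 1) ^ (m - 1) := by gcongr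
        calc _ ≤ _ := (le_abs_self _).trans h
          _ ≤ 2 * t * m * (L + 1) ^ (m - 1) := by gcongr
          _ = _ := by ring
    _ = _ := by
        rw [ENNReal.coe_mul, ENNReal.coe_toNNReal measure_ball_lt_top.ne,
          ENNReal.ofReal_mul (by positivity), mul_right_comm]
        rfl

/-- The normalized densities to which the bootstrap argument applies: supported in a ball, bounded
by one, and almost invariant under the translation by `τ` in `L¹`. The modulus is measured in terms
of that of the ball itself, and the constant `2` leaves room for the class to be reproduced by
`Admissible.mul_exp`. -/
structure Admissible (L : ℝ) (τ : EuclideanSpace ℝ (Fin m)) (A : EuclideanSpace ℝ (Fin m) → ℂ) :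
    Prop where
  measurable : Measurable A
  norm_le : ∀ y, ‖A y‖ ≤ 1
  eq_zero : ∀ y, L < ‖y‖ → A y = 0
  lintegral_le : ∫⁻ y, ‖A y - A (y - τ)‖ₑ ≤
    2 * ∫⁻ y, ‖(Metric.closedBall 0 L).indicator (1 : EuclideanSpace ℝ (Fin m) → ℂ) y -
        (Metric.closedBall 0 L).indicator (1 : EuclideanSpace ℝ (Fin m) → ℂ) (y - τ)‖ₑ

variable {L : ℝ} {τ : EuclideanSpace ℝ (Fin m)} {A : EuclideanSpace ℝ (Fin m) → ℂ}
  {h : EuclideanSpace ℝ (Fin m) → ℝ}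

theorem enorm_le_indicator (hA : ∀ y, ‖A y‖ ≤ 1) (hA0 : ∀ y, L < ‖y‖ → A y = 0)
    (y : EuclideanSpace ℝ (Fin m)) : ‖A y‖ₑ ≤ (Metric.closedBall 0 L).indicator 1 y := by
  by_cases hy : ‖y‖ ≤ L
  · rw [Set.indicator_of_mem (by simpa using hy), Pi.one_apply, ← ofReal_norm]
    exact ENNReal.ofReal_le_one.2 (hA y)
  · simp [hA0 y (not_le.1 hy)]

theorem memLp_of_norm_le_one (hm : Measurable A) (hA : ∀ y, ‖A y‖ ≤ 1)
    (hA0 : ∀ y, L < ‖y‖ → A y = 0) (p : ℝ≥0∞) : MemLp A p := by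
  have h1 : MemLp ((Metric.closedBall (0 : EuclideanSpace ℝ (Fin m)) L).indicator
      fun _ => (1 : ℝ)) p :=
    memLp_indicator_const p measurableSet_closedBall 1 (.inr measure_closedBall_lt_top.ne)
  refine h1.mono hm.aestronglyMeasurable (.of_forall fun y => ?_)
  by_cases hy : ‖y‖ ≤ L
  · rw [Set.indicator_of_mem (by simpa using hy)]; simpa using hA y
  · simp [hA0 y (not_le.1 hy)]

theorem Admissible.memLp (hA : Admissible L τ A) (p : ℝ≥0∞) : MemLp A p :=
  memLp_of_norm_le_one hA.measurable hA.norm_le hA.eq_zero p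

theorem Admissible.integrable (hA : Admissible L τ A) : Integrable A :=
  memLp_one_iff_integrable.1 (hA.memLp 1)

theorem admissible_indicator :
    Admissible L τ ((Metric.closedBall 0 L).indicator (1 : EuclideanSpace ℝ (Fin m) → ℂ)) where
  measurable := measurable_one.indicator measurableSet_closedBall
  norm_le y := by
    by_cases hy : y ∈ Metric.closedBall 0 L <;> simp [hy]
  eq_zero y hy := by simp [hy]
  lintegral_le := le_mul_of_one_le_left (zero_le) one_le_two

/-- Concavity makes the increments of `h` monotone, so that the translation modulus of their
product with an admissible density is controlled by that of the ball. -/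
theorem Admissible.mul_exp {η c : ℝ} (hη : 0 < η) (hη1 : η ≤ 1) (hA : Admissible L τ A)
    (hconc : ConcaveOn ℝ Set.univ h) (hh : Continuous h) (hc : 0 < c)
    (hlip : ∀ y, |c * (h (y + τ) - h y)| ≤ η) {s : ℝ} (hs : |s| ≤ 1) :
    Admissible L τ fun y => ((2 * η)⁻¹ : ℝ) * (A y * ((c * (h (y + τ) - h y) : ℝ) *
      Complex.exp ((-(s * (c * (h (y + τ) - h y))) : ℝ) * Complex.I))) := by
  set κ : EuclideanSpace ℝ (Fin m) → ℝ := fun y => c * (h (y + τ) - h y) with hκ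
  set β : EuclideanSpace ℝ (Fin m) → ℂ := fun y => (κ y : ℂ) * Complex.exp ((-(s * κ y) : ℝ) * Complex.I) with hβ
  have hκc : Continuous κ := by fun_prop
  have hβc : Continuous β := by fun_prop
  have hβn : ∀ y, ‖β y‖ ≤ η := fun y => by
    simp only [hβ, norm_mul, Complex.norm_exp_ofReal_mul_I, mul_one, Complex.norm_real]
    exact hlip y
  have hβd : ∀ y z, ‖β y - β z‖ ≤ 2 * |κ y - κ z| := fun y z => by
    have e : β y - β z = ((κ y - κ z : ℝ) : ℂ) * Complex.exp ((-(s * κ y) : ℝ) * Complex.I) +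
        (κ z : ℂ) * (Complex.exp ((-(s * κ y) : ℝ) * Complex.I) -
          Complex.exp ((-(s * κ z) : ℝ) * Complex.I)) := by
      simp only [hβ]; push_cast; ring
    rw [e]
    refine (norm_add_le _ _).trans ?_
    rw [norm_mul, norm_mul, Complex.norm_exp_ofReal_mul_I, mul_one, Complex.norm_real,
      Complex.norm_real, Real.norm_eq_abs, Real.norm_eq_abs]
    have h1 := norm_exp_mul_I_sub_exp_mul_I_le (-(s * κ y)) (-(s * κ z))
    have h2 : |-(s * κ y) - -(s * κ z)| ≤ |κ y - κ z| := by
      have : -(s * κ y) - -(s * κ z) = -s * (κ y - κ z) := by ring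
      rw [this, abs_mul, abs_neg]
      exact mul_le_of_le_one_left (abs_nonneg _) hs
    have h3 : |κ z| ≤ 1 := (hlip z).trans hη1
    calc |κ y - κ z| + |κ z| * ‖_‖ ≤ |κ y - κ z| + 1 * |κ y - κ z| := by
          gcongr; exact h1.trans h2
      _ = _ := by ring
  have hmono : ∀ z, κ (z + τ) ≤ κ z := fun z => by
    have h1 := hconc.2 (Set.mem_univ z) (Set.mem_univ (z + τ + τ))
      (by norm_num : (0 : ℝ) ≤ 1 / 2) (by norm_num : (0 : ℝ) ≤ 1 / 2) (by norm_num)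
    have e : (1 / 2 : ℝ) • z + (1 / 2 : ℝ) • (z + τ + τ) = z + τ := by module
    rw [e] at h1
    simp only [smul_eq_mul] at h1
    exact mul_le_mul_of_nonneg_left (by linarith) hc.le
  set B : Set (EuclideanSpace ℝ (Fin m)) := Metric.closedBall 0 L
  set χ : EuclideanSpace ℝ (Fin m) → ℂ := B.indicator 1 with hχ
  set K := ∫⁻ y, ‖χ y - χ (y - τ)‖ₑ with hK
  have hAm := hA.measurable
  have hχm : Measurable χ := measurable_one.indicator measurableSet_closedBall
  -- the total decrease of `κ` over the ball telescopes to a boundary term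
  have hdec : ∫⁻ y, B.indicator 1 (y - τ) * ENNReal.ofReal |κ y - κ (y - τ)| ≤
      ENNReal.ofReal η * K := by
    set χ' : EuclideanSpace ℝ (Fin m) → ℝ := B.indicator 1 with hχ'
    have hχi : Integrable χ' := (integrable_indicator_iff measurableSet_closedBall).2
      (integrableOn_const measure_closedBall_lt_top.ne)
    have i1 : Integrable fun z => χ' z * κ z :=
      hχi.mul_bdd (c := η) hκc.aestronglyMeasurable (.of_forall fun z => hlip z)
    have i2 : Integrable fun z => χ' z * κ (z + τ) :=
      hχi.mul_bdd (c := η) (by fun_prop : Continuous _).aestronglyMeasurable (.of_forall fun z => hlip _)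
    have i3 : Integrable fun z => χ' (z - τ) * κ z := by
      simpa using i2.comp_sub_right τ
    have hind : ∀ z, B.indicator (1 : EuclideanSpace ℝ (Fin m) → ℝ≥0∞) z = ENNReal.ofReal (χ' z) := fun z => by
      by_cases hz : z ∈ B <;> simp [hχ', hz]
    have hχ0 : ∀ z, 0 ≤ χ' z := fun z => Set.indicator_nonneg (by simp) z
    calc ∫⁻ y, B.indicator 1 (y - τ) * ENNReal.ofReal |κ y - κ (y - τ)|
        = ∫⁻ z, ENNReal.ofReal (χ' z * κ z - χ' z * κ (z + τ)) := by
          rw [← lintegral_sub_right_eq_self (fun z => ENNReal.ofReal (χ' z * κ z - χ' z * κ (z + τ))) τ]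
          refine lintegral_congr fun y => ?_
          have := hmono (y - τ)
          rw [sub_add_cancel] at this ⊢
          rw [hind, ← ENNReal.ofReal_mul (hχ0 _), abs_of_nonpos (by linarith), ← mul_sub]
          congr 2; ring
      _ = ENNReal.ofReal (∫ z, (χ' z * κ z - χ' z * κ (z + τ))) := by
          refine (ofReal_integral_eq_lintegral_ofReal (i1.sub i2) ?_).symm
          refine .of_forall fun z => ?_
          change (0 : ℝ) ≤ χ' z * κ z - χ' z * κ (z + τ)
          have := mul_nonneg (hχ0 z) (sub_nonneg.2 (hmono z))
          linarith
      _ = ENNReal.ofReal (∫ z, (χ' z - χ' (z - τ)) * κ z) := by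
          rw [integral_sub i1 i2, ← integral_sub_right_eq_self (fun z => χ' z * κ (z + τ)) τ]
          simp only [sub_add_cancel, sub_mul]
          rw [integral_sub i1 i3]
      _ ≤ ‖∫ z, (χ' z - χ' (z - τ)) * κ z‖ₑ := by
          rw [← ofReal_norm]; exact ENNReal.ofReal_le_ofReal (Real.le_norm_self _)
      _ ≤ ∫⁻ z, ‖(χ' z - χ' (z - τ)) * κ z‖ₑ := enorm_integral_le_lintegral_enorm _
      _ ≤ ∫⁻ z, ENNReal.ofReal η * ‖χ z - χ (z - τ)‖ₑ := by
          refine lintegral_mono fun z => ?_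
          have e1 : χ z - χ (z - τ) = ((χ' z - χ' (z - τ) : ℝ) : ℂ) := by
            have : ∀ w, χ w = (χ' w : ℂ) := fun w => by
              by_cases hw : w ∈ B <;> simp [hχ, hχ', hw]
            rw [this, this]; push_cast; rfl
          have e2 : ‖χ z - χ (z - τ)‖ₑ = ‖χ' z - χ' (z - τ)‖ₑ := by
            rw [e1, ← ofReal_norm, Complex.norm_real, ofReal_norm]
          have e3 : ‖κ z‖ₑ ≤ ENNReal.ofReal η := by
            rw [← ofReal_norm]; exact ENNReal.ofReal_le_ofReal (hlip z)
          rw [enorm_mul, e2, mul_comm]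
          gcongr
      _ = ENNReal.ofReal η * K := lintegral_const_mul' _ _ ENNReal.ofReal_ne_top
  refine ⟨by fun_prop, fun y => ?_, fun y hy => by simp [hA.eq_zero y hy], ?_⟩
  · change ‖(((2 * η)⁻¹ : ℝ) : ℂ) * (A y * β y)‖ ≤ 1
    rw [norm_mul, norm_mul, Complex.norm_real, Real.norm_of_nonneg (by positivity)]
    calc (2 * η)⁻¹ * (‖A y‖ * ‖β y‖) ≤ (2 * η)⁻¹ * (1 * η) := by
          gcongr
          · exact hA.norm_le y
          · exact hβn y
      _ ≤ 1 := by rw [one_mul, inv_mul_le_iff₀ (by positivity)]; linarith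
  · change ∫⁻ y, ‖(((2 * η)⁻¹ : ℝ) : ℂ) * (A y * β y) -
      (((2 * η)⁻¹ : ℝ) : ℂ) * (A (y - τ) * β (y - τ))‖ₑ ≤ 2 * K
    have hpt : ∀ y, ‖(((2 * η)⁻¹ : ℝ) : ℂ) * (A y * β y) -
        (((2 * η)⁻¹ : ℝ) : ℂ) * (A (y - τ) * β (y - τ))‖ₑ ≤
        ENNReal.ofReal (2 * η)⁻¹ * (ENNReal.ofReal η * ‖A y - A (y - τ)‖ₑ +
          2 * (B.indicator 1 (y - τ) * ENNReal.ofReal |κ y - κ (y - τ)|)) := by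
      intro y
      have e : (((2 * η)⁻¹ : ℝ) : ℂ) * (A y * β y) -
          (((2 * η)⁻¹ : ℝ) : ℂ) * (A (y - τ) * β (y - τ)) =
          (((2 * η)⁻¹ : ℝ) : ℂ) * (β y * (A y - A (y - τ)) +
            A (y - τ) * (β y - β (y - τ))) := by ring
      rw [e, enorm_mul]
      have e1 : ‖(((2 * η)⁻¹ : ℝ) : ℂ)‖ₑ = ENNReal.ofReal (2 * η)⁻¹ := by
        rw [← ofReal_norm, Complex.norm_real, Real.norm_of_nonneg (by positivity)]
      rw [e1]
      gcongr
      refine (enorm_add_le _ _).trans ?_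
      rw [enorm_mul (β y), enorm_mul (A (y - τ)), mul_left_comm 2]
      gcongr
      · rw [← ofReal_norm]; exact ENNReal.ofReal_le_ofReal (hβn y)
      · exact enorm_le_indicator hA.norm_le hA.eq_zero _
      · rw [← ofReal_norm]
        refine (ENNReal.ofReal_le_ofReal (hβd _ _)).trans ?_
        rw [ENNReal.ofReal_mul zero_le_two]; simp
    have hm1 : Measurable fun y => ENNReal.ofReal η * ‖A y - A (y - τ)‖ₑ :=
      ((hAm.sub (hAm.comp (measurable_sub_const τ))).enorm).const_mul _
    calc _ ≤ _ := lintegral_mono hpt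
      _ = ENNReal.ofReal (2 * η)⁻¹ * (ENNReal.ofReal η * (∫⁻ y, ‖A y - A (y - τ)‖ₑ) +
          2 * ∫⁻ y, (B.indicator 1 (y - τ) * ENNReal.ofReal |κ y - κ (y - τ)|)) := by
          rw [lintegral_const_mul' _ _ ENNReal.ofReal_ne_top, lintegral_add_left hm1,
            lintegral_const_mul' _ _ ENNReal.ofReal_ne_top, lintegral_const_mul' _ _ (by simp)]
      _ ≤ ENNReal.ofReal (2 * η)⁻¹ * (ENNReal.ofReal η * (2 * K) +
          2 * (ENNReal.ofReal η * K)) := by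
          gcongr
          exact hA.lintegral_le
      _ = ENNReal.ofReal ((2 * η)⁻¹ * (2 * η)) * (2 * K) := by
          rw [ENNReal.ofReal_mul (p := (2 * η)⁻¹) (by positivity), ENNReal.ofReal_mul (p := 2) (by positivity)]
          rw [ENNReal.ofReal_ofNat]; ring
      _ = 2 * K := by
          rw [inv_mul_cancel₀ (by positivity)]; simp

/-- Summation by parts at the scale `τ`: up to the phase factor, the transform of `A` is controlled
by that of the difference `A - A (· - τ)` and by those of densities with an additional factor of the
size of the increments of `h`. -/
theorem enorm_mul_graphFourier_le {c : ℝ} (hc : c ≠ 0) (hh : Continuous h) (hA : Integrable A)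
    (hb : ∃ M, ∀ y, |c * (h (y + τ) - h y)| ≤ M)
    (ζ : EuclideanSpace ℝ (Fin (m + 1))) (hζ : |2 * Real.pi * ζ 0 / c| ≤ 1) :
    ‖1 - Complex.exp ((-(2 * Real.pi * inner ℝ (tailE ζ) τ) : ℝ) * Complex.I)‖ₑ *
        ‖graphFourier h A ζ‖ₑ ≤
      ‖graphFourier h (fun y => A y - A (y - τ)) ζ‖ₑ +
        ∫⁻ s in Set.Icc (-1 : ℝ) 1, ‖graphFourier h (fun y => A y * ((c * (h (y + τ) - h y) : ℝ) *
          Complex.exp ((-(s * (c * (h (y + τ) - h y))) : ℝ) * Complex.I))) ζ‖ₑ := by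
  obtain ⟨M, hM⟩ := hb
  set κ : EuclideanSpace ℝ (Fin m) → ℝ := fun y => c * (h (y + τ) - h y) with hκ
  set q : ℂ := Complex.exp ((-(2 * Real.pi * inner ℝ (tailE ζ) τ) : ℝ) * Complex.I) with hq
  set ω := 2 * Real.pi * ζ 0 / c with hω
  have hκc : Continuous κ := by fun_prop
  have hqn : ‖q‖ = 1 := Complex.norm_exp_ofReal_mul_I _
  have hchar : ∀ y, fchar ζ (graphMap h (y + τ)) =
      q * (fchar ζ (graphMap h y) * Complex.exp ((-(ω * κ y) : ℝ) * Complex.I)) := fun y => by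
    simp only [fchar, hq, graphMap, ← Complex.exp_add, ← add_mul, ← Complex.ofReal_add,
      inner_consE, inner_add_right, hω, hκ]
    congr 3
    field_simp
    ring
  set E : EuclideanSpace ℝ (Fin m) → ℂ := fun y =>
    A y * fchar ζ (graphMap h y) * (Complex.exp ((-(ω * κ y) : ℝ) * Complex.I) - 1) with hE
  have i1 := integrable_mul_fchar hh hA ζ
  have i2 := integrable_mul_fchar hh (hA.comp_sub_right τ) ζ
  have i3 : Integrable E := by
    refine i1.mul_bdd (c := 2) (by fun_prop : Continuous _).aestronglyMeasurable
      (.of_forall fun y => ?_)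
    refine (norm_sub_le _ _).trans ?_
    rw [Complex.norm_exp_ofReal_mul_I, norm_one]; norm_num
  have hid : (1 - q) * graphFourier h A ζ =
      graphFourier h (fun y => A y - A (y - τ)) ζ + q * ∫ y, E y := by
    have e1 : graphFourier h (fun y => A y - A (y - τ)) ζ =
        graphFourier h A ζ - graphFourier h (fun y => A (y - τ)) ζ := by
      simp only [graphFourier, sub_mul]
      exact integral_sub i1 i2
    have e2 : graphFourier h (fun y => A (y - τ)) ζ =
        ∫ y, (q * (A y * fchar ζ (graphMap h y)) + q * E y) := by
      simp only [graphFourier]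
      rw [← integral_add_right_eq_self (fun y => A (y - τ) * fchar ζ (graphMap h y)) τ]
      refine integral_congr_ae (.of_forall fun y => ?_)
      simp only [add_sub_cancel_right, hchar, hE]
      ring
    rw [e1, e2, integral_add (i1.const_mul q) (i3.const_mul q), integral_const_mul,
      integral_const_mul]
    simp only [graphFourier]
    ring
  set F : EuclideanSpace ℝ (Fin m) → ℝ → ℂ := fun y s =>
    A y * fchar ζ (graphMap h y) *
      (-Complex.I * ((κ y : ℂ) * Complex.exp ((-(s * κ y) : ℝ) * Complex.I))) with hF
  have hEF : ∀ y, E y = ∫ s in (0 : ℝ)..ω, F y s := fun y => by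
    have hd : ∀ s : ℝ, HasDerivAt (fun s : ℝ => Complex.exp ((-(s * κ y) : ℝ) * Complex.I))
        (-Complex.I * ((κ y : ℂ) * Complex.exp ((-(s * κ y) : ℝ) * Complex.I))) s := fun s => by
      have h1 : HasDerivAt (fun s : ℝ => -(s * κ y)) (-(1 * κ y)) s :=
        ((hasDerivAt_id s).mul_const _).neg
      convert! (h1.ofReal_comp.mul_const Complex.I).cexp using 1
      push_cast; ring
    have := intervalIntegral.integral_eq_sub_of_hasDerivAt (a := 0) (b := ω) (fun s _ => hd s)
      ((by fun_prop : Continuous _).intervalIntegrable _ _)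
    simp only [hF]
    rw [intervalIntegral.integral_const_mul, this, hE]
    simp
  have : IsFiniteMeasure (volume.restrict (Set.uIoc 0 ω)) := by rw [Set.uIoc]; infer_instance
  have hI : Integrable (Function.uncurry F) (volume.prod (volume.restrict (Set.uIoc 0 ω))) := by
    have h1 : Integrable (fun p : EuclideanSpace ℝ (Fin m) × ℝ =>
        A p.1 * fchar ζ (graphMap h p.1)) (volume.prod (volume.restrict (Set.uIoc 0 ω))) :=
      i1.comp_fst _
    refine h1.mul_bdd (c := M) (by fun_prop : Continuous _).aestronglyMeasurable
      (.of_forall fun p => ?_)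
    rw [norm_mul, norm_mul, Complex.norm_exp_ofReal_mul_I, norm_neg, Complex.norm_I, one_mul,
      mul_one, Complex.norm_real]
    exact hM p.1
  have hsub : Set.uIoc 0 ω ⊆ Set.Icc (-1 : ℝ) 1 := fun s hs => by
    have h2 := abs_le.1 hζ
    rcases Set.mem_uIoc.1 hs with hs | hs
    · exact ⟨by linarith [hs.1], hs.2.trans h2.2⟩
    · exact ⟨by linarith [hs.1], by linarith [hs.2]⟩
  have hfin : ‖∫ y, E y‖ₑ ≤ ∫⁻ s in Set.Icc (-1 : ℝ) 1, ‖graphFourier h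
      (fun y => A y * ((κ y : ℝ) * Complex.exp ((-(s * κ y) : ℝ) * Complex.I))) ζ‖ₑ := by
    simp only [hEF, intervalIntegral.intervalIntegral_eq_integral_uIoc]
    rw [integral_smul, integral_integral_swap hI, enorm_smul]
    have e1 : ‖(if (0 : ℝ) ≤ ω then 1 else -1 : ℝ)‖ₑ = 1 := by split_ifs <;> simp
    rw [e1, one_mul]
    refine (enorm_integral_le_lintegral_enorm _).trans ((lintegral_mono_set hsub).trans_eq ?_)
    refine lintegral_congr fun s => ?_
    have e2 : ∫ y, F y s = -Complex.I * graphFourier h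
        (fun y => A y * ((κ y : ℝ) * Complex.exp ((-(s * κ y) : ℝ) * Complex.I))) ζ := by
      simp only [graphFourier, hF, ← integral_const_mul]
      refine integral_congr_ae (.of_forall fun y => ?_)
      ring
    rw [e2, enorm_mul, enorm_neg, ← ofReal_norm Complex.I, Complex.norm_I, ENNReal.ofReal_one, one_mul]
  rw [← enorm_mul, hid]
  refine (enorm_add_le _ _).trans ?_
  rw [enorm_mul, ← ofReal_norm q, hqn, ENNReal.ofReal_one, one_mul]
  gcongr

theorem enorm_graphFourier_le (hA : ∀ y, ‖A y‖ ≤ 1) (hA0 : ∀ y, L < ‖y‖ → A y = 0)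
    (ζ : EuclideanSpace ℝ (Fin (m + 1))) : ‖graphFourier h A ζ‖ₑ ≤
      volume (Metric.closedBall (0 : EuclideanSpace ℝ (Fin m)) L) := by
  refine (enorm_integral_le_lintegral_enorm _).trans ?_
  rw [← lintegral_indicator_one measurableSet_closedBall]
  refine lintegral_mono fun y => ?_
  rw [enorm_mul, enorm_fchar, mul_one]
  exact enorm_le_indicator hA hA0 y

/-- The averaged decay of the transform of a ball in the graph of a concave function with small
slope, over the rotations for which a tangential coordinate of the frequency is large. The proof is
a bootstrap: summation by parts reproduces half of the quantity to be bounded, and the translation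
differences have small support, so that the weaker bound `exists_lintegral_graphFourier_le`
suffices for them. -/
theorem exists_setLIntegral_graphFourier_le (hm : 1 ≤ m) {η : ℝ} (hη : 0 < η)
    (hηm : 1024 * m * η ^ 2 ≤ 1) (hconc : ConcaveOn ℝ Set.univ h)
    (hlip : ∀ y z, |h y - h z| ≤ η * ‖y - z‖) (hh : Continuous h) (hL : 1 ≤ L) (i : Fin m) :
    ∃ C : ℝ≥0, ∀ ξ : EuclideanSpace ℝ (Fin (m + 1)), 1 ≤ ‖ξ‖ →
      ∫⁻ θ in {θ | ‖ξ‖ ^ 2 ≤ 4 * m * (SO.rotate θ ξ i.succ) ^ 2},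
        ‖graphFourier h ((Metric.closedBall 0 L).indicator 1) (SO.rotate θ ξ)‖ₑ ^ 2
          ∂SO.haar (m + 1) ≤ C * ENNReal.ofReal (‖ξ‖ ^ m)⁻¹ := by
  obtain ⟨C₁, hC₁⟩ := exists_lintegral_graphFourier_le hm hh (L + 1)
  obtain ⟨C₂, hC₂⟩ := exists_lintegral_indicator_ball_sub_le (m := m) hL
  refine ⟨256 * m * C₁ * C₂, fun ξ hξ => ?_⟩
  have hm' : (1 : ℝ) ≤ m := by exact_mod_cast hm
  have hm0 : (m : ℝ≥0∞) ≠ 0 := by simp; omega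
  have hη1 : η ≤ 1 := by nlinarith
  set R := ‖ξ‖ with hR
  have hR0 : 0 < R := by linarith
  have h2π : 0 < 2 * Real.pi * R := by positivity
  set τ : EuclideanSpace ℝ (Fin m) := EuclideanSpace.single i (2 * Real.pi * R)⁻¹ with hτ
  have hτn : ‖τ‖ = (2 * Real.pi * R)⁻¹ := by
    rw [hτ, PiLp.norm_single, Real.norm_of_nonneg (by positivity)]
  have hτR : (2 * Real.pi * R)⁻¹ ≤ R⁻¹ := by
    apply inv_anti₀ hR0; nlinarith [Real.pi_gt_three]
  have hτ1 : ‖τ‖ ≤ 1 := hτn.le.trans (hτR.trans (inv_le_one_of_one_le₀ hξ))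
  set c := 2 * Real.pi * R with hc
  set K := ∫⁻ y, ‖(Metric.closedBall 0 L).indicator (1 : EuclideanSpace ℝ (Fin m) → ℂ) y -
        (Metric.closedBall 0 L).indicator (1 : EuclideanSpace ℝ (Fin m) → ℂ) (y - τ)‖ₑ with hK
  have hKle : K ≤ C₂ * ENNReal.ofReal R⁻¹ := by
    refine (hC₂ τ hτ1).trans ?_
    rw [hτn]
    gcongr
  have hκ : ∀ y, |c * (h (y + τ) - h y)| ≤ η := fun y => by
    rw [abs_mul, abs_of_pos h2π]
    calc c * |h (y + τ) - h y| ≤ c * (η * ‖y + τ - y‖) := by gcongr; exact hlip _ _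
      _ = η := by rw [add_sub_cancel_left, hτn]; field_simp
  set Sec : Set (SO (m + 1)) := {θ | R ^ 2 ≤ 4 * m * (SO.rotate θ ξ i.succ) ^ 2} with hSec
  set X : (EuclideanSpace ℝ (Fin m) → ℂ) → ℝ≥0∞ := fun A =>
    ∫⁻ θ in Sec, ‖graphFourier h A (SO.rotate θ ξ)‖ₑ ^ 2 ∂SO.haar (m + 1) with hX
  -- the best constant for the class, which the bootstrap compares with half of itself
  set B := ⨆ (A : EuclideanSpace ℝ (Fin m) → ℂ) (_ : Admissible L τ A), X A with hB
  have hSm : MeasurableSet Sec := by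
    refine (isClosed_le continuous_const ?_).measurableSet
    have : Continuous fun θ : SO (m + 1) => SO.rotate θ ξ := by fun_prop
    fun_prop
  have hBfin : B ≠ ⊤ := by
    refine ne_top_of_le_ne_top (b := volume (Metric.closedBall (0 : EuclideanSpace ℝ (Fin m)) L) ^ 2)
      (ENNReal.pow_ne_top measure_closedBall_lt_top.ne) (iSup₂_le fun A hA => ?_)
    calc X A ≤ ∫⁻ θ in Sec, volume (Metric.closedBall (0 : EuclideanSpace ℝ (Fin m)) L) ^ 2
          ∂SO.haar (m + 1) := by
          refine lintegral_mono fun θ => ?_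
          dsimp only
          gcongr
          exact enorm_graphFourier_le hA.norm_le hA.eq_zero _
      _ ≤ ∫⁻ θ, volume (Metric.closedBall (0 : EuclideanSpace ℝ (Fin m)) L) ^ 2
          ∂SO.haar (m + 1) := setLIntegral_le_lintegral _ _
      _ = _ := by simp
  -- the trace estimate applied to the translation differences
  have hV : ∀ A, Admissible L τ A → X (fun y => A y - A (y - τ)) ≤
      4 * C₁ * C₂ * ENNReal.ofReal (R ^ m)⁻¹ := fun A hA => by
    have hd1 : ∀ y, ‖A y - A (y - τ)‖ₑ ≤ 2 := fun y => by
      have h1 : ∀ z, ‖A z‖ₑ ≤ 1 := fun z => by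
        rw [← ofReal_norm]; exact ENNReal.ofReal_le_one.2 (hA.norm_le _)
      exact enorm_sub_le.trans ((add_le_add (h1 _) (h1 _)).trans_eq one_add_one_eq_two)
    have hd2 : ∫⁻ y, ‖A y - A (y - τ)‖ₑ ^ 2 ≤ 2 * (2 * K) := by
      calc ∫⁻ y, ‖A y - A (y - τ)‖ₑ ^ 2 ≤ ∫⁻ y, 2 * ‖A y - A (y - τ)‖ₑ := by
            refine lintegral_mono fun y => ?_
            dsimp only
            rw [sq]
            gcongr
            exact hd1 y
        _ = 2 * ∫⁻ y, ‖A y - A (y - τ)‖ₑ := lintegral_const_mul' _ _ (by simp)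
        _ ≤ _ := by gcongr; exact hA.lintegral_le
    have hmp : MeasurePreserving (fun y : EuclideanSpace ℝ (Fin m) => y - τ) :=
      measurePreserving_sub_right _ τ
    have h2 : MemLp (fun y => A y - A (y - τ)) 2 :=
      (hA.memLp 2).sub ((hA.memLp 2).comp_measurePreserving hmp)
    calc X (fun y => A y - A (y - τ))
        ≤ ∫⁻ θ, ‖graphFourier h (fun y => A y - A (y - τ)) (SO.rotate θ ξ)‖ₑ ^ 2
          ∂SO.haar (m + 1) := setLIntegral_le_lintegral _ _
      _ ≤ C₁ * ENNReal.ofReal (R * (R ^ m)⁻¹) * ∫⁻ y, ‖A y - A (y - τ)‖ₑ ^ 2 := by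
          refine hC₁ _ (hA.integrable.sub (hA.integrable.comp_sub_right τ)) h2 (fun y hy => ?_) ξ hξ
          have : ‖y‖ ≤ ‖y - τ‖ + ‖τ‖ := by simpa using norm_add_le (y - τ) τ
          change A y - A (y - τ) = 0
          rw [hA.eq_zero y (by linarith), hA.eq_zero (y - τ) (by linarith), sub_zero]
      _ ≤ C₁ * ENNReal.ofReal (R * (R ^ m)⁻¹) * (2 * (2 * (C₂ * ENNReal.ofReal R⁻¹))) := by
          gcongr
          exact hd2.trans (by gcongr)
      _ = 4 * C₁ * C₂ * (ENNReal.ofReal (R * (R ^ m)⁻¹) * ENNReal.ofReal R⁻¹) := by ring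
      _ = _ := by
          rw [← ENNReal.ofReal_mul (by positivity)]
          congr 2
          field_simp
  have hstep : ∀ A, Admissible L τ A →
      X A ≤ 128 * m * C₁ * C₂ * ENNReal.ofReal (R ^ m)⁻¹ + B / 2 := fun A hA => by
    set As : ℝ → EuclideanSpace ℝ (Fin m) → ℂ := fun s y => A y * ((c * (h (y + τ) - h y) : ℝ) *
      Complex.exp ((-(s * (c * (h (y + τ) - h y))) : ℝ) * Complex.I)) with hAs
    -- the densities with the additional factor are `2η` times admissible ones
    have hAsB : ∀ s ∈ Set.Icc (-1 : ℝ) 1, X (As s) ≤ ENNReal.ofReal (2 * η) ^ 2 * B := by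
      intro s hs
      have h1 := hA.mul_exp hη hη1 hconc hh h2π hκ (abs_le.2 hs)
      have h2 : X (As s) = ENNReal.ofReal (2 * η) ^ 2 *
          X (fun y => ((2 * η)⁻¹ : ℝ) * As s y) := by
        simp only [hX]
        rw [← lintegral_const_mul' _ _ (by finiteness)]
        refine lintegral_congr fun θ => ?_
        have e : graphFourier h (fun y => (((2 * η)⁻¹ : ℝ) : ℂ) * As s y) (SO.rotate θ ξ) =
            (((2 * η)⁻¹ : ℝ) : ℂ) * graphFourier h (As s) (SO.rotate θ ξ) := by
          simp only [graphFourier, mul_assoc]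
          exact integral_const_mul _ _
        rw [e, enorm_mul, ← mul_pow, ← mul_assoc, ← ofReal_norm ((((2 * η)⁻¹ : ℝ) : ℂ)),
          Complex.norm_real, Real.norm_of_nonneg (by positivity),
          ← ENNReal.ofReal_mul (by positivity), mul_inv_cancel₀ (by positivity),
          ENNReal.ofReal_one, one_mul]
      rw [h2]
      gcongr
      exact le_iSup₂_of_le _ h1 le_rfl
    have hjoint : Continuous fun p : SO (m + 1) × ℝ =>
        graphFourier h (As p.2) (SO.rotate p.1 ξ) := by
      refine continuous_of_dominated (bound := fun y => ‖A y‖ * η) (fun p => ?_)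
        (fun p => .of_forall fun y => ?_) (hA.integrable.norm.mul_const η) (.of_forall fun y => ?_)
      · refine (hA.measurable.aestronglyMeasurable.mul
          (by fun_prop : Continuous _).aestronglyMeasurable).mul
          (by fun_prop : Continuous _).aestronglyMeasurable
      · rw [norm_mul, norm_fchar, mul_one, norm_mul, norm_mul, Complex.norm_exp_ofReal_mul_I, mul_one,
          Complex.norm_real]
        gcongr
        exact hκ y
      · fun_prop
    have hUc : Continuous fun θ : SO (m + 1) => graphFourier h (fun y => A y - A (y - τ))
        (SO.rotate θ ξ) := (continuous_graphFourier hh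
          (hA.integrable.sub (hA.integrable.comp_sub_right τ))).comp (by fun_prop)
    have hpt : ∀ θ ∈ Sec, ‖graphFourier h A (SO.rotate θ ξ)‖ₑ ^ 2 ≤ 16 * m *
        (2 * ‖graphFourier h (fun y => A y - A (y - τ)) (SO.rotate θ ξ)‖ₑ ^ 2 +
          4 * ∫⁻ s in Set.Icc (-1 : ℝ) 1, ‖graphFourier h (As s) (SO.rotate θ ξ)‖ₑ ^ 2) := by
      intro θ hθ
      set ζ := SO.rotate θ ξ with hζ
      have hζn : ‖ζ‖ = R := SO.norm_rotate θ ξ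
      have hcoord : ∀ k, |ζ k| ≤ R := fun k => by
        rw [← hζn]; exact PiLp.norm_apply_le ζ k
      have hζ0 : |2 * Real.pi * ζ 0 / c| ≤ 1 := by
        have e : 2 * Real.pi * ζ 0 / c = ζ 0 / R := by rw [hc]; field_simp
        rw [e, abs_div, abs_of_pos hR0]
        exact div_le_one_of_le₀ (hcoord 0) hR0.le
      have h1 := enorm_mul_graphFourier_le (τ := τ) h2π.ne' hh hA.integrable ⟨η, hκ⟩ ζ hζ0
      have e2 : 2 * Real.pi * inner ℝ (tailE ζ) τ = ζ i.succ / R := by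
        rw [hτ, EuclideanSpace.inner_single_right]
        simp only [tailE_apply, conj_trivial, hc]
        field_simp
      rw [e2] at h1
      set ω := ζ i.succ / R with hω
      have hω1 : |ω| ≤ 1 := by
        rw [hω, abs_div, abs_of_pos hR0]
        exact div_le_one_of_le₀ (hcoord _) hR0.le
      have hω2 : 1 ≤ 4 * m * ω ^ 2 := by
        have : R ^ 2 ≤ 4 * m * ζ i.succ ^ 2 := hθ
        rw [hω, div_pow, ← mul_div_assoc, le_div_iff₀ (by positivity), one_mul]
        exact this
      have h3 := half_abs_le_norm_one_sub_exp hω1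
      -- the phase factor is bounded below, since the tangential coordinate is large
      have h4 : 1 ≤ 16 * m * ‖1 - Complex.exp ((-ω : ℝ) * Complex.I)‖ ^ 2 := by
        calc (1 : ℝ) ≤ 4 * m * ω ^ 2 := hω2
          _ = 16 * m * (|ω| / 2) ^ 2 := by rw [div_pow |ω|, sq_abs]; ring
          _ ≤ _ := by gcongr
      have h5 : (1 : ℝ≥0∞) ≤ 16 * m * ‖1 - Complex.exp ((-ω : ℝ) * Complex.I)‖ₑ ^ 2 := by
        have := ENNReal.ofReal_le_ofReal h4
        rwa [ENNReal.ofReal_one, ENNReal.ofReal_mul (by positivity),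
          ENNReal.ofReal_mul (by positivity), ENNReal.ofReal_pow (norm_nonneg _), ofReal_norm,
          ENNReal.ofReal_natCast, ENNReal.ofReal_ofNat] at this
      have h6 := sq_lintegral_le (volume.restrict (Set.Icc (-1 : ℝ) 1))
        (u := fun s => ‖graphFourier h (As s) ζ‖ₑ)
        ((hjoint.comp (by fun_prop : Continuous fun s : ℝ => (θ, s))).enorm.measurable.aemeasurable)
      rw [Measure.restrict_apply_univ, Real.volume_Icc] at h6
      norm_num at h6
      calc ‖graphFourier h A ζ‖ₑ ^ 2
          ≤ 16 * m * ‖1 - Complex.exp ((-ω : ℝ) * Complex.I)‖ₑ ^ 2 *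
            ‖graphFourier h A ζ‖ₑ ^ 2 := le_mul_of_one_le_left zero_le h5
        _ = 16 * m * (‖1 - Complex.exp ((-ω : ℝ) * Complex.I)‖ₑ * ‖graphFourier h A ζ‖ₑ) ^ 2 := by
            ring
        _ ≤ 16 * m * (_ + _) ^ 2 := by gcongr
        _ ≤ 16 * m * (2 * ‖graphFourier h (fun y => A y - A (y - τ)) ζ‖ₑ ^ 2 +
            2 * (∫⁻ s in Set.Icc (-1 : ℝ) 1, ‖graphFourier h (As s) ζ‖ₑ) ^ 2) := by
            gcongr
            exact ENNReal.add_sq_le_two_mul _ _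
        _ ≤ 16 * m * (2 * ‖graphFourier h (fun y => A y - A (y - τ)) ζ‖ₑ ^ 2 +
            2 * (2 * ∫⁻ s in Set.Icc (-1 : ℝ) 1, ‖graphFourier h (As s) ζ‖ₑ ^ 2)) := by
            gcongr
        _ = _ := by ring
    have hswap : ∫⁻ θ in Sec, ∫⁻ s in Set.Icc (-1 : ℝ) 1,
        ‖graphFourier h (As s) (SO.rotate θ ξ)‖ₑ ^ 2 ∂volume ∂SO.haar (m + 1) ≤
        2 * (ENNReal.ofReal (2 * η) ^ 2 * B) := by
      rw [lintegral_lintegral_swap (hjoint.enorm.measurable.pow_const 2).aemeasurable]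
      calc _ ≤ ∫⁻ s in Set.Icc (-1 : ℝ) 1, ENNReal.ofReal (2 * η) ^ 2 * B :=
            setLIntegral_mono' measurableSet_Icc hAsB
        _ = _ := by
            rw [setLIntegral_const, Real.volume_Icc, mul_comm]
            norm_num
    calc X A ≤ ∫⁻ θ in Sec, 16 * m *
        (2 * ‖graphFourier h (fun y => A y - A (y - τ)) (SO.rotate θ ξ)‖ₑ ^ 2 +
          4 * ∫⁻ s in Set.Icc (-1 : ℝ) 1, ‖graphFourier h (As s) (SO.rotate θ ξ)‖ₑ ^ 2)
            ∂SO.haar (m + 1) := setLIntegral_mono' hSm hpt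
      _ = 16 * m * (2 * X (fun y => A y - A (y - τ)) + 4 * ∫⁻ θ in Sec, ∫⁻ s in Set.Icc (-1 : ℝ) 1,
            ‖graphFourier h (As s) (SO.rotate θ ξ)‖ₑ ^ 2 ∂volume ∂SO.haar (m + 1)) := by
          rw [lintegral_const_mul' _ _ (by finiteness), lintegral_add_left
            ((hUc.enorm.measurable.pow_const 2).const_mul 2), lintegral_const_mul' _ _ (by simp),
            lintegral_const_mul' _ _ (by simp)]
      _ ≤ 16 * m * (2 * (4 * C₁ * C₂ * ENNReal.ofReal (R ^ m)⁻¹) +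
            4 * (2 * (ENNReal.ofReal (2 * η) ^ 2 * B))) := by
          gcongr
          exact hV A hA
      _ = 128 * m * C₁ * C₂ * ENNReal.ofReal (R ^ m)⁻¹ +
            (128 * m * ENNReal.ofReal (2 * η) ^ 2) * B := by ring
      _ ≤ 128 * m * C₁ * C₂ * ENNReal.ofReal (R ^ m)⁻¹ + 2⁻¹ * B := by
          -- `1024 m η² ≤ 1` says that the gain `128 m (2η)²` is at most one half
          gcongr
          have e : (128 * m * ENNReal.ofReal (2 * η) ^ 2 : ℝ≥0∞) =
              ENNReal.ofReal (128 * m * (2 * η) ^ 2) := by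
            rw [ENNReal.ofReal_mul (p := 128 * m) (by positivity), ENNReal.ofReal_mul (p := 128)
              (by positivity), ENNReal.ofReal_pow (by positivity), ENNReal.ofReal_natCast,
              ENNReal.ofReal_ofNat]
          rw [e, ENNReal.ofReal_le_iff_le_toReal (by simp)]
          simp
          nlinarith
      _ = _ := by rw [ENNReal.div_eq_inv_mul]
  have hBle : B ≤ 128 * m * C₁ * C₂ * ENNReal.ofReal (R ^ m)⁻¹ + B / 2 :=
    iSup₂_le hstep
  have hB2 : B / 2 ≤ 128 * m * C₁ * C₂ * ENNReal.ofReal (R ^ m)⁻¹ := by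
    nth_rewrite 1 [← ENNReal.add_halves B] at hBle
    exact (ENNReal.add_le_add_iff_right (ENNReal.div_ne_top hBfin (by simp))).1 hBle
  calc _ ≤ B := le_iSup₂_of_le _ admissible_indicator le_rfl
    _ = B / 2 + B / 2 := (ENNReal.add_halves B).symm
    _ ≤ _ := add_le_add hB2 hB2
    _ = _ := by push_cast; ring

end Tangential

end

noncomputable section

/-! ### Averaged decay near the normal direction -/

open scoped ContDiff

/-- A smooth function equal to `1 / x` away from a neighbourhood of the origin. -/
def smoothInv (x : ℝ) : ℝ := Real.smoothTransition (128 * x ^ 2 - 1) / x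

theorem smoothInv_mul_self {x : ℝ} (hx : 1 / 8 ≤ |x|) : smoothInv x * x = 1 := by
  have h0 : x ≠ 0 := by
    rintro rfl; norm_num at hx
  rw [smoothInv, div_mul_cancel₀ _ h0, Real.smoothTransition.one_of_one_le]
  have : (1 / 8 : ℝ) ^ 2 ≤ |x| ^ 2 := by gcongr
  rw [sq_abs] at this
  linarith

theorem contDiff_smoothInv : ContDiff ℝ ∞ smoothInv := by
  refine contDiff_iff_contDiffAt.2 fun x => ?_
  have h1 : ContDiff ℝ ∞ fun x : ℝ => Real.smoothTransition (128 * x ^ 2 - 1) :=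
    Real.smoothTransition.contDiff.comp (by fun_prop)
  rcases eq_or_ne x 0 with rfl | hx
  · refine (contDiffAt_const (c := (0 : ℝ))).congr_of_eventuallyEq ?_
    have : ∀ᶠ y : ℝ in nhds 0, 128 * y ^ 2 - 1 < 0 := by
      have hc : Continuous fun y : ℝ => 128 * y ^ 2 - 1 := by fun_prop
      exact hc.continuousAt.eventually_lt continuousAt_const (by norm_num)
    filter_upwards [this] with y hy
    rw [smoothInv, Real.smoothTransition.zero_of_nonpos hy.le, zero_div]
  · exact h1.contDiffAt.div contDiffAt_id hx

/-- The smooth amplitudes, periodic in the first variable, which vanish near the zeros of the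
cosine. The second and third variables are the parameters `Q` and `δ` of the phase
`Q (sin t + δ cos t)`. -/
structure IsAmplitude (G : ℝ × ℝ × ℝ → ℝ) : Prop where
  contDiff : ContDiff ℝ ∞ G
  periodic : ∀ t r, G (t + 2 * Real.pi, r) = G (t, r)
  eq_zero : ∀ t Q δ, |Q * Real.cos t| < 1 / 4 → G (t, Q, δ) = 0

/-- The amplitude produced by one integration by parts. -/
def amplitudeDeriv (G : ℝ × ℝ × ℝ → ℝ) (p : ℝ × ℝ × ℝ) : ℝ :=
  fderiv ℝ (fun p : ℝ × ℝ × ℝ =>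
    G p * smoothInv (p.2.1 * (Real.cos p.1 - p.2.2 * Real.sin p.1))) p (1, 0, 0)

section Amplitude

variable {G : ℝ × ℝ × ℝ → ℝ}

theorem IsAmplitude.contDiff_mul (hG : IsAmplitude G) : ContDiff ℝ ∞ (fun p : ℝ × ℝ × ℝ =>
    G p * smoothInv (p.2.1 * (Real.cos p.1 - p.2.2 * Real.sin p.1))) := by
  refine hG.contDiff.mul (contDiff_smoothInv.comp ?_)
  have h1 := Real.contDiff_cos (n := ∞).comp (contDiff_fst (E := ℝ) (F := ℝ × ℝ) (𝕜 := ℝ))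
  have h2 := Real.contDiff_sin (n := ∞).comp (contDiff_fst (E := ℝ) (F := ℝ × ℝ) (𝕜 := ℝ))
  have h3 : ContDiff ℝ ∞ fun p : ℝ × ℝ × ℝ => p.2.1 := by fun_prop
  have h4 : ContDiff ℝ ∞ fun p : ℝ × ℝ × ℝ => p.2.2 := by fun_prop
  exact h3.mul (h1.sub (h4.mul h2))

theorem isAmplitude_amplitudeDeriv (hG : IsAmplitude G) : IsAmplitude (amplitudeDeriv G) where
  contDiff := (hG.contDiff_mul.fderiv_right (m := ∞) (by norm_num)).clm_apply contDiff_const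
  periodic t r := by
    set F : ℝ × ℝ × ℝ → ℝ := fun p =>
      G p * smoothInv (p.2.1 * (Real.cos p.1 - p.2.2 * Real.sin p.1)) with hF
    have h : (fun p => F (p + (2 * Real.pi, 0))) = F := by
      funext p
      obtain ⟨s, q⟩ := p
      simp only [hF, Prod.mk_add_mk, add_zero, hG.periodic, Real.cos_add_two_pi,
        Real.sin_add_two_pi]
    have h2 := fderiv_comp_add_right (𝕜 := ℝ) (f := F) (x := (t, r)) (2 * Real.pi, 0)
    rw [h] at h2
    simp only [Prod.mk_add_mk, add_zero] at h2
    simp only [amplitudeDeriv]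
    rw [← h2]
  eq_zero t Q δ h := by
    have hc : Continuous fun p : ℝ × ℝ × ℝ => |p.2.1 * Real.cos p.1| := by fun_prop
    have : (fun p : ℝ × ℝ × ℝ => G p * smoothInv (p.2.1 * (Real.cos p.1 - p.2.2 * Real.sin p.1)))
        =ᶠ[nhds (t, Q, δ)] fun _ => 0 := by
      filter_upwards [hc.continuousAt.eventually_lt continuousAt_const h] with p hp
      obtain ⟨s, q, d⟩ := p
      rw [hG.eq_zero s q d hp, zero_mul]
    rw [amplitudeDeriv, this.fderiv_eq, fderiv_fun_const]
    rfl

/-- One integration by parts. -/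
theorem IsAmplitude.norm_integral_amplitudeDeriv (hG : IsAmplitude G) (l : ℝ) {Q δ : ℝ}
    (hQ : Q ∈ Set.Icc (0 : ℝ) 1) (hδ : |δ| ≤ 1 / 8) :
    ‖∫ t in (0 : ℝ)..2 * Real.pi, (amplitudeDeriv G (t, Q, δ) : ℂ) *
        Complex.exp ((-(l * (Q * (Real.sin t + δ * Real.cos t))) : ℝ) * Complex.I)‖ =
      |l| * ‖∫ t in (0 : ℝ)..2 * Real.pi, (G (t, Q, δ) : ℂ) *
        Complex.exp ((-(l * (Q * (Real.sin t + δ * Real.cos t))) : ℝ) * Complex.I)‖ := by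
  set e : ℝ → ℂ := fun t =>
    Complex.exp ((-(l * (Q * (Real.sin t + δ * Real.cos t))) : ℝ) * Complex.I) with he
  set ψ : ℝ → ℝ := fun t => Q * (Real.cos t - δ * Real.sin t) with hψ
  have hψG : ∀ t, G (t, Q, δ) * smoothInv (ψ t) * ψ t = G (t, Q, δ) := fun t => by
    by_cases h : |Q * Real.cos t| < 1 / 4
    · rw [hG.eq_zero t Q δ h]; ring
    · rw [mul_assoc, smoothInv_mul_self, mul_one]
      have h1 : |Q * (δ * Real.sin t)| ≤ 1 / 8 := by
        rw [abs_mul, abs_mul, abs_of_nonneg hQ.1]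
        calc Q * (|δ| * |Real.sin t|) ≤ 1 * (1 / 8 * 1) := by
              gcongr
              · exact hQ.2
              · exact Real.abs_sin_le_one t
          _ = 1 / 8 := by norm_num
      have h2 := abs_sub_abs_le_abs_sub (Q * Real.cos t) (Q * (δ * Real.sin t))
      rw [← mul_sub] at h2
      push Not at h
      linarith
  have hd1 : ∀ t, HasDerivAt (fun t => G (t, Q, δ) * smoothInv (ψ t))
      (amplitudeDeriv G (t, Q, δ)) t := fun t => by
    have h1 := ((hG.contDiff_mul.differentiable (by norm_num)) (t, Q, δ)).hasFDerivAt
    have h2 : HasDerivAt (fun t : ℝ => (t, Q, δ)) (1, 0, 0) t :=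
      (hasDerivAt_id t).prodMk (hasDerivAt_const t (Q, δ))
    exact h1.comp_hasDerivAt t h2
  have hd2 : ∀ t, HasDerivAt e (-(Complex.I * l) * ψ t * e t) t := fun t => by
    have h1 : HasDerivAt (fun t => -(l * (Q * (Real.sin t + δ * Real.cos t))))
        (-(l * (Q * (Real.cos t + δ * -Real.sin t)))) t :=
      ((((Real.hasDerivAt_sin t).add ((Real.hasDerivAt_cos t).const_mul δ)).const_mul Q).const_mul
        l).neg
    convert! (h1.ofReal_comp.mul_const Complex.I).cexp using 1
    simp only [hψ, he]
    push_cast; ring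
  have hd : ∀ t, HasDerivAt (fun t => ((G (t, Q, δ) * smoothInv (ψ t) : ℝ) : ℂ) * e t)
      ((amplitudeDeriv G (t, Q, δ) : ℂ) * e t + -(Complex.I * l) * ((G (t, Q, δ) : ℂ) * e t)) t :=
    fun t => by
      convert! (hd1 t).ofReal_comp.mul (hd2 t) using 1
      have := congrArg (fun x : ℝ => (x : ℂ)) (hψG t)
      push_cast at this ⊢
      linear_combination (Complex.I * l * e t) * this
  have hcG : Continuous fun t => G (t, Q, δ) := hG.contDiff.continuous.comp (by fun_prop)
  have hcD : Continuous fun t => amplitudeDeriv G (t, Q, δ) :=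
    (isAmplitude_amplitudeDeriv hG).contDiff.continuous.comp (by fun_prop)
  have hce : Continuous e := by fun_prop
  have i1 : IntervalIntegrable (fun t => (amplitudeDeriv G (t, Q, δ) : ℂ) * e t) volume 0
      (2 * Real.pi) := ((Complex.continuous_ofReal.comp hcD).mul hce).intervalIntegrable _ _
  have i2 : IntervalIntegrable (fun t => -(Complex.I * l) * ((G (t, Q, δ) : ℂ) * e t)) volume 0
      (2 * Real.pi) := (continuous_const.mul ((Complex.continuous_ofReal.comp hcG).mul
        hce)).intervalIntegrable _ _
  have h := intervalIntegral.integral_eq_sub_of_hasDerivAt (a := 0) (b := 2 * Real.pi)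
    (fun t _ => hd t) (i1.add i2)
  have hper : ((G (2 * Real.pi, Q, δ) * smoothInv (ψ (2 * Real.pi)) : ℝ) : ℂ) * e (2 * Real.pi) =
      ((G (0, Q, δ) * smoothInv (ψ 0) : ℝ) : ℂ) * e 0 := by
    have := hG.periodic 0 (Q, δ)
    rw [zero_add] at this
    simp [this, hψ, he]
  rw [hper, sub_self, intervalIntegral.integral_add i1 i2, intervalIntegral.integral_const_mul,
    ← eq_neg_iff_add_eq_zero] at h
  rw [h, norm_neg, norm_mul, norm_neg, norm_mul, Complex.norm_I, one_mul, Complex.norm_real,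
    Real.norm_eq_abs]

/-- Integration by parts `N` times: the phase has no critical points on the support of an
amplitude. -/
theorem exists_pow_mul_norm_integral_le (N : ℕ) : ∀ {G : ℝ × ℝ × ℝ → ℝ}, IsAmplitude G →
    ∃ C : ℝ, ∀ l Q δ : ℝ, Q ∈ Set.Icc (0 : ℝ) 1 → |δ| ≤ 1 / 8 →
      |l| ^ N * ‖∫ t in (0 : ℝ)..2 * Real.pi, (G (t, Q, δ) : ℂ) *
        Complex.exp ((-(l * (Q * (Real.sin t + δ * Real.cos t))) : ℝ) * Complex.I)‖ ≤ C := by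
  induction N with
  | zero =>
    intro G hG
    obtain ⟨M, hM⟩ := ((isCompact_Icc (a := (0 : ℝ)) (b := 2 * Real.pi)).prod
      ((isCompact_Icc (a := (0 : ℝ)) (b := 1)).prod
        (isCompact_Icc (a := (-(1 / 8) : ℝ)) (b := 1 / 8)))).exists_bound_of_continuousOn
        hG.contDiff.continuous.continuousOn
    refine ⟨M * |2 * Real.pi - 0|, fun l Q δ hQ hδ => ?_⟩
    rw [pow_zero, one_mul]
    refine intervalIntegral.norm_integral_le_of_norm_le_const fun t ht => ?_
    rw [Set.uIoc_of_le Real.two_pi_pos.le] at ht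
    rw [norm_mul, Complex.norm_exp_ofReal_mul_I, mul_one, Complex.norm_real]
    exact hM (t, Q, δ) ⟨⟨ht.1.le, ht.2⟩, hQ, abs_le.1 hδ⟩
  | succ N ih =>
    intro G hG
    obtain ⟨C, hC⟩ := ih (isAmplitude_amplitudeDeriv hG)
    refine ⟨C, fun l Q δ hQ hδ => ?_⟩
    rw [pow_succ, mul_assoc, ← hG.norm_integral_amplitudeDeriv l hQ hδ]
    exact hC l Q δ hQ hδ

end Amplitude

/-- A smooth cut-off equal to one for `1 / 2 ≤ |x|` and to zero for `|x| ≤ 1 / 4`. -/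
def poleCutoff (x : ℝ) : ℝ := Real.smoothTransition (16 * x ^ 2 - 1)

theorem contDiff_poleCutoff : ContDiff ℝ ∞ poleCutoff :=
  Real.smoothTransition.contDiff.comp (by fun_prop)

@[fun_prop] theorem continuous_poleCutoff : Continuous poleCutoff := contDiff_poleCutoff.continuous

theorem poleCutoff_nonneg (x : ℝ) : 0 ≤ poleCutoff x := Real.smoothTransition.nonneg _

theorem poleCutoff_le_one (x : ℝ) : poleCutoff x ≤ 1 := Real.smoothTransition.le_one _

theorem poleCutoff_eq_one {x : ℝ} (hx : 1 / 4 ≤ x ^ 2) : poleCutoff x = 1 :=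
  Real.smoothTransition.one_of_one_le (by linarith)

theorem isAmplitude_poleCutoff : IsAmplitude fun p => poleCutoff (p.2.1 * Real.cos p.1) where
  contDiff := by
    refine contDiff_poleCutoff.comp ?_
    have h1 := Real.contDiff_cos (n := ∞).comp (contDiff_fst (E := ℝ) (F := ℝ × ℝ) (𝕜 := ℝ))
    have h3 : ContDiff ℝ ∞ fun p : ℝ × ℝ × ℝ => p.2.1 := by fun_prop
    exact h3.mul h1
  periodic t r := by simp
  eq_zero t Q δ h := by
    refine Real.smoothTransition.zero_of_nonpos ?_
    have : |Q * Real.cos t| ^ 2 ≤ (1 / 4 : ℝ) ^ 2 := by gcongr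
    rw [sq_abs] at this
    dsimp only
    linarith

end

noncomputable section

theorem SO.continuous_rotate_planeRot {n : ℕ} {i j : Fin n} (h : i ≠ j) {X : Type*}
    [TopologicalSpace X] {a : X → ℝ} {b : X → EuclideanSpace ℝ (Fin n)} (ha : Continuous a)
    (hb : Continuous b) : Continuous fun x => SO.rotate (SO.planeRot h (a x)) (b x) := by
  refine (PiLp.continuous_toLp 2 _).comp (continuous_pi fun k => ?_)
  change Continuous fun x => SO.rotate (SO.planeRot h (a x)) (b x) k
  simp only [SO.rotate_planeRot]
  split_ifs <;> fun_prop

section Pole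

variable {m : ℕ}

/-- The average of a character over the rotations in a coordinate plane containing the normal
direction, cut off near the poles. -/
theorem exists_norm_integral_planeRot_le (N : ℕ) : ∃ C : ℝ, ∀ (R : ℝ), 0 < R →
    ∀ (i : Fin m) (ζ z : EuclideanSpace ℝ (Fin (m + 1))), ‖ζ‖ = R → z i.succ ≠ 0 →
      8 * |z 0| ≤ |z i.succ| →
      (R * |z i.succ|) ^ N * ‖∫ t in (0 : ℝ)..2 * Real.pi,
        (poleCutoff (SO.rotate (SO.planeRot (Fin.succ_ne_zero i).symm t) ζ 0 / R) : ℂ) *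
          fchar (SO.rotate (SO.planeRot (Fin.succ_ne_zero i).symm t) ζ) z‖ ≤ C := by
  obtain ⟨C, hC⟩ := exists_pow_mul_norm_integral_le N isAmplitude_poleCutoff
  refine ⟨C, fun R hR i ζ z hζ hz0 hz => ?_⟩
  set h0 := (Fin.succ_ne_zero i).symm
  set c : ℂ := ⟨ζ 0, ζ i.succ⟩ with hc
  set φ := c.arg
  have hc1 : ‖c‖ * Real.cos φ = ζ 0 := Complex.norm_mul_cos_arg c
  have hc2 : ‖c‖ * Real.sin φ = ζ i.succ := Complex.norm_mul_sin_arg c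
  set Q := ‖c‖ / R with hQ
  have hcR : ‖c‖ ≤ R := by
    refine abs_le_of_sq_le_sq' ?_ hR.le |>.2
    rw [← Complex.normSq_eq_norm_sq, Complex.normSq_mk, ← hζ, EuclideanSpace.norm_sq_eq,
      Fin.sum_univ_succ]
    simp only [Real.norm_eq_abs, sq_abs]
    have := Finset.single_le_sum (f := fun k : Fin m => ζ k.succ ^ 2)
      (fun k _ => sq_nonneg _) (Finset.mem_univ i)
    dsimp only at this
    nlinarith
  have hQ1 : Q ∈ Set.Icc (0 : ℝ) 1 := ⟨by positivity, div_le_one_of_le₀ hcR hR.le⟩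
  set δ := z 0 / z i.succ with hδ
  have hδ1 : |δ| ≤ 1 / 8 := by
    rw [hδ, abs_div, div_le_iff₀ (abs_pos.2 hz0)]; linarith
  set l := 2 * Real.pi * R * z i.succ with hl
  set a := inner ℝ ζ z - ζ 0 * z 0 - ζ i.succ * z i.succ with ha
  have e0 : ∀ t, SO.rotate (SO.planeRot h0 t) ζ 0 = ‖c‖ * Real.cos (t + φ) := fun t => by
    rw [SO.rotate_planeRot, if_pos rfl, ← hc1, ← hc2, Real.cos_add]; ring
  have e1 : ∀ t, SO.rotate (SO.planeRot h0 t) ζ i.succ = ‖c‖ * Real.sin (t + φ) := fun t => by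
    rw [SO.rotate_planeRot, if_neg h0.symm, if_pos rfl, ← hc1, ← hc2, Real.sin_add]; ring
  have e2 : ∀ t, inner ℝ (SO.rotate (SO.planeRot h0 t) ζ) z =
      a + ‖c‖ * (Real.cos (t + φ) * z 0 + Real.sin (t + φ) * z i.succ) := fun t => by
    have : SO.rotate (SO.planeRot h0 t) ζ = ζ +
        EuclideanSpace.single 0 (‖c‖ * Real.cos (t + φ) - ζ 0) +
        EuclideanSpace.single i.succ (‖c‖ * Real.sin (t + φ) - ζ i.succ) := by
      ext k
      by_cases hk0 : k = 0
      · subst hk0; rw [e0]; simp [h0]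
      · by_cases hki : k = i.succ
        · subst hki; rw [e1]; simp [h0.symm]
        · rw [SO.rotate_planeRot, if_neg hk0, if_neg hki]; simp [hk0, hki]
    rw [this, inner_add_left, inner_add_left, EuclideanSpace.inner_single_left,
      EuclideanSpace.inner_single_left, ha]
    simp only [conj_trivial]
    ring
  set F : ℝ → ℂ := fun s => (poleCutoff (Q * Real.cos s) : ℂ) *
    Complex.exp ((-(l * (Q * (Real.sin s + δ * Real.cos s))) : ℝ) * Complex.I) with hF
  have hper : Function.Periodic F (2 * Real.pi) := fun s => by
    simp only [hF, Real.cos_add_two_pi, Real.sin_add_two_pi]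
  have e3 : ∀ t, (poleCutoff (SO.rotate (SO.planeRot h0 t) ζ 0 / R) : ℂ) *
      fchar (SO.rotate (SO.planeRot h0 t) ζ) z =
        Complex.exp ((-(2 * Real.pi * a) : ℝ) * Complex.I) * F (t + φ) := fun t => by
    have e4 : -(2 * Real.pi * (a + ‖c‖ * (Real.cos (t + φ) * z 0 + Real.sin (t + φ) * z i.succ))) =
        -(2 * Real.pi * a) + -(l * (Q * (Real.sin (t + φ) + δ * Real.cos (t + φ)))) := by
      rw [hl, hQ, hδ]; field_simp; ring
    have e5 : ‖c‖ * Real.cos (t + φ) / R = Q * Real.cos (t + φ) := by rw [hQ]; ring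
    simp only [fchar]
    rw [e2, e0, e4, e5, Complex.ofReal_add, add_mul, Complex.exp_add]
    simp only [hF]; ring
  have e6 : ∫ t in (0 : ℝ)..2 * Real.pi, F (t + φ) = ∫ t in (0 : ℝ)..2 * Real.pi, F t := by
    rw [intervalIntegral.integral_comp_add_right, zero_add, add_comm]
    simpa using hper.intervalIntegral_add_eq φ 0
  simp only [e3, intervalIntegral.integral_const_mul, e6]
  rw [norm_mul, Complex.norm_exp_ofReal_mul_I, one_mul]
  refine le_trans ?_ (hC l Q δ hQ1 hδ1)
  gcongr
  rw [hl, abs_mul, abs_of_pos (show 0 < 2 * Real.pi * R by positivity)]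
  gcongr
  nlinarith [Real.pi_gt_three]

/-- The decay of the kernel arising from the averages of `‖graphFourier h A (θ ξ)‖²` over the
rotations for which `θ ξ` is close to the normal direction. -/
theorem exists_norm_integral_poleCutoff_le (N : ℕ) : ∃ C : ℝ, ∀ (R : ℝ), 0 < R →
    ∀ (i : Fin m) (ξ z : EuclideanSpace ℝ (Fin (m + 1))), ‖ξ‖ = R → z i.succ ≠ 0 →
      8 * |z 0| ≤ |z i.succ| →
      (R * |z i.succ|) ^ N * ‖∫ θ, (poleCutoff (SO.rotate θ ξ 0 / R) : ℂ) *
          fchar (SO.rotate θ ξ) z ∂SO.haar (m + 1)‖ ≤ C := by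
  obtain ⟨C, hC⟩ := exists_norm_integral_planeRot_le (m := m) N
  refine ⟨C, fun R hR i ξ z hξ hz0 hz => ?_⟩
  set h0 := (Fin.succ_ne_zero i).symm
  set F : EuclideanSpace ℝ (Fin (m + 1)) → ℂ := fun ζ =>
    (poleCutoff (ζ 0 / R) : ℂ) * fchar ζ z with hF
  have hFc : Continuous F := by
    have h1 : Continuous fun ζ : EuclideanSpace ℝ (Fin (m + 1)) => poleCutoff (ζ 0 / R) := by
      fun_prop
    exact (Complex.continuous_ofReal.comp h1).mul (by fun_prop)
  have hF1 : ∀ ζ, ‖F ζ‖ ≤ 1 := fun ζ => by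
    rw [hF, norm_mul, norm_fchar, mul_one, Complex.norm_real,
      Real.norm_of_nonneg (poleCutoff_nonneg _)]
    exact poleCutoff_le_one _
  have hinv : ∀ t, ∫ θ, F (SO.rotate (SO.planeRot h0 t) (SO.rotate θ ξ)) ∂SO.haar (m + 1) =
      ∫ θ, F (SO.rotate θ ξ) ∂SO.haar (m + 1) := fun t => by
    have h1 := integral_mul_left_eq_self (μ := SO.haar (m + 1)) (fun θ => F (SO.rotate θ ξ))
      (SO.planeRot h0 t)
    simpa only [SO.rotate_mul] using h1
  have hjc : Continuous fun p : ℝ × SO (m + 1) =>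
      F (SO.rotate (SO.planeRot h0 p.1) (SO.rotate p.2 ξ)) := by
    have h2 : Continuous fun p : ℝ × SO (m + 1) => SO.rotate p.2 ξ := by fun_prop
    exact hFc.comp (SO.continuous_rotate_planeRot h0 continuous_fst h2)
  have hswap : (2 * Real.pi) • ∫ θ, F (SO.rotate θ ξ) ∂SO.haar (m + 1) =
      ∫ θ, (∫ t in (0 : ℝ)..2 * Real.pi,
        F (SO.rotate (SO.planeRot h0 t) (SO.rotate θ ξ))) ∂SO.haar (m + 1) := by
    simp only [intervalIntegral.integral_of_le Real.two_pi_pos.le]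
    rw [← integral_integral_swap]
    · simp only [hinv]
      rw [setIntegral_const, measureReal_def, Real.volume_Ioc, sub_zero,
        ENNReal.toReal_ofReal Real.two_pi_pos.le]
    · exact Integrable.of_bound hjc.aestronglyMeasurable 1 (.of_forall fun p => hF1 _)
  have hn := congrArg norm hswap
  rw [norm_smul, Real.norm_of_nonneg Real.two_pi_pos.le] at hn
  have hC0 : 0 ≤ C := le_trans (by positivity) (hC R hR i ξ z hξ hz0 hz)
  have hb : (R * |z i.succ|) ^ N * ‖∫ θ, (∫ t in (0 : ℝ)..2 * Real.pi,
        F (SO.rotate (SO.planeRot h0 t) (SO.rotate θ ξ))) ∂SO.haar (m + 1)‖ ≤ C := by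
    have hp : 0 < (R * |z i.succ|) ^ N := pow_pos (mul_pos hR (abs_pos.2 hz0)) _
    rw [← le_div_iff₀' hp]
    refine (norm_integral_le_of_norm_le_const (C := C / (R * |z i.succ|) ^ N)
      (.of_forall fun θ => ?_)).trans (by simp)
    rw [le_div_iff₀' hp]
    exact hC R hR i (SO.rotate θ ξ) z (by simpa using hξ) hz0 hz
  rw [← hn] at hb
  refine le_trans ?_ hb
  gcongr
  nlinarith [Real.pi_gt_three, norm_nonneg (∫ θ, F (SO.rotate θ ξ) ∂SO.haar (m + 1))]

theorem exists_norm_sq_le_mul_sq (hm : 1 ≤ m) (y : EuclideanSpace ℝ (Fin m)) :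
    ∃ i, ‖y‖ ^ 2 ≤ m * y i ^ 2 := by
  have : Nonempty (Fin m) := ⟨⟨0, hm⟩⟩
  obtain ⟨i, hi⟩ := Finite.exists_max fun i => y i ^ 2
  refine ⟨i, ?_⟩
  rw [EuclideanSpace.norm_sq_eq]
  simp only [Real.norm_eq_abs, sq_abs]
  simpa using Finset.sum_le_card_nsmul Finset.univ (fun i => y i ^ 2) (y i ^ 2) fun k _ => hi k

variable {h : EuclideanSpace ℝ (Fin m) → ℝ}

/-- The small slope makes every chord of the graph nearly horizontal, so that rotations in the plane
of the normal direction and of the largest coordinate of the chord move the phase. -/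
theorem exists_norm_kernel_le (hm : 1 ≤ m) {η : ℝ} (hη : 0 < η)
    (hηm : 1024 * m * η ^ 2 ≤ 1) (hlip : ∀ y z, |h y - h z| ≤ η * ‖y - z‖) (N : ℕ) :
    ∃ C : ℝ, 0 ≤ C ∧ ∀ (ξ : EuclideanSpace ℝ (Fin (m + 1))), ξ ≠ 0 → ∀ y y',
      ‖∫ θ, (poleCutoff (SO.rotate θ ξ 0 / ‖ξ‖) : ℂ) *
          fchar (SO.rotate θ ξ) (graphMap h y - graphMap h y') ∂SO.haar (m + 1)‖ ≤
        C * ((1 + ‖‖ξ‖ • (y - y')‖) ^ N)⁻¹ := by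
  obtain ⟨C, hC⟩ := exists_norm_integral_poleCutoff_le (m := m) N
  have hm' : (1 : ℝ) ≤ m := by exact_mod_cast hm
  have hC0 : 0 ≤ max C 0 := le_max_right _ _
  refine ⟨2 ^ N * (1 + √m ^ N * max C 0), by positivity, fun ξ hξ y y' => ?_⟩
  set k := ∫ θ, (poleCutoff (SO.rotate θ ξ 0 / ‖ξ‖) : ℂ) *
          fchar (SO.rotate θ ξ) (graphMap h y - graphMap h y') ∂SO.haar (m + 1) with hk
  have hR : 0 < ‖ξ‖ := norm_pos_iff.2 hξ
  have hk1 : ‖k‖ ≤ 1 := by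
    refine (norm_integral_le_of_norm_le_const (C := 1) (.of_forall fun θ => ?_)).trans (by simp)
    rw [norm_mul, norm_fchar, mul_one, Complex.norm_real,
      Real.norm_of_nonneg (poleCutoff_nonneg _)]
    exact poleCutoff_le_one _
  set r := ‖‖ξ‖ • (y - y')‖ with hr
  have hr' : r = ‖ξ‖ * ‖y - y'‖ := by rw [hr, norm_smul, norm_norm]
  have hr0 : 0 ≤ r := norm_nonneg _
  have hkN : r ^ N * ‖k‖ ≤ 1 + √m ^ N * max C 0 := by
    obtain ⟨i, hi⟩ := exists_norm_sq_le_mul_sq hm (y - y')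
    have hi' : ‖y - y'‖ ≤ √m * |(y - y') i| := by
      rw [← Real.sqrt_sq_eq_abs, ← Real.sqrt_mul (by positivity)]
      exact Real.le_sqrt_of_sq_le hi
    rcases eq_or_ne y y' with hy | hy
    · have : r = 0 := by rw [hr', hy]; simp
      rw [this]
      have h2 : (0 : ℝ) ^ N ≤ 1 := pow_le_one₀ le_rfl zero_le_one
      have : 0 ≤ √(m : ℝ) ^ N * max C 0 := by positivity
      nlinarith [norm_nonneg k]
    · have hzi : (graphMap h y - graphMap h y') i.succ = (y - y') i := by
        simp [graphMap, ← consE_sub]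
      have hz0 : (graphMap h y - graphMap h y') 0 = h y - h y' := by
        simp [graphMap, ← consE_sub]
      have hpos : 0 < |(y - y') i| := by
        have : 0 < ‖y - y'‖ := norm_pos_iff.2 (sub_ne_zero.2 hy)
        by_contra hc
        nlinarith [Real.sqrt_nonneg (m : ℝ)]
      have hsq : 8 * η * √m ≤ 1 := by
        refine abs_le_of_sq_le_sq' ?_ zero_le_one |>.2
        rw [mul_pow, Real.sq_sqrt (by positivity)]
        nlinarith
      have h1 := hC ‖ξ‖ hR i ξ (graphMap h y - graphMap h y') rfl
        (by rw [hzi]; exact abs_pos.1 hpos) (by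
          rw [hz0, hzi]
          calc 8 * |h y - h y'| ≤ 8 * (η * (√m * |(y - y') i|)) := by
                gcongr; exact (hlip y y').trans (by gcongr)
            _ = (8 * η * √m) * |(y - y') i| := by ring
            _ ≤ 1 * |(y - y') i| := by gcongr
            _ = _ := one_mul _)
      rw [hzi] at h1
      calc r ^ N * ‖k‖ ≤ (√m * (‖ξ‖ * |(y - y') i|)) ^ N * ‖k‖ := by
            gcongr
            rw [hr', mul_left_comm]
            gcongr
        _ = √m ^ N * ((‖ξ‖ * |(y - y') i|) ^ N * ‖k‖) := by rw [mul_pow]; ring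
        _ ≤ √m ^ N * max C 0 := by gcongr; exact h1.trans (le_max_left _ _)
        _ ≤ _ := by linarith
  rw [← div_eq_mul_inv, le_div_iff₀ (by positivity)]
  rcases le_total r 1 with h1 | h1
  · calc ‖k‖ * (1 + r) ^ N ≤ 1 * (1 + 1) ^ N := by gcongr
      _ = 2 ^ N * 1 := by norm_num
      _ ≤ _ := by
        gcongr
        have : 0 ≤ √(m : ℝ) ^ N * max C 0 := by positivity
        linarith
  · calc ‖k‖ * (1 + r) ^ N ≤ ‖k‖ * (2 * r) ^ N := by gcongr; linarith
      _ = 2 ^ N * (r ^ N * ‖k‖) := by rw [mul_pow]; ring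
      _ ≤ _ := by gcongr

end Pole

end

noncomputable section

theorem lintegral_comp_smul {m : ℕ} {F : EuclideanSpace ℝ (Fin m) → ℝ≥0∞} (hF : Measurable F)
    {R : ℝ} (hR : 0 < R) :
    ∫⁻ y, F (R • y) = ENNReal.ofReal (R ^ m)⁻¹ * ∫⁻ y, F y := by
  rw [← lintegral_map hF (measurable_const_smul R), Measure.map_addHaar_smul _ hR.ne',
    lintegral_smul_measure, finrank_euclideanSpace_fin, abs_of_pos (by positivity), smul_eq_mul]

section Pole

variable {m : ℕ} {L : ℝ} {h : EuclideanSpace ℝ (Fin m) → ℝ}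

/-- The squared modulus of a Fourier transform as a double integral. -/
theorem graphFourier_mul_conj {A : EuclideanSpace ℝ (Fin m) → ℂ}
    (ζ : EuclideanSpace ℝ (Fin (m + 1))) :
    ((‖graphFourier h A ζ‖ ^ 2 : ℝ) : ℂ) =
      ∫ p : EuclideanSpace ℝ (Fin m) × EuclideanSpace ℝ (Fin m),
        A p.1 * star (A p.2) * fchar ζ (graphMap h p.1 - graphMap h p.2) := by
  have e : ((‖graphFourier h A ζ‖ ^ 2 : ℝ) : ℂ) =
      graphFourier h A ζ * star (graphFourier h A ζ) := by
    rw [RCLike.star_def, Complex.mul_conj, Complex.normSq_eq_norm_sq]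
  have e2 : star (graphFourier h A ζ) = ∫ y, star (A y * fchar ζ (graphMap h y)) := by
    rw [RCLike.star_def, graphFourier, ← integral_conj]
  rw [e, e2, graphFourier, Measure.volume_eq_prod, ← integral_prod_mul]
  refine integral_congr_ae (.of_forall fun p => ?_)
  simp only [fchar_sub_right, star_mul']
  ring

/-- Near the normal direction the square is expanded into a double integral over the graph. Averaging
over rotations first gives a kernel which is rapidly decreasing at scale `‖ξ‖⁻¹` along the graph, and
its integral in one variable is `O(‖ξ‖⁻ᵐ)`. Only the small slope of `h` is used. -/
theorem exists_lintegral_poleCutoff_le (hm : 1 ≤ m) {η : ℝ} (hη : 0 < η)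
    (hηm : 1024 * m * η ^ 2 ≤ 1) (hlip : ∀ y z, |h y - h z| ≤ η * ‖y - z‖) (hh : Continuous h)
    (L : ℝ) : ∃ C : ℝ≥0, ∀ ξ : EuclideanSpace ℝ (Fin (m + 1)), ξ ≠ 0 →
      ∫⁻ θ, ENNReal.ofReal (poleCutoff (SO.rotate θ ξ 0 / ‖ξ‖)) *
        ‖graphFourier h ((Metric.closedBall 0 L).indicator 1) (SO.rotate θ ξ)‖ₑ ^ 2
          ∂SO.haar (m + 1) ≤ C * ENNReal.ofReal (‖ξ‖ ^ m)⁻¹ := by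
  obtain ⟨C, hC0, hC⟩ := exists_norm_kernel_le hm hη hηm hlip (m + 1)
  set A : EuclideanSpace ℝ (Fin m) → ℂ := (Metric.closedBall 0 L).indicator 1 with hA
  have hAd := admissible_indicator (m := m) (L := L) (τ := 0)
  set V := volume (Metric.closedBall (0 : EuclideanSpace ℝ (Fin m)) L) with hV
  have hVt : V ≠ ⊤ := measure_closedBall_lt_top.ne
  set g : EuclideanSpace ℝ (Fin m) → ℝ≥0∞ := fun y => ENNReal.ofReal ((1 + ‖y‖) ^ (m + 1))⁻¹ with hg
  have hgm : Measurable g := by fun_prop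
  set I := ∫⁻ y, g y with hI
  have hIt : I ≠ ⊤ := by
    have h1 : Integrable (fun y : EuclideanSpace ℝ (Fin m) => ((1 + ‖y‖) ^ (m + 1))⁻¹) := by
      have := integrable_one_add_norm (E := EuclideanSpace ℝ (Fin m)) (μ := volume)
        (r := ((m + 1 : ℕ) : ℝ)) (by simp)
      refine this.congr (.of_forall fun y => ?_)
      dsimp only
      rw [Real.rpow_neg (by positivity), Real.rpow_natCast]
    rw [hI, hg, ← ofReal_integral_eq_lintegral_ofReal h1 (.of_forall fun y => by positivity)]
    exact ENNReal.ofReal_ne_top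
  refine ⟨V.toNNReal * (Real.toNNReal C * I.toNNReal), fun ξ hξ => ?_⟩
  have hR : 0 < ‖ξ‖ := norm_pos_iff.2 hξ
  set w : SO (m + 1) → ℝ := fun θ => poleCutoff (SO.rotate θ ξ 0 / ‖ξ‖) with hw
  have hwc : Continuous w := by
    have : Continuous fun θ : SO (m + 1) => SO.rotate θ ξ := by fun_prop
    simp only [hw]
    fun_prop
  have hw0 : ∀ θ, 0 ≤ w θ := fun θ => poleCutoff_nonneg _
  have hw1 : ∀ θ, ‖w θ‖ ≤ 1 := fun θ => by
    rw [Real.norm_of_nonneg (hw0 θ)]; exact poleCutoff_le_one _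
  have hUc : Continuous fun θ : SO (m + 1) => graphFourier h A (SO.rotate θ ξ) :=
    (continuous_graphFourier hh hAd.integrable).comp (by fun_prop)
  have hAm : Measurable A := hAd.measurable
  have hi : Integrable (fun p : EuclideanSpace ℝ (Fin m) × EuclideanSpace ℝ (Fin m) =>
      A p.1 * star (A p.2)) (volume.prod volume) := by
    have : Integrable (fun y => star (A y)) :=
      hAd.integrable.mono (continuous_star.measurable.comp hAm).aestronglyMeasurable
        (.of_forall fun y => (norm_star _).le)
    exact hAd.integrable.mul_prod this
  have hjoint : Integrable (Function.uncurry fun (θ : SO (m + 1))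
      (p : EuclideanSpace ℝ (Fin m) × EuclideanSpace ℝ (Fin m)) => (w θ : ℂ) *
        (A p.1 * star (A p.2) * fchar (SO.rotate θ ξ) (graphMap h p.1 - graphMap h p.2)))
      ((SO.haar (m + 1)).prod (volume.prod volume)) := by
    have h1 := hi.comp_snd (SO.haar (m + 1))
    have h2 := h1.mul_bdd (c := 1) (g := fun q : SO (m + 1) × EuclideanSpace ℝ (Fin m) ×
      EuclideanSpace ℝ (Fin m) => (w q.1 : ℂ) *
        fchar (SO.rotate q.1 ξ) (graphMap h q.2.1 - graphMap h q.2.2))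
      (by fun_prop : Continuous _).aestronglyMeasurable (.of_forall fun q => by
        rw [norm_mul, norm_fchar, mul_one, Complex.norm_real]; exact hw1 _)
    refine h2.congr (.of_forall fun q => ?_)
    simp only [Function.uncurry]
    ring
  have hint : Integrable (fun θ => w θ * ‖graphFourier h A (SO.rotate θ ξ)‖ ^ 2)
      (SO.haar (m + 1)) :=
    (by fun_prop : Continuous fun θ => w θ * ‖graphFourier h A (SO.rotate θ ξ)‖ ^ 2)
      |>.integrable_of_hasCompactSupport (HasCompactSupport.of_compactSpace _)
  calc ∫⁻ θ, ENNReal.ofReal (w θ) * ‖graphFourier h A (SO.rotate θ ξ)‖ₑ ^ 2 ∂SO.haar (m + 1)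
      = ∫⁻ θ, ENNReal.ofReal (w θ * ‖graphFourier h A (SO.rotate θ ξ)‖ ^ 2) ∂SO.haar (m + 1) := by
        refine lintegral_congr fun θ => ?_
        rw [ENNReal.ofReal_mul (hw0 θ), ENNReal.ofReal_pow (norm_nonneg _), ofReal_norm]
    _ = ENNReal.ofReal (∫ θ, w θ * ‖graphFourier h A (SO.rotate θ ξ)‖ ^ 2 ∂SO.haar (m + 1)) :=
        (ofReal_integral_eq_lintegral_ofReal hint
          (.of_forall fun θ => mul_nonneg (hw0 θ) (sq_nonneg _))).symm
    _ ≤ ‖((∫ θ, w θ * ‖graphFourier h A (SO.rotate θ ξ)‖ ^ 2 ∂SO.haar (m + 1) : ℝ) : ℂ)‖ₑ := by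
        rw [← ofReal_norm, Complex.norm_real]
        exact ENNReal.ofReal_le_ofReal (Real.le_norm_self _)
    _ = ‖∫ p : EuclideanSpace ℝ (Fin m) × EuclideanSpace ℝ (Fin m), A p.1 * star (A p.2) *
          ∫ θ, (w θ : ℂ) * fchar (SO.rotate θ ξ) (graphMap h p.1 - graphMap h p.2)
            ∂SO.haar (m + 1)‖ₑ := by
        congr 1
        rw [← integral_complex_ofReal]
        simp only [Complex.ofReal_mul, graphFourier_mul_conj, ← integral_const_mul]
        rw [Measure.volume_eq_prod, integral_integral_swap hjoint]
        refine integral_congr_ae (.of_forall fun p => ?_)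
        refine integral_congr_ae (.of_forall fun θ => ?_)
        ring
    _ ≤ ∫⁻ p : EuclideanSpace ℝ (Fin m) × EuclideanSpace ℝ (Fin m), ‖A p.1‖ₑ *
          (ENNReal.ofReal C * g (‖ξ‖ • (p.1 - p.2))) := by
        refine (enorm_integral_le_lintegral_enorm _).trans (lintegral_mono fun p => ?_)
        rw [enorm_mul, enorm_mul]
        gcongr
        · refine mul_le_of_le_one_right zero_le ?_
          rw [← ofReal_norm, norm_star]
          exact ENNReal.ofReal_le_one.2 (hAd.norm_le _)
        · rw [← ofReal_norm, hg, ← ENNReal.ofReal_mul hC0]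
          exact ENNReal.ofReal_le_ofReal (hC ξ hξ _ _)
    _ = ∫⁻ y, ‖A y‖ₑ * (ENNReal.ofReal C * (ENNReal.ofReal (‖ξ‖ ^ m)⁻¹ * I)) := by
        rw [Measure.volume_eq_prod, lintegral_prod _ (by fun_prop)]
        refine lintegral_congr fun y => ?_
        dsimp only
        rw [lintegral_const_mul _ (by fun_prop), lintegral_const_mul _ (by fun_prop),
          lintegral_sub_left_eq_self (fun y => g (‖ξ‖ • y)) y, lintegral_comp_smul hgm hR]
    _ ≤ V * (ENNReal.ofReal C * (ENNReal.ofReal (‖ξ‖ ^ m)⁻¹ * I)) := by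
        rw [lintegral_mul_const _ hAm.enorm]
        gcongr
        rw [hV, ← lintegral_indicator_one measurableSet_closedBall]
        exact lintegral_mono fun y => enorm_le_indicator hAd.norm_le hAd.eq_zero y
    _ = _ := by
        push_cast
        rw [ENNReal.coe_toNNReal hVt, ENNReal.coe_toNNReal hIt, ENNReal.ofReal]
        ring

/-- The averaged decay of the Fourier transform of a cap of a convex hypersurface which is a graph
with small slope. -/
theorem exists_lintegral_graphFourier_ball_le (hm : 1 ≤ m) {η : ℝ} (hη : 0 < η)
    (hηm : 1024 * m * η ^ 2 ≤ 1) (hconc : ConcaveOn ℝ Set.univ h)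
    (hlip : ∀ y z, |h y - h z| ≤ η * ‖y - z‖) (hh : Continuous h) (hL : 1 ≤ L) :
    ∃ C : ℝ≥0, ∀ ξ : EuclideanSpace ℝ (Fin (m + 1)), 1 ≤ ‖ξ‖ →
      ∫⁻ θ, ‖graphFourier h ((Metric.closedBall 0 L).indicator 1) (SO.rotate θ ξ)‖ₑ ^ 2
          ∂SO.haar (m + 1) ≤ C * ENNReal.ofReal (‖ξ‖ ^ m)⁻¹ := by
  obtain ⟨C, hC⟩ := exists_lintegral_poleCutoff_le hm hη hηm hlip hh L
  choose D hD using exists_setLIntegral_graphFourier_le hm hη hηm hconc hlip hh hL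
  refine ⟨C + ∑ i, D i, fun ξ hξ => ?_⟩
  have hξ0 : ξ ≠ 0 := by rintro rfl; norm_num at hξ
  set A : EuclideanSpace ℝ (Fin m) → ℂ := (Metric.closedBall 0 L).indicator 1 with hA
  have hAd := admissible_indicator (m := m) (L := L) (τ := 0)
  have hrc : Continuous fun θ : SO (m + 1) => SO.rotate θ ξ := by fun_prop
  have hUm : Measurable fun θ : SO (m + 1) => ‖graphFourier h A (SO.rotate θ ξ)‖ₑ ^ 2 :=
    ((continuous_graphFourier hh hAd.integrable).comp hrc).enorm.measurable.pow_const 2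
  have hSm : ∀ i : Fin m, MeasurableSet
      {θ : SO (m + 1) | ‖ξ‖ ^ 2 ≤ 4 * m * (SO.rotate θ ξ i.succ) ^ 2} := fun i =>
    (isClosed_le continuous_const (by fun_prop)).measurableSet
  have hpt : ∀ θ : SO (m + 1), ‖graphFourier h A (SO.rotate θ ξ)‖ₑ ^ 2 ≤
      ENNReal.ofReal (poleCutoff (SO.rotate θ ξ 0 / ‖ξ‖)) *
        ‖graphFourier h A (SO.rotate θ ξ)‖ₑ ^ 2 +
      ∑ i : Fin m, {θ : SO (m + 1) | ‖ξ‖ ^ 2 ≤ 4 * m * (SO.rotate θ ξ i.succ) ^ 2}.indicator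
        (fun θ => ‖graphFourier h A (SO.rotate θ ξ)‖ₑ ^ 2) θ := by
    intro θ
    by_cases hc : 1 / 4 ≤ (SO.rotate θ ξ 0 / ‖ξ‖) ^ 2
    · rw [poleCutoff_eq_one hc]; simp
    · obtain ⟨i, hi⟩ := exists_norm_sq_le_mul_sq hm (tailE (SO.rotate θ ξ))
      refine le_add_left ((Finset.single_le_sum (f := fun i : Fin m =>
        {θ : SO (m + 1) | ‖ξ‖ ^ 2 ≤ 4 * m * (SO.rotate θ ξ i.succ) ^ 2}.indicator
        (fun θ => ‖graphFourier h A (SO.rotate θ ξ)‖ₑ ^ 2) θ) (fun _ _ => zero_le)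
        (Finset.mem_univ i)).trans' ?_)
      dsimp only
      rw [Set.indicator_of_mem]
      have h1 := norm_consE_sq (SO.rotate θ ξ 0) (tailE (SO.rotate θ ξ))
      rw [consE_tailE, SO.norm_rotate] at h1
      rw [tailE_apply] at hi
      rw [div_pow, le_div_iff₀ (by positivity)] at hc
      change ‖ξ‖ ^ 2 ≤ 4 * m * (SO.rotate θ ξ i.succ) ^ 2
      nlinarith
  have hwm : Measurable fun θ : SO (m + 1) =>
      ENNReal.ofReal (poleCutoff (SO.rotate θ ξ 0 / ‖ξ‖)) *
        ‖graphFourier h A (SO.rotate θ ξ)‖ₑ ^ 2 :=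
    (by fun_prop : Continuous fun θ : SO (m + 1) =>
      poleCutoff (SO.rotate θ ξ 0 / ‖ξ‖)).measurable.ennreal_ofReal.mul hUm
  calc _ ≤ _ := lintegral_mono hpt
    _ = ∫⁻ θ, ENNReal.ofReal (poleCutoff (SO.rotate θ ξ 0 / ‖ξ‖)) *
        ‖graphFourier h A (SO.rotate θ ξ)‖ₑ ^ 2 ∂SO.haar (m + 1) +
        ∑ i : Fin m, ∫⁻ θ in {θ | ‖ξ‖ ^ 2 ≤ 4 * m * (SO.rotate θ ξ i.succ) ^ 2},
          ‖graphFourier h A (SO.rotate θ ξ)‖ₑ ^ 2 ∂SO.haar (m + 1) := by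
        rw [lintegral_add_left hwm,
          lintegral_finsetSum _ fun i _ => hUm.indicator (hSm i)]
        simp only [lintegral_indicator (hSm _)]
    _ ≤ C * ENNReal.ofReal (‖ξ‖ ^ m)⁻¹ + ∑ i, D i * ENNReal.ofReal (‖ξ‖ ^ m)⁻¹ := by
        gcongr with i
        · exact hC ξ hξ0
        · exact hD i ξ hξ
    _ = _ := by rw [← Finset.sum_mul, ← add_mul]; push_cast; rfl

end Pole

end

noncomputable section

/-! ### Dyadic regularizations of the surface measure -/

open scoped SchwartzMap LineDeriv

/-- A sequence of points moving monotonically along a line enters and leaves a convex set at most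
once. -/
theorem sum_norm_indicator_sub_le {V : Type*} [AddCommGroup V] [Module ℝ V] {S : Set V}
    (hS : Convex ℝ S) (x w : V) {t : ℕ → ℝ} (ht : Antitone t) (J : ℕ) :
    ∑ j ∈ Finset.range J, ‖S.indicator (1 : V → ℂ) (x - t (j + 1) • w) -
      S.indicator (1 : V → ℂ) (x - t j • w)‖ ≤ 2 := by
  classical
  have hT : Convex ℝ {s : ℝ | x - s • w ∈ S} := by
    intro s hs r hr a b ha hb hab
    have := hS hs hr ha hb hab
    have e : a • (x - s • w) + b • (x - r • w) = x - (a • s + b • r) • w := by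
      have : x = (a + b) • x := by rw [hab, one_smul]
      nth_rewrite 3 [this]
      simp only [smul_eq_mul]
      module
    rwa [e] at this
  -- the indicator is the product of an increasing and of a decreasing one
  set p : ℕ → ℝ := fun j => if ∃ i ≤ j, x - t i • w ∈ S then 1 else 0 with hp
  set q : ℕ → ℝ := fun j => if ∃ k, j ≤ k ∧ x - t k • w ∈ S then 1 else 0 with hq
  have hpq : ∀ j, S.indicator (1 : V → ℂ) (x - t j • w) = ((p j * q j : ℝ) : ℂ) := by
    intro j
    by_cases hj : x - t j • w ∈ S
    · rw [Set.indicator_of_mem hj, hp, hq]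
      simp only
      rw [if_pos ⟨j, le_rfl, hj⟩, if_pos ⟨j, le_rfl, hj⟩]; simp
    · rw [Set.indicator_of_notMem hj]
      by_cases h1 : ∃ i ≤ j, x - t i • w ∈ S
      · by_cases h2 : ∃ k, j ≤ k ∧ x - t k • w ∈ S
        · obtain ⟨i, hi, hiS⟩ := h1
          obtain ⟨k, hk, hkS⟩ := h2
          exact absurd (hT.ordConnected.out hkS hiS ⟨ht hk, ht hi⟩) hj
        · simp only [hq, if_neg h2]; simp
      · simp only [hp, if_neg h1]; simp
  have hp1 : Monotone p := fun a b hab => by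
    simp only [hp]
    split_ifs with h1 h2 h2
    · exact le_rfl
    · exact absurd (h1.imp fun i hi => ⟨hi.1.trans hab, hi.2⟩) h2
    · exact zero_le_one
    · exact le_rfl
  have hq1 : Antitone q := fun a b hab => by
    simp only [hq]
    split_ifs with h1 h2 h2
    · exact le_rfl
    · exact absurd (h1.imp fun i hi => ⟨hab.trans hi.1, hi.2⟩) h2
    · exact zero_le_one
    · exact le_rfl
  have hp0 : ∀ j, p j ∈ Set.Icc (0 : ℝ) 1 := fun j => by
    simp only [hp]; split_ifs <;> simp
  have hq0 : ∀ j, q j ∈ Set.Icc (0 : ℝ) 1 := fun j => by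
    simp only [hq]; split_ifs <;> simp
  have hstep : ∀ j, ‖S.indicator (1 : V → ℂ) (x - t (j + 1) • w) -
      S.indicator (1 : V → ℂ) (x - t j • w)‖ ≤ (p (j + 1) - p j) - (q (j + 1) - q j) := by
    intro j
    rw [hpq, hpq, ← Complex.ofReal_sub, Complex.norm_real]
    have h1 := hp1 (Nat.le_succ j)
    have h2 := hq1 (Nat.le_succ j)
    obtain ⟨a1, a2⟩ := hp0 j
    obtain ⟨b1, b2⟩ := hp0 (j + 1)
    obtain ⟨c1, c2⟩ := hq0 j
    obtain ⟨d1, d2⟩ := hq0 (j + 1)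
    simp only [Nat.succ_eq_add_one] at h1 h2
    rw [Real.norm_eq_abs, abs_le]
    constructor <;> nlinarith
  calc _ ≤ ∑ j ∈ Finset.range J, ((p (j + 1) - p j) - (q (j + 1) - q j)) :=
        Finset.sum_le_sum fun j _ => hstep j
    _ = (p J - p 0) - (q J - q 0) := by
        rw [Finset.sum_sub_distrib, Finset.sum_range_sub, Finset.sum_range_sub]
    _ ≤ 2 := by linarith [(hp0 J).2, (hp0 0).1, (hq0 J).1, (hq0 0).2]

/-- Summation by parts. -/
theorem norm_sub_one_mul_sum_le {v : ℂ} (hv : ‖v‖ = 1) (a : ℕ → ℂ) (J : ℕ) :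
    ‖(v - 1) * ∑ j ∈ Finset.range J, v ^ j * a j‖ ≤
      ‖a J‖ + ‖a 0‖ + ∑ j ∈ Finset.range J, ‖a (j + 1) - a j‖ := by
  have key : (v - 1) * ∑ j ∈ Finset.range J, v ^ j * a j =
      v ^ J * a J - a 0 - ∑ j ∈ Finset.range J, v ^ (j + 1) * (a (j + 1) - a j) := by
    induction J with
    | zero => simp
    | succ J ih => rw [Finset.sum_range_succ, mul_add, ih, Finset.sum_range_succ]; ring
  rw [key]
  refine (norm_sub_le _ _).trans (add_le_add ((norm_sub_le _ _).trans ?_) ?_)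
  · rw [norm_mul, norm_pow, hv, one_pow, one_mul]
  · refine (norm_sum_le _ _).trans (Finset.sum_le_sum fun j _ => ?_)
    rw [norm_mul, norm_pow, hv, one_pow, one_mul]

section Dyadic

variable {m : ℕ}

theorem consE_eq_smul_add (s : ℝ) (y : EuclideanSpace ℝ (Fin m)) :
    consE s y = s • consE 1 0 + consE 0 y := by
  rw [← consE_smul, ← consE_add]; simp

/-- The part below the graph of `h` of the cylinder over a ball. -/
def subgraph (h : EuclideanSpace ℝ (Fin m) → ℝ) (L : ℝ) : Set (EuclideanSpace ℝ (Fin (m + 1))) :=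
  {u | ‖tailE u‖ ≤ L ∧ u 0 ≤ h (tailE u)}

variable {h : EuclideanSpace ℝ (Fin m) → ℝ} {L : ℝ}

theorem tailE_add (u v : EuclideanSpace ℝ (Fin (m + 1))) : tailE (u + v) = tailE u + tailE v := rfl

theorem tailE_smul (c : ℝ) (u : EuclideanSpace ℝ (Fin (m + 1))) : tailE (c • u) = c • tailE u := rfl

theorem convex_subgraph (hconc : ConcaveOn ℝ Set.univ h) (L : ℝ) : Convex ℝ (subgraph h L) := by
  intro u hu v hv a b ha hb hab
  refine ⟨?_, ?_⟩
  · rw [tailE_add, tailE_smul, tailE_smul]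
    have := convex_closedBall (0 : EuclideanSpace ℝ (Fin m)) L
      (mem_closedBall_zero_iff.2 hu.1) (mem_closedBall_zero_iff.2 hv.1) ha hb hab
    exact mem_closedBall_zero_iff.1 this
  · rw [tailE_add, tailE_smul, tailE_smul]
    have h1 := hconc.2 (Set.mem_univ (tailE u)) (Set.mem_univ (tailE v)) ha hb hab
    refine le_trans ?_ h1
    have e : (a • u + b • v) 0 = a * u 0 + b * v 0 := rfl
    rw [e, smul_eq_mul, smul_eq_mul]
    exact add_le_add (mul_le_mul_of_nonneg_left hu.2 ha) (mul_le_mul_of_nonneg_left hv.2 hb)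

theorem measurableSet_subgraph (hh : Continuous h) (L : ℝ) : MeasurableSet (subgraph h L) :=
  MeasurableSet.inter
    (isClosed_le (by fun_prop : Continuous fun u : EuclideanSpace ℝ (Fin (m + 1)) => ‖tailE u‖)
      continuous_const).measurableSet
    (isClosed_le (by fun_prop : Continuous fun u : EuclideanSpace ℝ (Fin (m + 1)) => u 0)
      (by fun_prop : Continuous fun u => h (tailE u))).measurableSet

/-- The convolution of the measure on the graph of `h` over a ball with the dilate by `2⁻ʲ` of the
function `ρ`, normalized in `L¹`. -/
def dyadicKernel (ρ : EuclideanSpace ℝ (Fin (m + 1)) → ℂ) (h : EuclideanSpace ℝ (Fin m) → ℝ) (L : ℝ)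
    (j : ℕ) (x : EuclideanSpace ℝ (Fin (m + 1))) : ℂ :=
  ∫ y, (Metric.closedBall 0 L).indicator 1 y *
    (((2 : ℝ) ^ j) ^ (m + 1) • ρ ((2 : ℝ) ^ j • (x - graphMap h y)))

variable (ρ : 𝓢(EuclideanSpace ℝ (Fin (m + 1)), ℂ))

/-- The regularization of the surface measure, weakened by the factor `2⁻ʲ`, is an average of
translates of the indicator function of a convex set. -/
theorem inv_smul_dyadicKernel (hh : Continuous h) (j : ℕ) (x : EuclideanSpace ℝ (Fin (m + 1))) :
    ((2 : ℝ) ^ j)⁻¹ • dyadicKernel ρ h L j x =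
      -∫ w, (subgraph h L).indicator (1 : EuclideanSpace ℝ (Fin (m + 1)) → ℂ)
        (x - ((2 : ℝ) ^ j)⁻¹ • w) * (∂_{consE 1 (0 : EuclideanSpace ℝ (Fin m))} ρ) w := by
  set r : ℝ := 2 ^ j with hr
  have hr0 : 0 < r := by positivity
  set D : 𝓢(EuclideanSpace ℝ (Fin (m + 1)), ℂ) :=
    ∂_{consE 1 (0 : EuclideanSpace ℝ (Fin m))} ρ with hD
  set F : EuclideanSpace ℝ (Fin (m + 1)) → ℂ := fun w =>
    (subgraph h L).indicator (1 : EuclideanSpace ℝ (Fin (m + 1)) → ℂ) (x - r⁻¹ • w) * D w with hF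
  have e1 : ∫ w, F w = r ^ (m + 1) • ∫ u, F (r • (x - u)) := by
    rw [integral_sub_left_eq_self (fun u => F (r • u)) volume x, Measure.integral_comp_smul,
      finrank_euclideanSpace_fin, abs_of_pos (by positivity), smul_smul,
      mul_inv_cancel₀ (by positivity), one_smul]
  have e2 : ∀ u, F (r • (x - u)) = (subgraph h L).indicator
      (1 : EuclideanSpace ℝ (Fin (m + 1)) → ℂ) u * D (r • (x - u)) := fun u => by
    simp only [hF]
    rw [inv_smul_smul₀ hr0.ne', sub_sub_cancel]
  have i1 : Integrable fun u => D (r • (x - u)) :=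
    (D.integrable.comp_smul hr0.ne').comp_sub_left x
  have i2 : Integrable fun u => (subgraph h L).indicator
      (1 : EuclideanSpace ℝ (Fin (m + 1)) → ℂ) u * D (r • (x - u)) := by
    refine (i1.indicator (measurableSet_subgraph hh L)).congr (.of_forall fun u => ?_)
    by_cases hu : u ∈ subgraph h L <;> simp [hu]
  have hsec : ∀ᵐ y : EuclideanSpace ℝ (Fin m), Integrable fun s : ℝ => D (r • (x - consE s y)) := by
    have := (measurePreserving_consE (m := m)).integrable_comp_emb measurableEmbedding_consE |>.2 i1
    exact this.prod_left_ae
  rw [e1, integral_congr_ae (.of_forall e2), integral_consE i2]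
  have e3 : ∀ᵐ y : EuclideanSpace ℝ (Fin m), ∫ s : ℝ, (subgraph h L).indicator
      (1 : EuclideanSpace ℝ (Fin (m + 1)) → ℂ) (consE s y) * D (r • (x - consE s y)) =
      (Metric.closedBall 0 L).indicator 1 y * (-r⁻¹ * ρ (r • (x - graphMap h y))) := by
    filter_upwards [hsec] with y hy
    have e4 : ∀ s, (subgraph h L).indicator
      (1 : EuclideanSpace ℝ (Fin (m + 1)) → ℂ) (consE s y) * D (r • (x - consE s y)) =
      (Metric.closedBall 0 L).indicator 1 y *
        (Set.Iic (h y)).indicator (fun s => D (r • (x - consE s y))) s := fun s => by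
      by_cases h1 : ‖y‖ ≤ L <;> by_cases h2 : s ≤ h y <;>
        simp [subgraph, Set.indicator, h1, h2]
    simp only [e4]
    rw [integral_const_mul, integral_indicator measurableSet_Iic]
    congr 1
    have hd : ∀ s ∈ Set.Iic (h y), HasDerivAt (fun s => -(r⁻¹ : ℂ) * ρ (r • (x - consE s y)))
        (D (r • (x - consE s y))) s := fun s _ => by
      have h1 : HasDerivAt (fun s : ℝ => r • (x - consE s y))
          (-(r • consE 1 (0 : EuclideanSpace ℝ (Fin m)))) s := by
        have h2 : HasDerivAt (fun s : ℝ => r • (x - (s • consE 1 (0 : EuclideanSpace ℝ (Fin m)) +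
            consE 0 y))) (r • (-((1 : ℝ) • consE 1 (0 : EuclideanSpace ℝ (Fin m))))) s :=
          ((((hasDerivAt_id s).smul_const _).add_const _).const_sub x).const_smul r
        simpa only [← consE_eq_smul_add, one_smul, smul_neg] using h2
      have h3 := (ρ.differentiableAt (x := r • (x - consE s y))).hasFDerivAt.comp_hasDerivAt s h1
      convert! h3.const_mul (-(r⁻¹ : ℂ)) using 1
      rw [hD, SchwartzMap.lineDerivOp_apply_eq_fderiv, map_neg, map_smul, Complex.real_smul]
      have : (r : ℂ) ≠ 0 := by exact_mod_cast hr0.ne'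
      field_simp
    have hlim : Filter.Tendsto (fun s => -(r⁻¹ : ℂ) * ρ (r • (x - consE s y))) Filter.atBot
        (nhds (-(r⁻¹ : ℂ) * 0)) := by
      refine (ρ.tendsto_cocompact.comp ?_).const_mul _
      rw [← Metric.cobounded_eq_cocompact, ← comap_norm_atTop, Filter.tendsto_comap_iff]
      have h5 : Filter.Tendsto (fun s : ℝ => r * (x 0 - s)) Filter.atBot Filter.atTop :=
        (Filter.tendsto_atTop_add_const_left _ (x 0) Filter.tendsto_neg_atBot_atTop).const_mul_atTop
          hr0
      refine Filter.tendsto_atTop_mono (fun s => ?_) h5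
      simp only [Function.comp_apply]
      rw [norm_smul, Real.norm_of_nonneg hr0.le]
      gcongr
      have := PiLp.norm_apply_le (x - consE s y) 0
      exact (Real.le_norm_self _).trans this
    rw [integral_Iic_of_hasDerivAt_of_tendsto' hd hy.integrableOn hlim, mul_zero, sub_zero,
      Complex.ofReal_inv, graphMap]
  rw [integral_congr_ae e3, dyadicKernel, ← integral_smul, ← integral_smul, ← integral_neg]
  refine integral_congr_ae (.of_forall fun y => ?_)
  simp only [Complex.real_smul, ← hr]
  have : (r : ℂ) ≠ 0 := by exact_mod_cast hr0.ne'
  rw [Complex.ofReal_inv, Complex.ofReal_pow]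
  field_simp

/-- The analytic family of kernels: at `z = 0` it is the regularized surface measure, and the
frequencies of size `2ʲ` are damped by the factor `2⁻ʲᶻ`. The factor in front of the sum keeps the
family bounded for `Re z = 1`. -/
def stripKernel (ρ : EuclideanSpace ℝ (Fin (m + 1)) → ℂ) (h : EuclideanSpace ℝ (Fin m) → ℝ) (L : ℝ)
    (J : ℕ) (z : ℂ) (x : EuclideanSpace ℝ (Fin (m + 1))) : ℂ :=
  dyadicKernel ρ h L 0 x + (Complex.exp ((1 - z) * Real.log 2) - 1) *
    ∑ j ∈ Finset.range J, Complex.exp (-(j * z * Real.log 2)) *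
      (dyadicKernel ρ h L (j + 1) x - dyadicKernel ρ h L j x)

theorem exp_log_two : Complex.exp (Real.log 2 : ℝ) = 2 := by
  rw [← Complex.ofReal_exp, Real.exp_log two_pos]; simp

theorem stripKernel_zero (ρ : EuclideanSpace ℝ (Fin (m + 1)) → ℂ) (J : ℕ) :
    stripKernel ρ h L J 0 = dyadicKernel ρ h L J := by
  funext x
  simp only [stripKernel, sub_zero, one_mul, exp_log_two, mul_zero, zero_mul, neg_zero,
    Complex.exp_zero]
  rw [Finset.sum_range_sub (fun j => dyadicKernel ρ h L j x)]
  ring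

/-- On the line `Re z = 1` the kernels are bounded, uniformly in the number of scales. This is where
the convexity of the surface enters. -/
theorem norm_stripKernel_le (hconc : ConcaveOn ℝ Set.univ h) (hh : Continuous h) (J : ℕ) {z : ℂ}
    (hz : z.re = 1) (x : EuclideanSpace ℝ (Fin (m + 1))) :
    ‖stripKernel ρ h L J z x‖ ≤
      13 * ∫ w, ‖(∂_{consE 1 (0 : EuclideanSpace ℝ (Fin m))} ρ) w‖ := by
  set D := ∂_{consE 1 (0 : EuclideanSpace ℝ (Fin m))} ρ with hD
  set I := ∫ w, ‖D w‖ with hI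
  set b : ℕ → ℂ := fun j => ((2 : ℝ) ^ j)⁻¹ • dyadicKernel ρ h L j x with hb
  set χ := (subgraph h L).indicator (1 : EuclideanSpace ℝ (Fin (m + 1)) → ℂ) with hχ
  have hχm : Measurable χ := measurable_one.indicator (measurableSet_subgraph hh L)
  have hχ1 : ∀ u, ‖χ u‖ ≤ 1 := fun u => by
    by_cases hu : u ∈ subgraph h L <;> simp [hχ, hu]
  have hbi : ∀ j, b j = -∫ w, χ (x - ((2 : ℝ) ^ j)⁻¹ • w) * D w := fun j =>
    inv_smul_dyadicKernel ρ hh j x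
  have hint : ∀ j, Integrable fun w => χ (x - ((2 : ℝ) ^ j)⁻¹ • w) * D w := fun j => by
    refine D.integrable.bdd_mul (c := 1) (Measurable.aestronglyMeasurable ?_)
      (.of_forall fun w => hχ1 _)
    exact hχm.comp (by fun_prop)
  have hb1 : ∀ j, ‖b j‖ ≤ I := fun j => by
    rw [hbi, norm_neg]
    refine norm_integral_le_of_norm_le D.integrable.norm (.of_forall fun w => ?_)
    rw [norm_mul]
    exact mul_le_of_le_one_left (norm_nonneg _) (hχ1 _)
  -- the scales `b j` have bounded variation: the points `x - 2⁻ʲ w` move along a line, which meets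
  -- the boundary of a convex set at most twice
  have hb2 : ∀ J, ∑ j ∈ Finset.range J, ‖b (j + 1) - b j‖ ≤ 2 * I := fun J => by
    have h1 : ∀ j, ‖b (j + 1) - b j‖ ≤
        ∫ w, ‖χ (x - ((2 : ℝ) ^ (j + 1))⁻¹ • w) - χ (x - ((2 : ℝ) ^ j)⁻¹ • w)‖ * ‖D w‖ := by
      intro j
      rw [hbi, hbi, neg_sub_neg, norm_sub_rev, ← integral_sub (hint _) (hint _)]
      refine (norm_integral_le_integral_norm _).trans_eq (integral_congr_ae (.of_forall fun w => ?_))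
      dsimp only
      rw [← sub_mul, norm_mul]
    have h2 : ∀ j, Integrable fun w =>
        ‖χ (x - ((2 : ℝ) ^ (j + 1))⁻¹ • w) - χ (x - ((2 : ℝ) ^ j)⁻¹ • w)‖ * ‖D w‖ := fun j => by
      refine ((hint (j + 1)).sub (hint j)).norm.congr (.of_forall fun w => ?_)
      simp only [Pi.sub_apply]
      rw [← sub_mul, norm_mul]
    calc _ ≤ ∑ j ∈ Finset.range J, ∫ w,
          ‖χ (x - ((2 : ℝ) ^ (j + 1))⁻¹ • w) - χ (x - ((2 : ℝ) ^ j)⁻¹ • w)‖ * ‖D w‖ :=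
          Finset.sum_le_sum fun j _ => h1 j
      _ = ∫ w, ∑ j ∈ Finset.range J,
          ‖χ (x - ((2 : ℝ) ^ (j + 1))⁻¹ • w) - χ (x - ((2 : ℝ) ^ j)⁻¹ • w)‖ * ‖D w‖ :=
          (integral_finsetSum _ fun j _ => h2 j).symm
      _ ≤ ∫ w, 2 * ‖D w‖ := by
          refine integral_mono (integrable_finsetSum _ fun j _ => h2 j)
            (D.integrable.norm.const_mul 2) fun w => ?_
          dsimp only
          rw [← Finset.sum_mul]
          gcongr
          refine sum_norm_indicator_sub_le (convex_subgraph hconc L) x w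
            (t := fun j => ((2 : ℝ) ^ j)⁻¹) (fun i j hij => ?_) J
          dsimp only
          gcongr
          exact one_le_two
      _ = 2 * I := integral_const_mul _ _
  set v : ℂ := Complex.exp ((1 - z) * Real.log 2) with hv
  have hv1 : ‖v‖ = 1 := by
    rw [hv, Complex.norm_exp, Complex.re_mul_ofReal, Complex.sub_re, hz]; simp
  have hterm : ∀ j : ℕ, Complex.exp (-(j * z * Real.log 2)) *
      (dyadicKernel ρ h L (j + 1) x - dyadicKernel ρ h L j x) = v ^ j * (2 * b (j + 1) - b j) := by
    intro j
    have h1 : ∀ k, dyadicKernel ρ h L k x = 2 ^ k * b k := fun k => by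
      simp only [hb, Complex.real_smul]
      push_cast
      rw [mul_inv_cancel_left₀ (pow_ne_zero k two_ne_zero)]
    have h2 : v ^ j = Complex.exp (-(j * z * Real.log 2)) * 2 ^ j := by
      rw [hv, ← exp_log_two, ← Complex.exp_nat_mul, ← Complex.exp_nat_mul, ← Complex.exp_add]
      congr 1; ring
    rw [h1, h1, h2]; ring
  have hK : stripKernel ρ h L J z x =
      b 0 + (v - 1) * ∑ j ∈ Finset.range J, v ^ j * (2 * b (j + 1) - b j) := by
    rw [stripKernel, Finset.sum_congr rfl fun j _ => hterm j]
    congr 1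
    simp [hb]
  -- the factor `v - 1` permits a summation by parts, which leaves only the variation
  have h3 := norm_sub_one_mul_sum_le hv1 (fun j => 2 * b (j + 1) - b j) J
  have h4 : ∀ j, ‖2 * b (j + 1) - b j‖ ≤ 3 * I := fun j => by
    refine (norm_sub_le _ _).trans ?_
    rw [norm_mul, Complex.norm_ofNat]
    linarith [hb1 (j + 1), hb1 j]
  have h5 : ∑ j ∈ Finset.range J, ‖(2 * b (j + 1 + 1) - b (j + 1)) - (2 * b (j + 1) - b j)‖ ≤
      6 * I := by
    calc _ ≤ ∑ j ∈ Finset.range J, (2 * ‖b (j + 1 + 1) - b (j + 1)‖ + ‖b (j + 1) - b j‖) := by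
          refine Finset.sum_le_sum fun j _ => ?_
          have e : (2 * b (j + 1 + 1) - b (j + 1)) - (2 * b (j + 1) - b j) =
              2 * (b (j + 1 + 1) - b (j + 1)) - (b (j + 1) - b j) := by ring
          rw [e]
          refine (norm_sub_le _ _).trans ?_
          rw [norm_mul, Complex.norm_ofNat]
      _ = 2 * ∑ j ∈ Finset.range J, ‖b (j + 1 + 1) - b (j + 1)‖ +
            ∑ j ∈ Finset.range J, ‖b (j + 1) - b j‖ := by
          rw [Finset.sum_add_distrib, Finset.mul_sum]
      _ ≤ 2 * (2 * I) + 2 * I := by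
          gcongr
          · have h6 := hb2 (J + 1)
            rw [Finset.sum_range_succ'] at h6
            linarith [norm_nonneg (b (0 + 1) - b 0)]
          · exact hb2 J
      _ = 6 * I := by ring
  rw [hK]
  refine (norm_add_le _ _).trans ?_
  have h6 := h4 J
  have h7 := h4 0
  linarith [hb1 0]

end Dyadic

end

noncomputable section

open scoped SchwartzMap ContDiff

section Dyadic

variable {m : ℕ}

/-- A smooth radial cut-off equal to one on the unit ball. -/
def radialCutoff (ξ : EuclideanSpace ℝ (Fin m)) : ℝ := Real.smoothTransition (2 - ‖ξ‖ ^ 2)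

theorem radialCutoff_nonneg (ξ : EuclideanSpace ℝ (Fin m)) : 0 ≤ radialCutoff ξ :=
  Real.smoothTransition.nonneg _

theorem radialCutoff_le_one (ξ : EuclideanSpace ℝ (Fin m)) : radialCutoff ξ ≤ 1 :=
  Real.smoothTransition.le_one _

theorem radialCutoff_eq_one {ξ : EuclideanSpace ℝ (Fin m)} (h : ‖ξ‖ ≤ 1) : radialCutoff ξ = 1 :=
  Real.smoothTransition.one_of_one_le (by nlinarith [norm_nonneg ξ])

theorem radialCutoff_smul_le {a b : ℝ} (ha : 0 ≤ a) (hab : a ≤ b) (ξ : EuclideanSpace ℝ (Fin m)) :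
    radialCutoff (b • ξ) ≤ radialCutoff (a • ξ) := by
  refine Real.smoothTransition.monotone ?_
  rw [norm_smul, norm_smul, Real.norm_of_nonneg ha, Real.norm_of_nonneg (ha.trans hab)]
  gcongr

/-- A Schwartz function whose Fourier transform is the radial cut-off. -/
theorem exists_fourier_eq_radialCutoff : ∃ ρ : 𝓢(EuclideanSpace ℝ (Fin m), ℂ),
    ∀ ξ, ∫ x, ρ x * fchar ξ x = (radialCutoff ξ : ℂ) := by
  have h1 : ContDiff ℝ ∞ fun ξ : EuclideanSpace ℝ (Fin m) => (radialCutoff ξ : ℂ) :=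
    Complex.ofRealCLM.contDiff.comp (Real.smoothTransition.contDiff.comp
      (contDiff_const.sub (contDiff_norm_sq ℝ)))
  have h2 : HasCompactSupport fun ξ : EuclideanSpace ℝ (Fin m) => (radialCutoff ξ : ℂ) := by
    refine HasCompactSupport.intro (isCompact_closedBall 0 2) fun ξ hξ => ?_
    rw [mem_closedBall_zero_iff, not_le] at hξ
    rw [radialCutoff, Real.smoothTransition.zero_of_nonpos (by nlinarith)]; rfl
  set X : 𝓢(EuclideanSpace ℝ (Fin m), ℂ) := h2.toSchwartzMap h1 with hX
  refine ⟨FourierTransformInv.fourierInv X, fun ξ => ?_⟩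
  rw [← fourier_eq_integral_fchar]
  have h3 : FourierTransform.fourier (FourierTransformInv.fourierInv X) = X :=
    FourierTransform.fourier_fourierInv_eq X
  have h4 := congrArg (fun Z : 𝓢(EuclideanSpace ℝ (Fin m), ℂ) => Z ξ) h3
  exact h4

variable {h : EuclideanSpace ℝ (Fin m) → ℝ} {L : ℝ} (ρ : 𝓢(EuclideanSpace ℝ (Fin (m + 1)), ℂ))

theorem integrable_dilate (j : ℕ) : Integrable fun x : EuclideanSpace ℝ (Fin (m + 1)) =>
    ((2 : ℝ) ^ j) ^ (m + 1) • ρ ((2 : ℝ) ^ j • x) :=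
  (ρ.integrable.comp_smul (pow_ne_zero j two_ne_zero)).smul (((2 : ℝ) ^ j) ^ (m + 1))

theorem integral_dilate_mul_fchar (j : ℕ) (ξ : EuclideanSpace ℝ (Fin (m + 1))) :
    ∫ x, (((2 : ℝ) ^ j) ^ (m + 1) • ρ ((2 : ℝ) ^ j • x)) * fchar ξ x =
      ∫ x, ρ x * fchar (((2 : ℝ) ^ j)⁻¹ • ξ) x := by
  set r : ℝ := 2 ^ j
  have hr : 0 < r := by positivity
  have h1 := Measure.integral_comp_smul (volume : Measure (EuclideanSpace ℝ (Fin (m + 1))))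
    (fun x => ρ x * fchar (r⁻¹ • ξ) x) r
  rw [finrank_euclideanSpace_fin, abs_of_pos (by positivity)] at h1
  have h2 : ∀ x : EuclideanSpace ℝ (Fin (m + 1)), fchar (r⁻¹ • ξ) (r • x) = fchar ξ x := fun x => by
    simp only [fchar, inner_smul_left, inner_smul_right, conj_trivial]
    rw [mul_inv_cancel_left₀ hr.ne']
  simp only [h2] at h1
  simp only [smul_mul_assoc]
  rw [integral_smul, h1, smul_smul, mul_inv_cancel₀ (by positivity), one_smul]

theorem integrable_indicator_ball_complex (L : ℝ) :
    Integrable ((Metric.closedBall 0 L).indicator (1 : EuclideanSpace ℝ (Fin m) → ℂ)) :=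
  (admissible_indicator (L := L) (τ := 0)).integrable

theorem integrable_dyadicKernel_uncurry (hh : Continuous h) (j : ℕ) :
    Integrable (Function.uncurry fun (y : EuclideanSpace ℝ (Fin m))
      (x : EuclideanSpace ℝ (Fin (m + 1))) => (Metric.closedBall 0 L).indicator (1 : EuclideanSpace ℝ (Fin m) → ℂ) y *
        (((2 : ℝ) ^ j) ^ (m + 1) • ρ ((2 : ℝ) ^ j • (x - graphMap h y))))
      (volume.prod volume) := by
  have hm1 : Measurable ((Metric.closedBall 0 L).indicator (1 : EuclideanSpace ℝ (Fin m) → ℂ)) :=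
    measurable_one.indicator measurableSet_closedBall
  have hi := integrable_dilate ρ j
  have hc := ρ.continuous
  refine (integrable_prod_iff ?_).2 ⟨.of_forall fun y => ?_, ?_⟩
  · refine ((hm1.comp measurable_fst).mul (Continuous.measurable ?_)).aestronglyMeasurable
    fun_prop
  · exact (hi.comp_sub_right (graphMap h y)).const_mul
      ((Metric.closedBall 0 L).indicator (1 : EuclideanSpace ℝ (Fin m) → ℂ) y)
  · have e : ∀ y : EuclideanSpace ℝ (Fin m), ∫ x : EuclideanSpace ℝ (Fin (m + 1)),
        ‖(Metric.closedBall 0 L).indicator (1 : EuclideanSpace ℝ (Fin m) → ℂ) y *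
          (((2 : ℝ) ^ j) ^ (m + 1) • ρ ((2 : ℝ) ^ j • (x - graphMap h y)))‖ =
        ‖(Metric.closedBall 0 L).indicator (1 : EuclideanSpace ℝ (Fin m) → ℂ) y‖ *
          ∫ x : EuclideanSpace ℝ (Fin (m + 1)), ‖((2 : ℝ) ^ j) ^ (m + 1) • ρ ((2 : ℝ) ^ j • x)‖ :=
      fun y => by
        simp only [norm_mul]
        rw [integral_const_mul, integral_sub_right_eq_self
          (fun x => ‖((2 : ℝ) ^ j) ^ (m + 1) • ρ ((2 : ℝ) ^ j • x)‖)]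
    exact ((integrable_indicator_ball_complex L).norm.mul_const _).congr (.of_forall fun y => (e y).symm)

theorem integrable_dyadicKernel (hh : Continuous h) (j : ℕ) : Integrable (dyadicKernel ρ h L j) :=
  (integrable_dyadicKernel_uncurry ρ hh j).integral_prod_right

theorem integral_dyadicKernel_mul_fchar (hh : Continuous h) (j : ℕ)
    (ξ : EuclideanSpace ℝ (Fin (m + 1))) :
    ∫ x, dyadicKernel ρ h L j x * fchar ξ x = graphFourier h ((Metric.closedBall 0 L).indicator 1) ξ *
      ∫ x, ρ x * fchar (((2 : ℝ) ^ j)⁻¹ • ξ) x := by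
  have hi := (integrable_dyadicKernel_uncurry (L := L) ρ hh j).mul_bdd (c := 1)
    (g := fun p => fchar ξ p.2) (by fun_prop : Continuous _).aestronglyMeasurable
    (.of_forall fun p => (norm_fchar _ _).le)
  simp only [dyadicKernel, ← integral_mul_const]
  rw [← integral_integral_swap hi]
  simp only [graphFourier, ← integral_mul_const]
  refine integral_congr_ae (.of_forall fun y => ?_)
  dsimp only
  rw [← integral_dilate_mul_fchar]
  simp only [mul_assoc]
  rw [integral_const_mul]
  congr 1
  rw [← integral_const_mul, ← integral_add_right_eq_self _ (graphMap h y)]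
  refine integral_congr_ae (.of_forall fun x => ?_)
  simp only [add_sub_cancel_right, fchar_add_right]
  ring

theorem continuous_dyadicKernel (hh : Continuous h) (j : ℕ) : Continuous (dyadicKernel ρ h L j) := by
  obtain ⟨M, hM⟩ : ∃ M : ℝ, ∀ x, ‖ρ x‖ ≤ M := ⟨_, fun x => by
    simpa using ρ.toBoundedContinuousFunction.norm_coe_le_norm x⟩
  have hc := ρ.continuous
  refine continuous_of_dominated
    (bound := fun y => ‖(Metric.closedBall 0 L).indicator (1 : EuclideanSpace ℝ (Fin m) → ℂ) y‖ *
      (((2 : ℝ) ^ j) ^ (m + 1) * M)) (fun x => ?_)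
    (fun x => .of_forall fun y => ?_) ((integrable_indicator_ball_complex L).norm.mul_const _)
    (.of_forall fun y => by fun_prop)
  · exact (integrable_indicator_ball_complex L).aestronglyMeasurable.mul
      (by fun_prop : Continuous _).aestronglyMeasurable
  · rw [norm_mul, norm_smul, Real.norm_of_nonneg (by positivity)]
    gcongr
    exact hM _

variable {ρ}

/-- On the line `Re z = -m / 2` the Fourier transform of the kernels grows at most as fast as the
averaged decay of the transform of the surface measure permits. -/
theorem norm_integral_stripKernel_mul_fchar_le (hh : Continuous h)
    (hρ : ∀ ξ, ∫ x, ρ x * fchar ξ x = (radialCutoff ξ : ℂ)) (J : ℕ) {z : ℂ}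
    (hz : z.re = -(m / 2)) (ξ : EuclideanSpace ℝ (Fin (m + 1))) :
    ‖∫ x, stripKernel ρ h L J z x * fchar ξ x‖ ≤
      ‖graphFourier h ((Metric.closedBall 0 L).indicator 1) ξ‖ *
        ((2 + 2 ^ (1 + m / 2 : ℝ)) * max 1 ‖ξ‖ ^ (m / 2 : ℝ)) := by
  set U := graphFourier h ((Metric.closedBall 0 L).indicator 1) ξ with hU
  set a : ℕ → ℝ := fun j => radialCutoff (((2 : ℝ) ^ j)⁻¹ • ξ) with ha
  set v : ℂ := Complex.exp ((1 - z) * Real.log 2) with hv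
  have hi : ∀ j, Integrable fun x => dyadicKernel ρ h L j x * fchar ξ x := fun j =>
    (integrable_dyadicKernel ρ hh j).mul_bdd (c := 1)
      (by fun_prop : Continuous _).aestronglyMeasurable (.of_forall fun p => (norm_fchar _ _).le)
  have hd : ∀ j, ∫ x, dyadicKernel ρ h L j x * fchar ξ x = U * (a j : ℂ) := fun j => by
    rw [integral_dyadicKernel_mul_fchar ρ hh, hρ]
  have hK : ∫ x, stripKernel ρ h L J z x * fchar ξ x = U * ((a 0 : ℂ) + (v - 1) *
      ∑ j ∈ Finset.range J, Complex.exp (-(j * z * Real.log 2)) * ((a (j + 1) - a j : ℝ) : ℂ)) := by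
    have e : ∀ x, stripKernel ρ h L J z x * fchar ξ x = dyadicKernel ρ h L 0 x * fchar ξ x +
        (v - 1) * ∑ j ∈ Finset.range J, Complex.exp (-(j * z * Real.log 2)) *
          (dyadicKernel ρ h L (j + 1) x * fchar ξ x - dyadicKernel ρ h L j x * fchar ξ x) := by
      intro x
      rw [stripKernel, add_mul, mul_assoc, Finset.sum_mul]
      congr 2
      refine Finset.sum_congr rfl fun j _ => by ring
    have i2 : ∀ j ∈ Finset.range J, Integrable fun x => Complex.exp (-(j * z * Real.log 2)) *
          (dyadicKernel ρ h L (j + 1) x * fchar ξ x - dyadicKernel ρ h L j x * fchar ξ x) :=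
      fun j _ => ((hi (j + 1)).sub (hi j)).const_mul _
    rw [integral_congr_ae (.of_forall e), integral_add (hi 0) ((integrable_finsetSum _ i2).const_mul _),
      integral_const_mul, integral_finsetSum _ i2, hd, mul_add, Finset.mul_sum, Finset.mul_sum,
      Finset.mul_sum]
    congr 1
    refine Finset.sum_congr rfl fun j _ => ?_
    rw [integral_const_mul, integral_sub (hi (j + 1)) (hi j), hd, hd]
    push_cast; ring
  have hv1 : ‖v - 1‖ ≤ 1 + 2 ^ (1 + m / 2 : ℝ) := by
    refine (norm_sub_le _ _).trans ?_
    rw [hv, Complex.norm_exp, Complex.re_mul_ofReal, Complex.sub_re, hz, norm_one, add_comm,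
      Real.rpow_def_of_pos two_pos]
    simp [mul_comm]
  set M := max 1 ‖ξ‖ with hM
  have hM1 : 1 ≤ M := le_max_left _ _
  have ha0 : ∀ j, 0 ≤ a (j + 1) - a j := fun j => sub_nonneg.2 <|
    radialCutoff_smul_le (by positivity) (by gcongr <;> simp) ξ
  -- a scale contributes only if `2ʲ < ‖ξ‖`, and there the weight is at most `‖ξ‖ ^ (m / 2)`
  have hterm : ∀ j, ‖Complex.exp (-((j : ℕ) * z * Real.log 2)) * ((a (j + 1) - a j : ℝ) : ℂ)‖ ≤
      M ^ (m / 2 : ℝ) * (a (j + 1) - a j) := by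
    intro j
    rw [norm_mul, Complex.norm_real, Real.norm_of_nonneg (ha0 j)]
    by_cases hj : ‖ξ‖ ≤ 2 ^ j
    · have h1 : ∀ k, j ≤ k → a k = 1 := fun k hk => by
        refine radialCutoff_eq_one ?_
        rw [norm_smul, Real.norm_of_nonneg (by positivity), inv_mul_le_iff₀ (by positivity), mul_one]
        exact hj.trans (by gcongr; exact one_le_two)
      rw [h1 j le_rfl, h1 (j + 1) (Nat.le_succ j)]; simp
    · gcongr
      · exact ha0 j
      · have e : ‖Complex.exp (-((j : ℕ) * z * Real.log 2))‖ = ((2 : ℝ) ^ j) ^ (m / 2 : ℝ) := by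
          rw [Complex.norm_exp, ← Real.rpow_natCast, ← Real.rpow_mul zero_le_two,
            Real.rpow_def_of_pos two_pos]
          congr 1
          rw [Complex.neg_re, Complex.re_mul_ofReal, Complex.mul_re, hz, Complex.natCast_re,
            Complex.natCast_im]; ring
        rw [e]
        gcongr
        exact (not_le.1 hj).le.trans (le_max_right _ _)
  have hsum : ‖∑ j ∈ Finset.range J, Complex.exp (-(j * z * Real.log 2)) *
      ((a (j + 1) - a j : ℝ) : ℂ)‖ ≤ M ^ (m / 2 : ℝ) := by
    refine (norm_sum_le _ _).trans ((Finset.sum_le_sum fun j _ => hterm j).trans ?_)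
    rw [← Finset.mul_sum, Finset.sum_range_sub]
    refine mul_le_of_le_one_right (by positivity) ?_
    have h1 : a J ≤ 1 := radialCutoff_le_one _
    have h2 : 0 ≤ a 0 := radialCutoff_nonneg _
    linarith
  have hMp : 1 ≤ M ^ (m / 2 : ℝ) := Real.one_le_rpow hM1 (by positivity)
  have ha1 : ‖(a 0 : ℂ)‖ ≤ 1 := by
    rw [Complex.norm_real, Real.norm_of_nonneg (radialCutoff_nonneg _)]
    exact radialCutoff_le_one _
  rw [hK, norm_mul]
  gcongr
  refine (norm_add_le _ _).trans ?_
  rw [norm_mul]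
  calc ‖(a 0 : ℂ)‖ + ‖v - 1‖ * _ ≤ M ^ (m / 2 : ℝ) + (1 + 2 ^ (1 + m / 2 : ℝ)) * M ^ (m / 2 : ℝ) := by
        gcongr
        exact ha1.trans hMp
    _ = _ := by ring

/-- The averages over rotations of the squared Fourier transform of the kernels on the line
`Re z = -m / 2` are bounded, uniformly in the frequency and in the number of scales. -/
theorem exists_lintegral_stripKernel_le (hm : 1 ≤ m) {η : ℝ} (hη : 0 < η)
    (hηm : 1024 * m * η ^ 2 ≤ 1) (hconc : ConcaveOn ℝ Set.univ h)
    (hlip : ∀ y z, |h y - h z| ≤ η * ‖y - z‖) (hh : Continuous h) (hL : 1 ≤ L)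
    (hρ : ∀ ξ, ∫ x, ρ x * fchar ξ x = (radialCutoff ξ : ℂ)) :
    ∃ C : ℝ≥0, ∀ (J : ℕ) (z : ℂ), z.re = -(m / 2) → ∀ ξ : EuclideanSpace ℝ (Fin (m + 1)),
      ∫⁻ θ, ‖∫ x, stripKernel ρ h L J z x * fchar (SO.rotate θ ξ) x‖ₑ ^ 2 ∂SO.haar (m + 1) ≤ C := by
  obtain ⟨C, hC⟩ := exists_lintegral_graphFourier_ball_le hm hη hηm hconc hlip hh hL
  set V := volume (Metric.closedBall (0 : EuclideanSpace ℝ (Fin m)) L) with hV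
  have hVt : V ≠ ⊤ := measure_closedBall_lt_top.ne
  set c : ℝ := 2 + 2 ^ (1 + m / 2 : ℝ) with hc
  refine ⟨Real.toNNReal (c ^ 2) * (C + V.toNNReal ^ 2), fun J z hz ξ => ?_⟩
  have h1 : ∀ θ : SO (m + 1), ‖∫ x, stripKernel ρ h L J z x * fchar (SO.rotate θ ξ) x‖ₑ ^ 2 ≤
      ENNReal.ofReal (c ^ 2) * ENNReal.ofReal (max 1 ‖ξ‖ ^ m) *
        ‖graphFourier h ((Metric.closedBall 0 L).indicator 1) (SO.rotate θ ξ)‖ₑ ^ 2 := fun θ => by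
    have h2 := norm_integral_stripKernel_mul_fchar_le (L := L) hh hρ J hz (SO.rotate θ ξ)
    rw [SO.norm_rotate] at h2
    have h3 : (max 1 ‖ξ‖ ^ (m / 2 : ℝ)) ^ 2 = max 1 ‖ξ‖ ^ m := by
      rw [← Real.rpow_natCast, ← Real.rpow_mul (by positivity), ← Real.rpow_natCast]
      congr 1; push_cast; ring
    rw [← ofReal_norm, ← ofReal_norm, ← ENNReal.ofReal_pow (norm_nonneg _),
      ← ENNReal.ofReal_pow (norm_nonneg _), ← ENNReal.ofReal_mul (by positivity),
      ← ENNReal.ofReal_mul (by positivity)]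
    refine ENNReal.ofReal_le_ofReal ((pow_le_pow_left₀ (norm_nonneg _) h2 2).trans_eq ?_)
    rw [mul_pow, mul_pow, h3]; ring
  refine (lintegral_mono h1).trans ?_
  rw [lintegral_const_mul' _ _ (by finiteness)]
  push_cast
  rw [mul_assoc, ENNReal.coe_toNNReal hVt]
  change ENNReal.ofReal (c ^ 2) * _ ≤ ENNReal.ofReal (c ^ 2) * _
  gcongr
  rcases le_total 1 ‖ξ‖ with hξ | hξ
  · rw [max_eq_right hξ]
    refine le_add_right ?_
    calc _ ≤ ENNReal.ofReal (‖ξ‖ ^ m) * (C * ENNReal.ofReal (‖ξ‖ ^ m)⁻¹) := by gcongr; exact hC ξ hξ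
      _ = C * (ENNReal.ofReal (‖ξ‖ ^ m) * ENNReal.ofReal (‖ξ‖ ^ m)⁻¹) := by ring
      _ = C := by
        rw [← ENNReal.ofReal_mul (by positivity), mul_inv_cancel₀ (by positivity)]; simp
  · rw [max_eq_left hξ, one_pow, ENNReal.ofReal_one, one_mul]
    refine le_add_left ?_
    calc _ ≤ ∫⁻ θ : SO (m + 1), V ^ 2 ∂SO.haar (m + 1) := by
          refine lintegral_mono fun θ => ?_
          dsimp only
          gcongr
          have hAd := admissible_indicator (m := m) (L := L) (τ := 0)
          exact enorm_graphFourier_le hAd.norm_le hAd.eq_zero _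
      _ = _ := by simp

end Dyadic

end

noncomputable section

/-! ### Convolution with rotated kernels -/

section RotConv

variable {n : ℕ}

/-- The convolution of `f` with the kernel `K` rotated by `θ⁻¹`, as a function of the point and of
the rotation. -/
def rotConv (f K : EuclideanSpace ℝ (Fin n) → ℂ) (p : EuclideanSpace ℝ (Fin n) × SO n) : ℂ :=
  ∫ u, f (p.1 - u) * K (SO.rotate p.2 u)

variable {f K : EuclideanSpace ℝ (Fin n) → ℂ}

theorem integrable_comp_rotate (hK : Integrable K) (θ : SO n) :
    Integrable fun u => K (SO.rotate θ u) :=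
  (SO.measurePreserving_rotate θ).integrable_comp_emb (SO.measurableEmbedding_rotate θ) |>.2 hK

theorem integrable_rotConv_integrand (hf : Measurable f) {M : ℝ} (hM : ∀ x, ‖f x‖ ≤ M)
    (hK : Integrable K) (p : EuclideanSpace ℝ (Fin n) × SO n) :
    Integrable fun u => f (p.1 - u) * K (SO.rotate p.2 u) :=
  (integrable_comp_rotate hK p.2).bdd_mul
    (hf.comp (measurable_const_sub p.1)).aestronglyMeasurable (.of_forall fun _ => hM _)

theorem measurable_rotConv_integrand (hf : Measurable f) (hKc : Continuous K) :
    Measurable fun q : (EuclideanSpace ℝ (Fin n) × SO n) × EuclideanSpace ℝ (Fin n) =>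
      f (q.1.1 - q.2) * K (SO.rotate q.1.2 q.2) := by
  refine (hf.comp (by fun_prop)).mul (Continuous.measurable ?_)
  fun_prop

theorem measurable_rotConv (hf : Measurable f) (hKc : Continuous K) : Measurable (rotConv f K) :=
  (measurable_rotConv_integrand hf hKc).stronglyMeasurable.integral_prod_right.measurable

theorem norm_rotConv_le {M : ℝ} (hM : ∀ x, ‖f x‖ ≤ M)
    (hK : Integrable K) (p : EuclideanSpace ℝ (Fin n) × SO n) :
    ‖rotConv f K p‖ ≤ M * ∫ u, ‖K u‖ := by
  have h1 : ∫ u, ‖K (SO.rotate p.2 u)‖ = ∫ u, ‖K u‖ :=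
    (SO.measurePreserving_rotate p.2).integral_comp (SO.measurableEmbedding_rotate p.2)
      (fun u => ‖K u‖)
  rw [← h1, ← integral_const_mul]
  refine norm_integral_le_of_norm_le ((integrable_comp_rotate hK p.2).norm.const_mul M)
    (.of_forall fun u => ?_)
  rw [norm_mul]
  gcongr
  exact hM _

theorem integrable_rotConv_uncurry (hf : Measurable f) (hfi : Integrable f) (hKc : Continuous K)
    (hK : Integrable K) :
    Integrable (fun q : (EuclideanSpace ℝ (Fin n) × SO n) × EuclideanSpace ℝ (Fin n) =>
      f (q.1.1 - q.2) * K (SO.rotate q.1.2 q.2))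
      ((volume.prod (SO.haar n)).prod volume) := by
  have hm := measurable_rotConv_integrand hf hKc
  refine ⟨hm.aestronglyMeasurable, ?_⟩
  have hme : Measurable fun q : (EuclideanSpace ℝ (Fin n) × SO n) × EuclideanSpace ℝ (Fin n) =>
      ‖f (q.1.1 - q.2) * K (SO.rotate q.1.2 q.2)‖ₑ := hm.enorm
  rw [hasFiniteIntegral_iff_enorm]
  rw [lintegral_prod_symm' _ hme]
  have h1 : ∀ u, ∫⁻ p : EuclideanSpace ℝ (Fin n) × SO n,
      ‖f (p.1 - u) * K (SO.rotate p.2 u)‖ₑ ∂(volume.prod (SO.haar n)) =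
      ∫⁻ θ : SO n, (∫⁻ x, ‖f x‖ₑ) * ‖K (SO.rotate θ u)‖ₑ ∂SO.haar n := fun u => by
    have hmu : Measurable fun p : EuclideanSpace ℝ (Fin n) × SO n =>
        ‖f (p.1 - u) * K (SO.rotate p.2 u)‖ₑ := by
      have ha : Measurable fun p : EuclideanSpace ℝ (Fin n) × SO n => f (p.1 - u) :=
        hf.comp (measurable_fst.sub_const u)
      have hb : Continuous fun p : EuclideanSpace ℝ (Fin n) × SO n => K (SO.rotate p.2 u) := by
        fun_prop
      exact (ha.mul hb.measurable).enorm
    rw [lintegral_prod_symm' _ hmu]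
    refine lintegral_congr fun θ => ?_
    simp only [enorm_mul]
    rw [lintegral_mul_const' _ _ enorm_ne_top,
      lintegral_sub_right_eq_self (fun x => ‖f x‖ₑ) u]
  simp only [h1]
  have hKm : Measurable fun q : EuclideanSpace ℝ (Fin n) × SO n => ‖K (SO.rotate q.2 q.1)‖ₑ :=
    (by fun_prop : Continuous fun q : EuclideanSpace ℝ (Fin n) × SO n =>
      K (SO.rotate q.2 q.1)).enorm.measurable
  rw [lintegral_lintegral_swap (hKm.const_mul (∫⁻ x, ‖f x‖ₑ)).aemeasurable]
  have h2 : ∀ θ : SO n, ∫⁻ u, (∫⁻ x, ‖f x‖ₑ) * ‖K (SO.rotate θ u)‖ₑ =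
      (∫⁻ x, ‖f x‖ₑ) * ∫⁻ u, ‖K u‖ₑ := fun θ => by
    rw [lintegral_const_mul' _ _ hfi.2.ne, (SO.measurePreserving_rotate θ).lintegral_comp_emb
      (SO.measurableEmbedding_rotate θ) (fun u => ‖K u‖ₑ)]
  simp only [h2, lintegral_const, measure_univ, mul_one]
  exact ENNReal.mul_lt_top hfi.2 hK.2

theorem integrable_rotConv (hf : Measurable f) (hfi : Integrable f) (hKc : Continuous K)
    (hK : Integrable K) : Integrable (rotConv f K) (volume.prod (SO.haar n)) :=
  (integrable_rotConv_uncurry hf hfi hKc hK).integral_prod_left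

theorem memLp_two_of_bounded {α : Type*} [MeasurableSpace α] {μ : Measure α} {g : α → ℂ}
    (hg : Integrable g μ) {M : ℝ} (hM : ∀ x, ‖g x‖ ≤ M) : MemLp g 2 μ := by
  refine (memLp_two_iff_integrable_sq_norm hg.aestronglyMeasurable).2 ?_
  refine (hg.norm.const_mul M).mono (hg.aestronglyMeasurable.norm.pow 2) (.of_forall fun x => ?_)
  have h0 : 0 ≤ M := (norm_nonneg _).trans (hM x)
  rw [Real.norm_of_nonneg (by positivity), Real.norm_of_nonneg (by positivity), sq]
  gcongr
  exact hM x

open FourierTransform in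
/-- Plancherel's theorem for the convolution with rotated kernels. -/
theorem lintegral_enorm_sq_rotConv_le (hf : Measurable f) (hfi : Integrable f) {M : ℝ}
    (hM : ∀ x, ‖f x‖ ≤ M) (hKc : Continuous K) (hK : Integrable K) {C : ℝ≥0}
    (hC : ∀ ξ, ∫⁻ θ, ‖∫ x, K x * fchar (SO.rotate θ ξ) x‖ₑ ^ 2 ∂SO.haar n ≤ C) :
    ∫⁻ p, ‖rotConv f K p‖ₑ ^ 2 ∂(volume.prod (SO.haar n)) ≤ C * ∫⁻ x, ‖f x‖ₑ ^ 2 := by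
  have hm := measurable_rotConv hf hKc
  rw [lintegral_prod_symm' _ (hm.enorm.pow_const 2)]
  have hfc : Continuous (𝓕 f) := VectorFourier.fourierIntegral_continuous
    Real.continuous_fourierChar (by exact continuous_inner) hfi
  have hKfc : Continuous fun ξ => ∫ x, K x * fchar ξ x := by
    refine continuous_of_dominated (bound := fun x => ‖K x‖) (fun ξ => ?_)
      (fun ξ => .of_forall fun x => by simp) hK.norm (.of_forall fun x => by fun_prop)
    exact (by fun_prop : Continuous _).aestronglyMeasurable
  have h1 : ∀ θ : SO n, ∫⁻ x, ‖rotConv f K (x, θ)‖ₑ ^ 2 =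
      ∫⁻ ξ, ‖𝓕 f ξ‖ₑ ^ 2 * ‖∫ x, K x * fchar (SO.rotate θ ξ) x‖ₑ ^ 2 := fun θ => by
    have hKi := integrable_comp_rotate hK θ
    have e : (fun x => rotConv f K (x, θ)) = MeasureTheory.convolution
        (fun u => K (SO.rotate θ u)) f (ContinuousLinearMap.mul ℂ ℂ) volume := by
      funext x
      simp only [rotConv, MeasureTheory.convolution, ContinuousLinearMap.mul_apply', mul_comm]
    have hHi : Integrable fun x => rotConv f K (x, θ) := by
      rw [e]
      exact hKi.integrable_convolution (ContinuousLinearMap.mul ℂ ℂ) hfi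
    rw [← lintegral_enorm_sq_fourier hHi
      (memLp_two_of_bounded hHi fun x => norm_rotConv_le hM hK (x, θ))]
    refine lintegral_congr fun ξ => ?_
    rw [e, Real.fourier_mul_convolution_eq hKi hfi, enorm_mul, mul_pow, mul_comm]
    congr 3
    rw [fourier_eq_integral_fchar,
      ← (SO.measurePreserving_rotate θ).integral_comp (SO.measurableEmbedding_rotate θ)
        (fun x => K x * fchar (SO.rotate θ ξ) x)]
    simp only [fchar, SO.inner_rotate_rotate]
  simp only [h1]
  rw [lintegral_lintegral_swap]
  · calc _ ≤ ∫⁻ ξ, ‖𝓕 f ξ‖ₑ ^ 2 * C := by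
          refine lintegral_mono fun ξ => ?_
          dsimp only
          rw [lintegral_const_mul' _ _ (by finiteness)]
          gcongr
          exact hC ξ
      _ = C * ∫⁻ x, ‖f x‖ₑ ^ 2 := by
          rw [lintegral_mul_const' _ _ (by finiteness),
            lintegral_enorm_sq_fourier hfi (memLp_two_of_bounded hfi hM), mul_comm]
  · have hm2 : Measurable fun q : SO n × EuclideanSpace ℝ (Fin n) =>
        ‖𝓕 f q.2‖ₑ ^ 2 * ‖∫ x, K x * fchar (SO.rotate q.1 q.2) x‖ₑ ^ 2 := by
      have hm3 : Measurable fun q : SO n × EuclideanSpace ℝ (Fin n) => ‖𝓕 f q.2‖ₑ ^ 2 :=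
        (hfc.measurable.comp measurable_snd).enorm.pow_const 2
      have hm4 : Continuous fun q : SO n × EuclideanSpace ℝ (Fin n) =>
          ∫ x, K x * fchar (SO.rotate q.1 q.2) x := hKfc.comp (by fun_prop)
      exact hm3.mul (hm4.measurable.enorm.pow_const 2)
    exact hm2.aemeasurable

/-- Integrals depending exponentially on a complex parameter are entire. -/
theorem differentiable_integral_mul_exp {α : Type*} [MeasurableSpace α] {μ : Measure α} {w : α → ℂ}
    {l : α → ℝ} (hw : Integrable w μ) (hl : Measurable l) {B : ℝ} (hB : ∀ x, |l x| ≤ B) :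
    Differentiable ℂ fun z : ℂ => ∫ x, w x * Complex.exp (z * l x) ∂μ := by
  intro z₀
  have hexp : ∀ (z : ℂ) x, ‖Complex.exp (z * l x)‖ ≤ Real.exp (‖z‖ * B) := fun z x => by
    rw [Complex.norm_exp, Complex.re_mul_ofReal]
    apply Real.exp_le_exp.2
    calc z.re * l x ≤ |z.re * l x| := le_abs_self _
      _ = |z.re| * |l x| := abs_mul _ _
      _ ≤ ‖z‖ * B := by
        gcongr
        · exact Complex.abs_re_le_norm z
        · exact hB x
  have hm : ∀ z : ℂ, AEStronglyMeasurable (fun x => w x * Complex.exp (z * l x)) μ := fun z =>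
    hw.aestronglyMeasurable.mul (Measurable.aestronglyMeasurable (by fun_prop))
  have hint : Integrable (fun x => w x * Complex.exp (z₀ * l x)) μ :=
    hw.mul_bdd (Measurable.aestronglyMeasurable (by fun_prop)) (.of_forall fun x => hexp z₀ x)
  have h := hasDerivAt_integral_of_dominated_loc_of_deriv_le (𝕜 := ℂ) (μ := μ) (x₀ := z₀)
    (F := fun z x => w x * Complex.exp (z * l x))
    (F' := fun z x => w x * (l x * Complex.exp (z * l x)))
    (bound := fun x => ‖w x‖ * (B * Real.exp ((‖z₀‖ + 1) * B))) (Metric.ball_mem_nhds z₀ one_pos)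
    (.of_forall hm) hint
    (hw.aestronglyMeasurable.mul (Measurable.aestronglyMeasurable (by fun_prop)))
    (.of_forall fun x z hz => ?_) (hw.norm.mul_const _) (.of_forall fun x z hz => ?_)
  · exact h.2.differentiableAt
  · have h0 : 0 ≤ B := (abs_nonneg _).trans (hB x)
    rw [norm_mul, norm_mul, Complex.norm_real]
    gcongr
    · exact hB x
    · refine (hexp z x).trans (Real.exp_le_exp.2 ?_)
      gcongr
      have : ‖z‖ ≤ ‖z₀‖ + ‖z - z₀‖ := by
        simpa using norm_add_le z₀ (z - z₀)
      have h2 := mem_ball_iff_norm.1 hz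
      linarith
  · have h1 : HasDerivAt (fun z : ℂ => z * l x) (1 * l x) z := (hasDerivAt_id z).mul_const _
    convert! (h1.cexp).const_mul (w x) using 1
    ring

end RotConv

end

noncomputable section

/-! ### Complex interpolation -/

section Interpolation

variable {n m : ℕ}

theorem mul_exp_log_div {a : ℝ} (ha : 0 ≤ a) :
    a * Real.exp (Real.log a / (m + 1)) = a ^ ((m + 2 : ℝ) / (m + 1)) := by
  rcases ha.eq_or_lt with rfl | ha
  · rw [Real.zero_rpow (by positivity), zero_mul]
  · rw [Real.rpow_def_of_pos ha]
    conv_lhs => rw [← Real.exp_log ha, Real.log_exp, ← Real.exp_add]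
    congr 1
    field_simp
    ring

theorem mul_exp_log_div_sq {a : ℝ} (ha : 0 ≤ a) :
    (a * Real.exp (-(m / 2) * (Real.log a / (m + 1)))) ^ 2 = a ^ ((m + 2 : ℝ) / (m + 1)) := by
  rcases ha.eq_or_lt with rfl | ha
  · rw [Real.zero_rpow (by positivity)]; simp
  · rw [Real.rpow_def_of_pos ha]
    conv_lhs => rw [← Real.exp_log ha, Real.log_exp, ← Real.exp_add, ← Real.exp_nat_mul]
    congr 1
    push_cast
    field_simp
    ring

theorem pow_mul_exp_log {a : ℝ} (ha : 0 < a) : a * a ^ m * Real.exp (Real.log a) = a ^ (m + 2) := by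
  rw [Real.exp_log ha]; ring

theorem pow_mul_exp_log_sq {a : ℝ} (ha : 0 < a) :
    (a * a ^ m * Real.exp (-(m / 2) * Real.log a)) ^ 2 = a ^ (m + 2) := by
  have h1 : Real.exp (-(m / 2) * Real.log a) ^ 2 = (a ^ m)⁻¹ := by
    rw [← Real.exp_nat_mul, ← Real.exp_log (pow_pos ha m), ← Real.exp_neg, Real.log_pow]
    congr 1
    push_cast
    ring
  rw [mul_pow, h1]
  field_simp
  ring

theorem le_of_le_interp {X A B F : ℝ} (hX : 0 ≤ X) (hA : 0 ≤ A) (hB : 0 ≤ B) (hF : 0 ≤ F)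
    (h : X ≤ Real.sqrt (X * (B * F)) ^ (1 - (m : ℝ) / (m + 2)) * (X * (A * F)) ^ ((m : ℝ) / (m + 2))) :
    X ≤ B * A ^ m * F ^ (m + 1) := by
  rcases hX.eq_or_lt with rfl | hX
  · positivity
  have h1 : (Real.sqrt (X * (B * F)) ^ (1 - (m : ℝ) / (m + 2))) ^ (m + 2) = X * (B * F) := by
    rw [← Real.rpow_natCast, ← Real.rpow_mul (by positivity)]
    have : (1 - (m : ℝ) / (m + 2)) * ((m + 2 : ℕ) : ℝ) = (2 : ℕ) := by
      push_cast; field_simp; ring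
    rw [this, Real.rpow_natCast, Real.sq_sqrt (by positivity)]
  have h2 : ((X * (A * F)) ^ ((m : ℝ) / (m + 2))) ^ (m + 2) = (X * (A * F)) ^ m := by
    rw [← Real.rpow_natCast, ← Real.rpow_mul (by positivity), ← Real.rpow_natCast]
    congr 1
    push_cast; field_simp
  have h3 := pow_le_pow_left₀ hX.le h (m + 2)
  rw [mul_pow, h1, h2] at h3
  have h4 : X ^ (m + 1) * X ≤ X ^ (m + 1) * (B * A ^ m * F ^ (m + 1)) := by
    calc X ^ (m + 1) * X = X ^ (m + 2) := by ring
      _ ≤ _ := h3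
      _ = _ := by rw [mul_pow, mul_pow]; ring
  exact le_of_mul_le_mul_left h4 (by positivity)

theorem sq_lintegral_mul_le_sq {α : Type*} [MeasurableSpace α] {μ : Measure α} {u v : α → ℝ≥0∞}
    (hu : AEMeasurable u μ) (hv : AEMeasurable v μ) :
    (∫⁻ x, u x * v x ∂μ) ^ 2 ≤ (∫⁻ x, u x ^ 2 ∂μ) * ∫⁻ x, v x ^ 2 ∂μ := by
  have h := ENNReal.lintegral_mul_le_Lp_mul_Lq μ Real.HolderConjugate.two_two hu hv
  refine (pow_le_pow_left' h 2).trans_eq ?_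
  rw [mul_pow, ← ENNReal.rpow_natCast, ← ENNReal.rpow_natCast, ← ENNReal.rpow_mul,
    ← ENNReal.rpow_mul]
  norm_num

theorem rotConv_sum {ι : Type*} {s : Finset ι} {P : ι → EuclideanSpace ℝ (Fin n) → ℂ} (c : ι → ℂ)
    {f : EuclideanSpace ℝ (Fin n) → ℂ} (hf : Measurable f) {M : ℝ} (hM : ∀ x, ‖f x‖ ≤ M)
    (hP : ∀ k ∈ s, Integrable (P k)) (p : EuclideanSpace ℝ (Fin n) × SO n) :
    rotConv f (fun x => ∑ k ∈ s, c k * P k x) p = ∑ k ∈ s, c k * rotConv f (P k) p := by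
  simp only [rotConv, Finset.mul_sum, ← integral_const_mul]
  rw [integral_finsetSum]
  · refine Finset.sum_congr rfl fun k _ => integral_congr_ae (.of_forall fun u => ?_)
    ring
  · intro k hk
    refine ((integrable_rotConv_integrand hf hM (hP k hk) p).const_mul (c k)).congr
      (.of_forall fun u => ?_)
    ring

/-- The pairing of the convolution with a bounded function, for a kernel bounded by `A`. -/
theorem norm_integral_mul_rotConv_le {f K : EuclideanSpace ℝ (Fin n) → ℂ}
    {g : EuclideanSpace ℝ (Fin n) × SO n → ℂ} (hfi : Integrable f) {A : ℝ}
    (hA : ∀ x, ‖K x‖ ≤ A) (hg : Integrable g (volume.prod (SO.haar n))) :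
    ‖∫ p, g p * rotConv f K p ∂(volume.prod (SO.haar n))‖ ≤
      (∫ p, ‖g p‖ ∂(volume.prod (SO.haar n))) * (A * ∫ x, ‖f x‖) := by
  rw [← integral_mul_const]
  refine norm_integral_le_of_norm_le (hg.norm.mul_const _) (.of_forall fun p => ?_)
  rw [norm_mul]
  gcongr
  rw [← integral_sub_left_eq_self (fun x => ‖f x‖) volume p.1, ← integral_const_mul]
  refine norm_integral_le_of_norm_le ((hfi.norm.comp_sub_left p.1).const_mul A)
    (.of_forall fun u => ?_)
  rw [norm_mul, mul_comm]
  gcongr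
  exact hA _

/-- The pairing of the convolution with a square integrable function, for a kernel whose Fourier
transform is bounded on average over rotations. -/
theorem norm_integral_mul_rotConv_le_sqrt {f K : EuclideanSpace ℝ (Fin n) → ℂ}
    {g : EuclideanSpace ℝ (Fin n) × SO n → ℂ} (hf : Measurable f) (hfi : Integrable f) {M : ℝ}
    (hM : ∀ x, ‖f x‖ ≤ M) (hKc : Continuous K) (hK : Integrable K) {B : ℝ≥0}
    (hB : ∀ ξ, ∫⁻ θ, ‖∫ x, K x * fchar (SO.rotate θ ξ) x‖ₑ ^ 2 ∂SO.haar n ≤ B)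
    (hg : Measurable g) {X F : ℝ} (hX0 : 0 ≤ X) (hF0 : 0 ≤ F)
    (hX : ∫⁻ p, ‖g p‖ₑ ^ 2 ∂(volume.prod (SO.haar n)) ≤ ENNReal.ofReal X)
    (hF : ∫⁻ x, ‖f x‖ₑ ^ 2 ≤ ENNReal.ofReal F) :
    ‖∫ p, g p * rotConv f K p ∂(volume.prod (SO.haar n))‖ ≤ Real.sqrt (X * (B * F)) := by
  refine Real.le_sqrt_of_sq_le ?_
  rw [← ENNReal.ofReal_le_ofReal_iff (by positivity), ENNReal.ofReal_pow (norm_nonneg _),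
    ofReal_norm]
  calc ‖∫ p, g p * rotConv f K p ∂(volume.prod (SO.haar n))‖ₑ ^ 2
      ≤ (∫⁻ p, ‖g p‖ₑ * ‖rotConv f K p‖ₑ ∂(volume.prod (SO.haar n))) ^ 2 := by
        gcongr
        refine (enorm_integral_le_lintegral_enorm _).trans_eq ?_
        simp only [enorm_mul]
    _ ≤ (∫⁻ p, ‖g p‖ₑ ^ 2 ∂(volume.prod (SO.haar n))) *
        ∫⁻ p, ‖rotConv f K p‖ₑ ^ 2 ∂(volume.prod (SO.haar n)) :=
      sq_lintegral_mul_le_sq hg.enorm.aemeasurable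
        (measurable_rotConv hf hKc).enorm.aemeasurable
    _ ≤ ENNReal.ofReal X * (B * ENNReal.ofReal F) := by
        gcongr
        exact (lintegral_enorm_sq_rotConv_le hf hfi hM hKc hK hB).trans (by gcongr)
    _ = ENNReal.ofReal (X * (B * F)) := by
        rw [ENNReal.ofReal_mul hX0, ENNReal.ofReal_mul B.coe_nonneg, ENNReal.ofReal_coe_nnreal]

theorem integrable_norm_pow_of_bounded {α : Type*} [MeasurableSpace α] {μ : Measure α} {g : α → ℂ}
    (hg : Integrable g μ) {M : ℝ} (hM : ∀ x, ‖g x‖ ≤ M) (k : ℕ) :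
    Integrable (fun x => ‖g x‖ ^ (k + 1)) μ := by
  refine (hg.norm.const_mul (M ^ k)).mono (hg.aestronglyMeasurable.norm.pow _)
    (.of_forall fun x => ?_)
  have h0 : 0 ≤ M := (norm_nonneg _).trans (hM x)
  rw [Real.norm_of_nonneg (by positivity), Real.norm_of_nonneg (by positivity), pow_succ]
  gcongr
  exact hM x

/-- Stein's interpolation argument for a family of kernels with `L¹ → L^∞` bounds on `Re z = 1` and
`L² → L²` bounds on `Re z = -m / 2`, in a truncated form. -/
theorem setIntegral_norm_rotConv_pow_le {ι : Type*} {s : Finset ι}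
    {P : ι → EuclideanSpace ℝ (Fin n) → ℂ} {c : ι → ℂ → ℂ}
    {K : ℂ → EuclideanSpace ℝ (Fin n) → ℂ} (hK : ∀ z, K z = fun x => ∑ k ∈ s, c k z * P k x)
    (hPc : ∀ k, Continuous (P k)) (hPi : ∀ k, Integrable (P k))
    (hc : ∀ k, Differentiable ℂ (c k))
    (hcb : ∀ k, ∃ b, ∀ z : ℂ, -(m / 2 : ℝ) ≤ z.re → z.re ≤ 1 → ‖c k z‖ ≤ b)
    {A : ℝ} (hA : ∀ z : ℂ, z.re = 1 → ∀ x, ‖K z x‖ ≤ A) {B : ℝ≥0}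
    (hB : ∀ z : ℂ, z.re = -(m / 2) → ∀ ξ,
      ∫⁻ θ, ‖∫ x, K z x * fchar (SO.rotate θ ξ) x‖ₑ ^ 2 ∂SO.haar n ≤ B)
    {f : EuclideanSpace ℝ (Fin n) → ℝ} (hf : Measurable f) (hfi : Integrable f) {δ M : ℝ}
    (hδ : 0 < δ) (hfv : ∀ x, f x = 0 ∨ δ ≤ f x ∧ f x ≤ M) {ε : ℝ} (hε : 0 < ε) :
    ∫ p in {p | ε < ‖rotConv (fun x => (f x : ℂ)) (K 0) p‖},
        ‖rotConv (fun x => (f x : ℂ)) (K 0) p‖ ^ (m + 2) ∂(volume.prod (SO.haar n)) ≤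
      B * A ^ m * (∫ x, f x ^ ((m + 2 : ℝ) / (m + 1))) ^ (m + 1) := by
  set W := (volume : Measure (EuclideanSpace ℝ (Fin n))).prod (SO.haar n) with hW
  have hA0 : 0 ≤ A := (norm_nonneg _).trans (hA 1 (by simp) 0)
  have hf0 : ∀ x, 0 ≤ f x := fun x => by
    rcases hfv x with h | h
    · exact h.ge
    · exact hδ.le.trans h.1
  have hKc : ∀ z, Continuous (K z) := fun z => by
    rw [hK]; exact continuous_finsetSum _ fun k _ => (hPc k).const_mul _
  have hKi : ∀ z, Integrable (K z) := fun z => by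
    rw [hK]; exact integrable_finsetSum _ fun k _ => (hPi k).const_mul _
  -- the logarithm of `f`, with the junk value `0` off the support
  set lf : EuclideanSpace ℝ (Fin n) → ℝ := fun x => Real.log (f x) / (m + 1) with hlf
  have hlfm : Measurable lf := hf.log.div_const _
  obtain ⟨b₁, hb₁⟩ : ∃ b, ∀ x, |lf x| ≤ b := by
    refine ⟨max |Real.log δ| |Real.log M| / (m + 1), fun x => ?_⟩
    rw [hlf, abs_div, abs_of_pos (by positivity : (0 : ℝ) < m + 1)]
    gcongr
    rcases hfv x with h | h
    · rw [h]; simp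
    · exact abs_le_max_abs_abs (Real.log_le_log hδ h.1) (Real.log_le_log (hδ.trans_le h.1) h.2)
  have hM0 : ∀ x, f x ≤ max M 0 := fun x => by
    rcases hfv x with h | h
    · rw [h]; exact le_max_right _ _
    · exact h.2.trans (le_max_left _ _)
  have hfM : ∀ x, ‖(f x : ℂ)‖ ≤ max M 0 := fun x => by
    rw [Complex.norm_real, Real.norm_of_nonneg (hf0 x)]; exact hM0 x
  have hfcm : Measurable fun x => (f x : ℂ) := Complex.measurable_ofReal.comp hf
  have hfci : Integrable fun x => (f x : ℂ) := hfi.ofReal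
  set h : EuclideanSpace ℝ (Fin n) × SO n → ℂ := rotConv (fun x => (f x : ℂ)) (K 0) with hh
  have hhm : Measurable h := measurable_rotConv hfcm (hKc 0)
  have hhi : Integrable h W := integrable_rotConv hfcm hfci (hKc 0) (hKi 0)
  obtain ⟨H, hH⟩ : ∃ H, ∀ p, ‖h p‖ ≤ H := ⟨_, fun p => norm_rotConv_le hfM (hKi 0) p⟩
  set D : Set (EuclideanSpace ℝ (Fin n) × SO n) := {p | ε < ‖h p‖} with hD
  have hDm : MeasurableSet D := measurableSet_lt measurable_const hhm.norm
  set lh : EuclideanSpace ℝ (Fin n) × SO n → ℝ := D.indicator fun p => Real.log ‖h p‖ with hlh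
  have hlhm : Measurable lh := hhm.norm.log.indicator hDm
  obtain ⟨b₂, hb₂⟩ : ∃ b, ∀ p, |lh p| ≤ b := by
    refine ⟨max |Real.log ε| |Real.log H|, fun p => ?_⟩
    by_cases hp : p ∈ D
    · rw [hlh, Set.indicator_of_mem hp]
      exact abs_le_max_abs_abs (Real.log_le_log hε (le_of_lt hp))
        (Real.log_le_log (hε.trans hp) (hH p))
    · rw [hlh, Set.indicator_of_notMem hp]; simp
  set g : EuclideanSpace ℝ (Fin n) × SO n → ℂ :=
    D.indicator fun p => (starRingEnd ℂ) (h p) * ((‖h p‖ ^ m : ℝ) : ℂ) with hg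
  have hgm : Measurable g := by
    refine Measurable.indicator ?_ hDm
    exact (Complex.continuous_conj.measurable.comp hhm).mul
      (Complex.measurable_ofReal.comp (hhm.norm.pow_const m))
  have hgn : ∀ p, ‖g p‖ = D.indicator (fun p => ‖h p‖ * ‖h p‖ ^ m) p := fun p => by
    by_cases hp : p ∈ D
    · rw [hg, Set.indicator_of_mem hp, Set.indicator_of_mem hp, norm_mul, Complex.norm_real,
        RCLike.norm_conj, Real.norm_of_nonneg (by positivity)]
    · rw [hg, Set.indicator_of_notMem hp, Set.indicator_of_notMem hp, norm_zero]
  have hgb : ∀ p, ‖g p‖ ≤ H * H ^ m := fun p => by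
    have hH0 := (norm_nonneg _).trans (hH p)
    rw [hgn]
    refine Set.indicator_apply_le' (fun _ => ?_) fun _ => by positivity
    gcongr <;> exact hH p
  have hgi : Integrable g W := by
    refine (integrable_norm_pow_of_bounded hhi hH m).mono hgm.aestronglyMeasurable
      (.of_forall fun p => ?_)
    rw [hgn, Real.norm_of_nonneg (by positivity)]
    refine Set.indicator_apply_le' (fun _ => ?_) fun _ => by positivity
    exact (pow_succ' _ _).ge
  -- the analytic families of functions
  set F : ℂ → EuclideanSpace ℝ (Fin n) → ℂ := fun z x => f x * Complex.exp (z * lf x) with hF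
  set G : ℂ → EuclideanSpace ℝ (Fin n) × SO n → ℂ := fun z p => g p * Complex.exp (z * lh p) with hG
  have hexp : ∀ (z : ℂ) {t b : ℝ}, |t| ≤ b → ‖Complex.exp (z * t)‖ ≤ Real.exp (|z.re| * b) :=
    fun z t b htb => by
      rw [Complex.norm_exp, Complex.re_mul_ofReal]
      apply Real.exp_le_exp.2
      calc z.re * t ≤ |z.re * t| := le_abs_self _
        _ = |z.re| * |t| := abs_mul _ _
        _ ≤ |z.re| * b := by gcongr
  have hFm : ∀ z, Measurable (F z) := fun z =>
    hfcm.mul (Complex.measurable_exp.comp ((Complex.measurable_ofReal.comp hlfm).const_mul z))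
  have hGm : ∀ z, Measurable (G z) := fun z =>
    hgm.mul (Complex.measurable_exp.comp ((Complex.measurable_ofReal.comp hlhm).const_mul z))
  have hFi : ∀ z, Integrable (F z) := fun z => hfci.mul_bdd (c := Real.exp (|z.re| * b₁))
    (Measurable.aestronglyMeasurable
      (Complex.measurable_exp.comp ((Complex.measurable_ofReal.comp hlfm).const_mul z)))
    (.of_forall fun x => hexp z (hb₁ x))
  have hGi : ∀ z, Integrable (G z) W := fun z => hgi.mul_bdd (c := Real.exp (|z.re| * b₂))
    (Measurable.aestronglyMeasurable
      (Complex.measurable_exp.comp ((Complex.measurable_ofReal.comp hlhm).const_mul z)))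
    (.of_forall fun x => hexp z (hb₂ x))
  have hFb : ∀ z x, ‖F z x‖ ≤ max M 0 * Real.exp (|z.re| * b₁) := fun z x => by
    rw [hF, norm_mul]
    gcongr
    exacts [hfM x, hexp z (hb₁ x)]
  have hFn : ∀ z x, ‖F z x‖ = f x * Real.exp (z.re * lf x) := fun z x => by
    rw [hF, norm_mul, Complex.norm_exp, Complex.re_mul_ofReal, Complex.norm_real,
      Real.norm_of_nonneg (hf0 x)]
  have hGn : ∀ z p, ‖G z p‖ = D.indicator (fun p => ‖h p‖ * ‖h p‖ ^ m *
      Real.exp (z.re * Real.log ‖h p‖)) p := fun z p => by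
    rw [hG, norm_mul, Complex.norm_exp, Complex.re_mul_ofReal, hgn, hlh]
    by_cases hp : p ∈ D
    · simp only [Set.indicator_of_mem hp]
    · simp only [Set.indicator_of_notMem hp, zero_mul]
  set X : ℝ := ∫ p in D, ‖h p‖ ^ (m + 2) ∂W with hX
  set N : ℝ := ∫ x, f x ^ ((m + 2 : ℝ) / (m + 1)) with hN
  have hX0 : 0 ≤ X := integral_nonneg fun p => by positivity
  have hN0 : 0 ≤ N := integral_nonneg fun x => Real.rpow_nonneg (hf0 x) _
  have hXi : Integrable (D.indicator fun p => ‖h p‖ ^ (m + 2)) W :=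
    (integrable_norm_pow_of_bounded hhi hH (m + 1)).indicator hDm
  have hXe : X = ∫ p, D.indicator (fun p => ‖h p‖ ^ (m + 2)) p ∂W := (integral_indicator hDm).symm
  -- the functions on the two boundary lines
  have hF1 : ∀ z : ℂ, z.re = 1 → ∀ x, ‖F z x‖ = f x ^ ((m + 2 : ℝ) / (m + 1)) := fun z hz x => by
    rw [hFn, hz, one_mul, hlf, mul_exp_log_div (hf0 x)]
  have hF2 : ∀ z : ℂ, z.re = -(m / 2) → ∀ x, ‖F z x‖ ^ 2 = f x ^ ((m + 2 : ℝ) / (m + 1)) :=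
    fun z hz x => by rw [hFn, hz, hlf, mul_exp_log_div_sq (hf0 x)]
  have hG1 : ∀ z : ℂ, z.re = 1 → ∀ p, ‖G z p‖ = D.indicator (fun p => ‖h p‖ ^ (m + 2)) p :=
    fun z hz p => by
      rw [hGn]
      by_cases hp : p ∈ D
      · simp only [Set.indicator_of_mem hp, hz, one_mul]
        exact pow_mul_exp_log (hε.trans hp)
      · simp only [Set.indicator_of_notMem hp]
  have hG2 : ∀ z : ℂ, z.re = -(m / 2) → ∀ p,
      ‖G z p‖ ^ 2 = D.indicator (fun p => ‖h p‖ ^ (m + 2)) p := fun z hz p => by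
    rw [hGn]
    by_cases hp : p ∈ D
    · simp only [Set.indicator_of_mem hp, hz]
      exact pow_mul_exp_log_sq (hε.trans hp)
    · simp [Set.indicator_of_notMem hp]
  have hNi : Integrable fun x => f x ^ ((m + 2 : ℝ) / (m + 1)) :=
    (hFi 1).norm.congr (.of_forall fun x => hF1 1 Complex.one_re x)
  -- the pairing, an entire function of `z`
  set Φ : ι → ℂ → ℂ := fun k z => ∫ p, G z p * rotConv (F z) (P k) p ∂W with hΦ
  set w : ι → (EuclideanSpace ℝ (Fin n) × SO n) × EuclideanSpace ℝ (Fin n) → ℂ := fun k q =>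
    g q.1 * (f (q.1.1 - q.2) * P k (SO.rotate q.1.2 q.2)) with hw
  set l : (EuclideanSpace ℝ (Fin n) × SO n) × EuclideanSpace ℝ (Fin n) → ℝ := fun q =>
    lh q.1 + lf (q.1.1 - q.2) with hl
  have hlm : Measurable l := (hlhm.comp measurable_fst).add (hlfm.comp (by fun_prop))
  have hlb : ∀ q, |l q| ≤ b₂ + b₁ := fun q => (abs_add_le _ _).trans (add_le_add (hb₂ _) (hb₁ _))
  have hwi : ∀ k, Integrable (w k) (W.prod volume) := fun k =>
    (integrable_rotConv_uncurry hfcm hfci (hPc k) (hPi k)).bdd_mul (c := H * H ^ m)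
      (hgm.comp measurable_fst).aestronglyMeasurable (.of_forall fun q => hgb q.1)
  have hΦw : ∀ k z, Φ k z = ∫ q, w k q * Complex.exp (z * l q) ∂(W.prod volume) := fun k z => by
    have hi : Integrable (fun q => w k q * Complex.exp (z * l q)) (W.prod volume) :=
      (hwi k).mul_bdd (c := Real.exp (|z.re| * (b₂ + b₁)))
        (Measurable.aestronglyMeasurable
          (Complex.measurable_exp.comp ((Complex.measurable_ofReal.comp hlm).const_mul z)))
        (.of_forall fun q => hexp z (hlb q))
    rw [integral_prod _ hi]
    refine integral_congr_ae (.of_forall fun p => ?_)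
    simp only [hG, hF, hw, hl, rotConv, ← integral_const_mul]
    refine integral_congr_ae (.of_forall fun u => ?_)
    simp only [Complex.ofReal_add, mul_add, Complex.exp_add]
    ring
  have hΦd : ∀ k, Differentiable ℂ (Φ k) := fun k => by
    rw [funext (hΦw k)]
    exact differentiable_integral_mul_exp (hwi k) hlm hlb
  set Ψ : ℂ → ℂ := fun z => ∑ k ∈ s, c k z * Φ k z with hΨ
  have hΨd : Differentiable ℂ Ψ := by
    refine Differentiable.fun_sum fun k _ => (hc k).mul (hΦd k)
  have hΨe : ∀ z, Ψ z = ∫ p, G z p * rotConv (F z) (K z) p ∂W := fun z => by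
    simp only [hΨ, hΦ, hK, ← integral_const_mul]
    rw [← integral_finsetSum]
    · refine integral_congr_ae (.of_forall fun p => ?_)
      simp only [rotConv_sum (fun k => c k z) (hFm z) (hFb z) (fun k _ => hPi k), Finset.mul_sum]
      exact Finset.sum_congr rfl fun k _ => by ring
    · intro k _
      refine Integrable.const_mul ?_ _
      exact (hGi z).mul_bdd (measurable_rotConv (hFm z) (hPc k)).aestronglyMeasurable
        (.of_forall fun p => norm_rotConv_le (hFb z) (hPi k) p)
  have hΨ0 : Ψ 0 = X := by
    rw [hΨe, hXe, ← integral_complex_ofReal]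
    refine integral_congr_ae (.of_forall fun p => ?_)
    have e1 : F 0 = fun x => (f x : ℂ) := by funext x; simp [hF]
    simp only [e1, hG, zero_mul, Complex.exp_zero, mul_one]
    rw [← hh]
    by_cases hp : p ∈ D
    · simp only [hg, Set.indicator_of_mem hp]
      rw [mul_right_comm, mul_comm ((starRingEnd ℂ) (h p)), Complex.mul_conj']
      push_cast
      ring
    · simp [hg, Set.indicator_of_notMem hp]
  have hbdd : BddAbove (norm ∘ Ψ '' Complex.HadamardThreeLines.verticalClosedStrip
      (-(m / 2 : ℝ)) 1) := by
    choose b hb using hcb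
    refine ⟨∑ k ∈ s, b k * ((∫ q, ‖w k q‖ ∂(W.prod volume)) *
      Real.exp ((m / 2 + 1) * (b₂ + b₁))), ?_⟩
    rintro _ ⟨z, hz, rfl⟩
    obtain ⟨hz1, hz2⟩ : -(m / 2 : ℝ) ≤ z.re ∧ z.re ≤ 1 := hz
    refine norm_sum_le_of_le _ fun k _ => ?_
    rw [norm_mul]
    have hbk := hb k z hz1 hz2
    refine mul_le_mul hbk ?_ (norm_nonneg _) ((norm_nonneg _).trans hbk)
    rw [hΦw, ← integral_mul_const]
    refine norm_integral_le_of_norm_le ((hwi k).norm.mul_const _) (.of_forall fun q => ?_)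
    rw [norm_mul]
    gcongr
    refine (hexp z (hlb q)).trans (Real.exp_le_exp.2 ?_)
    have : 0 ≤ b₂ + b₁ := (abs_nonneg _).trans (hlb q)
    gcongr
    rw [abs_le]
    have : (0 : ℝ) ≤ m / 2 := by positivity
    constructor <;> linarith
  have key := Complex.HadamardThreeLines.norm_le_interp_of_mem_verticalClosedStrip'
    (f := Ψ) (z := 0) (l := -(m / 2 : ℝ)) (u := 1) (a := Real.sqrt (X * (B * N)))
    (b := X * (A * N)) ?_ ?_ hΨd.diffContOnCl hbdd ?_ ?_
  · rw [hΨ0, Complex.norm_real, Real.norm_of_nonneg hX0] at key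
    have e : ((0 : ℂ).re - -(m / 2 : ℝ)) / (1 - -(m / 2 : ℝ)) = m / (m + 2) := by
      rw [Complex.zero_re, (by ring : 1 - -(m / 2 : ℝ) = (m + 2) / 2)]
      field_simp
      ring
    rw [e] at key
    exact le_of_le_interp hX0 hA0 B.coe_nonneg hN0 key
  · have : (0 : ℝ) ≤ m / 2 := by positivity
    linarith
  · have : (0 : ℝ) ≤ m / 2 := by positivity
    exact ⟨by simpa using this, by simp⟩
  · intro z hz
    have hz : z.re = -(m / 2) := hz
    rw [hΨe]
    refine norm_integral_mul_rotConv_le_sqrt (hFm z) (hFi z) (hFb z) (hKc z) (hKi z) (hB z hz)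
      (hGm z) hX0 hN0 ?_ ?_
    · rw [hXe, ofReal_integral_eq_lintegral_ofReal hXi
        (.of_forall fun p => Set.indicator_nonneg (fun _ _ => by positivity) p)]
      refine lintegral_mono fun p => ?_
      rw [← hG2 z hz, ← ofReal_norm, ENNReal.ofReal_pow (norm_nonneg _)]
    · rw [hN, ofReal_integral_eq_lintegral_ofReal hNi
        (.of_forall fun x => Real.rpow_nonneg (hf0 x) _)]
      refine lintegral_mono fun x => ?_
      rw [← hF2 z hz, ← ofReal_norm, ENNReal.ofReal_pow (norm_nonneg _)]
  · intro z hz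
    have hz : z.re = 1 := hz
    rw [hΨe]
    refine (norm_integral_mul_rotConv_le (hFi z) (hA z hz) (hGi z)).trans_eq ?_
    simp only [hG1 z hz, hF1 z hz]
    rw [hXe]

/-- Stein's interpolation argument for a family of kernels with `L¹ → L^∞` bounds on `Re z = 1` and
`L² → L²` bounds on `Re z = -m / 2`. -/
theorem lintegral_enorm_rotConv_pow_le {ι : Type*} {s : Finset ι}
    {P : ι → EuclideanSpace ℝ (Fin n) → ℂ} {c : ι → ℂ → ℂ}
    {K : ℂ → EuclideanSpace ℝ (Fin n) → ℂ} (hK : ∀ z, K z = fun x => ∑ k ∈ s, c k z * P k x)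
    (hPc : ∀ k, Continuous (P k)) (hPi : ∀ k, Integrable (P k))
    (hc : ∀ k, Differentiable ℂ (c k))
    (hcb : ∀ k, ∃ b, ∀ z : ℂ, -(m / 2 : ℝ) ≤ z.re → z.re ≤ 1 → ‖c k z‖ ≤ b)
    {A B : ℝ≥0} (hA : ∀ z : ℂ, z.re = 1 → ∀ x, ‖K z x‖ ≤ A)
    (hB : ∀ z : ℂ, z.re = -(m / 2) → ∀ ξ,
      ∫⁻ θ, ‖∫ x, K z x * fchar (SO.rotate θ ξ) x‖ₑ ^ 2 ∂SO.haar n ≤ B)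
    {f : EuclideanSpace ℝ (Fin n) → ℝ} (hf : Measurable f) (hfi : Integrable f) {δ M : ℝ}
    (hδ : 0 < δ) (hfv : ∀ x, f x = 0 ∨ δ ≤ f x ∧ f x ≤ M) :
    ∫⁻ p, ‖rotConv (fun x => (f x : ℂ)) (K 0) p‖ₑ ^ (m + 2) ∂(volume.prod (SO.haar n)) ≤
      B * A ^ m * (∫⁻ x, ‖f x‖ₑ ^ ((m + 2 : ℝ) / (m + 1))) ^ (m + 1) := by
  have hf0 : ∀ x, 0 ≤ f x := fun x => by
    rcases hfv x with h | h
    · exact h.ge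
    · exact hδ.le.trans h.1
  have hK0c : Continuous (K 0) := by
    rw [hK]; exact continuous_finsetSum _ fun k _ => (hPc k).const_mul _
  have hK0i : Integrable (K 0) := by
    rw [hK]; exact integrable_finsetSum _ fun k _ => (hPi k).const_mul _
  have hfcm : Measurable fun x => (f x : ℂ) := Complex.measurable_ofReal.comp hf
  have hfM : ∀ x, ‖(f x : ℂ)‖ ≤ max M 0 := fun x => by
    rw [Complex.norm_real, Real.norm_of_nonneg (hf0 x)]
    rcases hfv x with h | h
    · rw [h]; exact le_max_right _ _
    · exact h.2.trans (le_max_left _ _)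
  set h : EuclideanSpace ℝ (Fin n) × SO n → ℂ := rotConv (fun x => (f x : ℂ)) (K 0) with hh
  have hhm : Measurable h := measurable_rotConv hfcm hK0c
  have hhi := integrable_norm_pow_of_bounded (integrable_rotConv hfcm hfi.ofReal hK0c hK0i)
    (fun p => norm_rotConv_le hfM hK0i p) (m + 1)
  set N : ℝ := ∫ x, f x ^ ((m + 2 : ℝ) / (m + 1)) with hN
  have hNe : ENNReal.ofReal N ≤ ∫⁻ x, ‖f x‖ₑ ^ ((m + 2 : ℝ) / (m + 1)) := by
    rw [hN, integral_eq_lintegral_of_nonneg_ae (.of_forall fun x => Real.rpow_nonneg (hf0 x) _)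
      (hf.pow_const _).aestronglyMeasurable]
    refine ENNReal.ofReal_toReal_le.trans_eq (lintegral_congr fun x => ?_)
    rw [← ofReal_norm, Real.norm_of_nonneg (hf0 x),
      ENNReal.ofReal_rpow_of_nonneg (hf0 x) (by positivity)]
  have hk : ∀ k : ℕ, ∫⁻ p in {p | 1 / ((k : ℝ) + 1) < ‖h p‖}, ‖h p‖ₑ ^ (m + 2)
      ∂(volume.prod (SO.haar n)) ≤
      B * A ^ m * (∫⁻ x, ‖f x‖ₑ ^ ((m + 2 : ℝ) / (m + 1))) ^ (m + 1) := fun k => by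
    have h1 := setIntegral_norm_rotConv_pow_le hK hPc hPi hc hcb hA hB hf hfi hδ hfv
      (Nat.one_div_pos_of_nat (α := ℝ) (n := k))
    have h2 : ∀ p, ‖h p‖ₑ ^ (m + 2) = ENNReal.ofReal (‖h p‖ ^ (m + 2)) := fun p => by
      rw [← ofReal_norm, ENNReal.ofReal_pow (norm_nonneg _)]
    simp only [h2]
    rw [← ofReal_integral_eq_lintegral_ofReal hhi.integrableOn (.of_forall fun p => by positivity)]
    refine (ENNReal.ofReal_le_ofReal h1).trans ?_
    have hN0 : 0 ≤ N := integral_nonneg fun x => Real.rpow_nonneg (hf0 x) _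
    rw [ENNReal.ofReal_mul (by positivity), ENNReal.ofReal_mul B.coe_nonneg,
      ENNReal.ofReal_coe_nnreal, ENNReal.ofReal_pow A.coe_nonneg, ENNReal.ofReal_coe_nnreal,
      ENNReal.ofReal_pow hN0]
    gcongr
  have hD : Monotone fun k : ℕ => {p | 1 / ((k : ℝ) + 1) < ‖h p‖} := fun i j hij p hp => by
    rw [Set.mem_ofPred_eq] at hp ⊢
    exact (Nat.one_div_le_one_div hij).trans_lt hp
  have hU : (⋃ k : ℕ, {p | 1 / ((k : ℝ) + 1) < ‖h p‖}) = {p | h p ≠ 0} := by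
    ext p
    simp only [Set.mem_iUnion, Set.mem_ofPred_eq]
    refine ⟨fun ⟨k, hk⟩ h0 => ?_, fun hp => exists_nat_one_div_lt (norm_pos_iff.2 hp)⟩
    rw [h0, norm_zero] at hk
    exact absurd hk (not_lt.2 Nat.one_div_pos_of_nat.le)
  have hsup : ∫⁻ p, ‖h p‖ₑ ^ (m + 2) ∂(volume.prod (SO.haar n)) =
      ∫⁻ p in {p | h p ≠ 0}, ‖h p‖ₑ ^ (m + 2) ∂(volume.prod (SO.haar n)) := by
    refine (setLIntegral_eq_of_support_subset fun p hp => ?_).symm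
    intro h0
    simp [h0] at hp
  rw [hsup, ← hU, setLIntegral_iUnion_of_directed _ hD.directed_le]
  exact iSup_le hk

open scoped SchwartzMap LineDeriv in
/-- The `L^{(m+2)/(m+1)} → L^{m+2}` bound for the regularized measures, uniformly in the scale of
the regularization. -/
theorem exists_lintegral_rotConv_dyadicKernel_le (hm : 1 ≤ m) {η : ℝ} (hη : 0 < η)
    (hηm : 1024 * m * η ^ 2 ≤ 1) {h : EuclideanSpace ℝ (Fin m) → ℝ}
    (hconc : ConcaveOn ℝ Set.univ h) (hlip : ∀ y z, |h y - h z| ≤ η * ‖y - z‖)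
    (hh : Continuous h) {L : ℝ} (hL : 1 ≤ L) (ρ : 𝓢(EuclideanSpace ℝ (Fin (m + 1)), ℂ))
    (hρ : ∀ ξ, ∫ x, ρ x * fchar ξ x = (radialCutoff ξ : ℂ)) :
    ∃ C : ℝ≥0, ∀ (J : ℕ) (f : EuclideanSpace ℝ (Fin (m + 1)) → ℝ), Measurable f → Integrable f →
      ∀ δ M : ℝ, 0 < δ → (∀ x, f x = 0 ∨ δ ≤ f x ∧ f x ≤ M) →
      ∫⁻ p, ‖rotConv (fun x => (f x : ℂ)) (dyadicKernel ρ h L J) p‖ₑ ^ (m + 2)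
        ∂(volume.prod (SO.haar (m + 1))) ≤
        C * (∫⁻ x, ‖f x‖ₑ ^ ((m + 2 : ℝ) / (m + 1))) ^ (m + 1) := by
  obtain ⟨B, hB⟩ := exists_lintegral_stripKernel_le hm hη hηm hconc hlip hh hL hρ
  set A : ℝ≥0 := ⟨13 * ∫ w, ‖(∂_{consE 1 (0 : EuclideanSpace ℝ (Fin m))} ρ) w‖, by positivity⟩
    with hA
  refine ⟨B * A ^ m, fun J f hf hfi δ M hδ hfv => ?_⟩
  set P : ℕ → EuclideanSpace ℝ (Fin (m + 1)) → ℂ := fun k => k.casesOn (dyadicKernel ρ h L 0)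
    fun j x => dyadicKernel ρ h L (j + 1) x - dyadicKernel ρ h L j x with hP
  set c : ℕ → ℂ → ℂ := fun k => k.casesOn (fun _ => 1) fun j z =>
    (Complex.exp ((1 - z) * Real.log 2) - 1) * Complex.exp (-(j * z * Real.log 2)) with hc
  have hK : ∀ z, stripKernel ρ h L J z = fun x => ∑ k ∈ Finset.range (J + 1), c k z * P k x :=
    fun z => by
      funext x
      have h0 : c 0 z * P 0 x = dyadicKernel ρ h L 0 x := one_mul _
      rw [Finset.sum_range_succ', stripKernel, Finset.mul_sum, add_comm, h0]
      simp only [hP, hc, mul_assoc]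
  have h1 := lintegral_enorm_rotConv_pow_le (m := m) hK (A := A) (B := B) ?_ ?_ ?_ ?_ ?_ (hB J) hf
    hfi hδ hfv
  · rw [stripKernel_zero] at h1
    push_cast
    exact h1
  · rintro (_ | j)
    · exact continuous_dyadicKernel ρ hh 0
    · exact (continuous_dyadicKernel ρ hh (j + 1)).sub (continuous_dyadicKernel ρ hh j)
  · rintro (_ | j)
    · exact integrable_dyadicKernel ρ hh 0
    · exact (integrable_dyadicKernel ρ hh (j + 1)).sub (integrable_dyadicKernel ρ hh j)
  · rintro (_ | j)
    · exact differentiable_const _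
    · simp only [hc]
      fun_prop
  · rintro (_ | j)
    · exact ⟨1, fun z _ _ => by simp [hc]⟩
    · refine ⟨(Real.exp ((1 + m / 2) * Real.log 2) + 1) * Real.exp (j * (m / 2) * Real.log 2),
        fun z hz1 _ => ?_⟩
      have hl2 := Real.log_nonneg one_le_two
      simp only [hc, norm_mul]
      refine mul_le_mul ((norm_sub_le _ _).trans ?_) ?_ (norm_nonneg _) (by positivity)
      · rw [norm_one, Complex.norm_exp, Complex.re_mul_ofReal]
        gcongr
        simp only [Complex.sub_re, Complex.one_re]
        linarith
      · rw [Complex.norm_exp]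
        apply Real.exp_le_exp.2
        rw [Complex.neg_re, Complex.re_mul_ofReal, ← neg_mul]
        gcongr
        have : ((j : ℂ) * z).re = j * z.re := by
          rw [← Complex.ofReal_natCast, Complex.re_ofReal_mul]
        rw [this, ← mul_neg]
        gcongr
        linarith
  · intro z hz x
    exact norm_stripKernel_le ρ hconc hh J hz x

end Interpolation

end

noncomputable section

/-! ### Passage from the regularized measures to the graph -/

section GraphBound

open scoped SchwartzMap
open Filter Topology

variable {m : ℕ} {h : EuclideanSpace ℝ (Fin m) → ℝ} {L : ℝ}
  {ρ : 𝓢(EuclideanSpace ℝ (Fin (m + 1)), ℂ)}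

theorem integrable_indicator_mul_of_bounded
    {F : EuclideanSpace ℝ (Fin m) × EuclideanSpace ℝ (Fin (m + 1)) → ℂ} (hF : Measurable F) {M : ℝ}
    (hM : ∀ q, ‖F q‖ ≤ M) :
    Integrable (fun q : EuclideanSpace ℝ (Fin m) × EuclideanSpace ℝ (Fin (m + 1)) =>
      (Metric.closedBall 0 L).indicator (1 : EuclideanSpace ℝ (Fin m) → ℂ) q.1 * (F q * ρ q.2))
      (volume.prod volume) := by
  refine (((integrable_indicator_ball_complex L).mul_prod (ρ.integrable (μ := volume))).bdd_mul
    hF.aestronglyMeasurable (.of_forall hM)).congr (.of_forall fun q => ?_)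
  ring

theorem integral_mul_dyadicKernel (hh : Continuous h) {g : EuclideanSpace ℝ (Fin (m + 1)) → ℂ}
    (hg : Measurable g) {M : ℝ} (hM : ∀ x, ‖g x‖ ≤ M) (J : ℕ) :
    ∫ v, g v * dyadicKernel ρ h L J v =
      ∫ q : EuclideanSpace ℝ (Fin m) × EuclideanSpace ℝ (Fin (m + 1)),
        (Metric.closedBall 0 L).indicator 1 q.1 *
          (g (graphMap h q.1 + ((2 : ℝ) ^ J)⁻¹ • q.2) * ρ q.2) ∂(volume.prod volume) := by
  set r : ℝ := (2 : ℝ) ^ J with hr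
  have hr0 : 0 < r := by positivity
  have hi := (integrable_dyadicKernel_uncurry (L := L) ρ hh J).bdd_mul (c := M)
    (hg.comp measurable_snd).aestronglyMeasurable (.of_forall fun q => hM q.2)
  have hg2 : Measurable fun q : EuclideanSpace ℝ (Fin m) × EuclideanSpace ℝ (Fin (m + 1)) =>
      g (graphMap h q.1 + r⁻¹ • q.2) := by
    refine hg.comp (Continuous.measurable ?_)
    fun_prop
  rw [integral_prod _ (integrable_indicator_mul_of_bounded hg2 fun q => hM _)]
  simp only [dyadicKernel, ← integral_const_mul]
  rw [← integral_integral_swap hi]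
  refine integral_congr_ae (.of_forall fun y => ?_)
  have h2 := Measure.integral_comp_smul (volume : Measure (EuclideanSpace ℝ (Fin (m + 1))))
    (fun w => g (graphMap h y + r⁻¹ • w) *
      ((Metric.closedBall 0 L).indicator (1 : EuclideanSpace ℝ (Fin m) → ℂ) y *
        (r ^ (m + 1) • ρ w))) r
  dsimp only
  rw [← integral_add_right_eq_self _ (graphMap h y)]
  simp only [inv_smul_smul₀ hr0.ne', finrank_euclideanSpace, Fintype.card_fin] at h2
  simp only [add_comm _ (graphMap h y), add_sub_cancel_left, ← hr]
  rw [h2, ← integral_smul]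
  refine integral_congr_ae (.of_forall fun w => ?_)
  have hrc : (r : ℂ) ≠ 0 := by exact_mod_cast hr0.ne'
  simp only [Complex.real_smul, abs_of_pos (inv_pos.2 (pow_pos hr0 (m + 1)))]
  push_cast
  field_simp

theorem rotConv_eq_integral_comp_inv {n : ℕ} (f K : EuclideanSpace ℝ (Fin n) → ℂ)
    (p : EuclideanSpace ℝ (Fin n) × SO n) :
    rotConv f K p = ∫ v, f (p.1 - SO.rotate p.2⁻¹ v) * K v := by
  rw [← (SO.measurePreserving_rotate p.2).integral_comp (SO.measurableEmbedding_rotate p.2)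
    (fun v => f (p.1 - SO.rotate p.2⁻¹ v) * K v)]
  simp only [SO.rotate_inv_rotate, rotConv]

theorem rotConv_dyadicKernel (hh : Continuous h) {f : EuclideanSpace ℝ (Fin (m + 1)) → ℂ}
    (hf : Measurable f) {M : ℝ} (hM : ∀ x, ‖f x‖ ≤ M) (J : ℕ)
    (p : EuclideanSpace ℝ (Fin (m + 1)) × SO (m + 1)) :
    rotConv f (dyadicKernel ρ h L J) p =
      ∫ q : EuclideanSpace ℝ (Fin m) × EuclideanSpace ℝ (Fin (m + 1)),
        (Metric.closedBall 0 L).indicator 1 q.1 *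
          (f (p.1 - SO.rotate p.2⁻¹ (graphMap h q.1 + ((2 : ℝ) ^ J)⁻¹ • q.2)) * ρ q.2)
        ∂(volume.prod volume) := by
  have hfr : Measurable fun v => f (p.1 - SO.rotate p.2⁻¹ v) := hf.comp (by fun_prop)
  rw [rotConv_eq_integral_comp_inv, integral_mul_dyadicKernel hh hfr (fun v => hM _)]

theorem integral_eq_one_of_fourier (hρ : ∀ ξ, ∫ x, ρ x * fchar ξ x = (radialCutoff ξ : ℂ)) :
    ∫ x, ρ x = 1 := by
  have := hρ 0
  rw [radialCutoff_eq_one (by simp)] at this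
  simpa [fchar] using this

theorem tendsto_rotConv_dyadicKernel (hh : Continuous h)
    (hρ : ∀ ξ, ∫ x, ρ x * fchar ξ x = (radialCutoff ξ : ℂ))
    {f : EuclideanSpace ℝ (Fin (m + 1)) → ℂ} (hf : Continuous f)
    {F : ℕ → EuclideanSpace ℝ (Fin (m + 1)) → ℂ} (hF : ∀ J, Measurable (F J)) {M : ℝ}
    (hM : ∀ J x, ‖F J x‖ ≤ M) (hFf : ∀ (J : ℕ) x, ‖F J x - f x‖ ≤ 1 / ((J : ℝ) + 1))
    (p : EuclideanSpace ℝ (Fin (m + 1)) × SO (m + 1)) :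
    Tendsto (fun J => rotConv (F J) (dyadicKernel ρ h L J) p) atTop
      (𝓝 (∫ y in Metric.closedBall 0 L, f (p.1 - SO.rotate p.2⁻¹ (graphMap h y)))) := by
  have e : ∫ y in Metric.closedBall 0 L, f (p.1 - SO.rotate p.2⁻¹ (graphMap h y)) =
      ∫ q : EuclideanSpace ℝ (Fin m) × EuclideanSpace ℝ (Fin (m + 1)),
        (Metric.closedBall 0 L).indicator 1 q.1 *
          (f (p.1 - SO.rotate p.2⁻¹ (graphMap h q.1)) * ρ q.2) ∂(volume.prod volume) := by
    simp only [← mul_assoc]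
    rw [integral_prod_mul (fun y => (Metric.closedBall 0 L).indicator 1 y *
      f (p.1 - SO.rotate p.2⁻¹ (graphMap h y))) (fun w => ρ w), integral_eq_one_of_fourier hρ,
      mul_one, ← integral_indicator measurableSet_closedBall]
    refine integral_congr_ae (.of_forall fun y => ?_)
    by_cases hy : y ∈ Metric.closedBall (0 : EuclideanSpace ℝ (Fin m)) L <;> simp [hy]
  rw [e]
  simp only [rotConv_dyadicKernel hh (hF _) (hM _)]
  refine tendsto_integral_of_dominated_convergence
    (fun q => ‖(Metric.closedBall 0 L).indicator (1 : EuclideanSpace ℝ (Fin m) → ℂ) q.1 * ρ q.2‖ * M)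
    (fun J => ?_) (((integrable_indicator_ball_complex L).mul_prod
      (ρ.integrable (μ := volume))).norm.mul_const M) (fun J => .of_forall fun q => ?_)
    (.of_forall fun q => ?_)
  · refine (integrable_indicator_mul_of_bounded ((hF J).comp (Continuous.measurable ?_))
      fun q => hM J _).aestronglyMeasurable
    fun_prop
  · rw [norm_mul, norm_mul, norm_mul, mul_assoc, mul_comm ‖ρ q.2‖]
    gcongr
    exact hM J _
  · refine Tendsto.const_mul _ (Tendsto.mul_const _ ?_)
    have h0 : Tendsto (fun J : ℕ => ((2 : ℝ) ^ J)⁻¹) atTop (𝓝 0) :=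
      tendsto_inv_atTop_zero.comp (tendsto_pow_atTop_atTop_of_one_lt one_lt_two)
    have h1 : Tendsto (fun J : ℕ => f (p.1 - SO.rotate p.2⁻¹ (graphMap h q.1 +
        ((2 : ℝ) ^ J)⁻¹ • q.2))) atTop (𝓝 (f (p.1 - SO.rotate p.2⁻¹ (graphMap h q.1)))) := by
      have hc : Continuous fun t : ℝ => f (p.1 - SO.rotate p.2⁻¹ (graphMap h q.1 + t • q.2)) := by
        fun_prop
      have := (hc.tendsto 0).comp h0
      simpa [Function.comp_def] using this
    have h2 : Tendsto (fun J : ℕ => F J (p.1 - SO.rotate p.2⁻¹ (graphMap h q.1 +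
        ((2 : ℝ) ^ J)⁻¹ • q.2)) - f (p.1 - SO.rotate p.2⁻¹ (graphMap h q.1 +
        ((2 : ℝ) ^ J)⁻¹ • q.2))) atTop (𝓝 0) :=
      squeeze_zero_norm (fun J => hFf J _) tendsto_one_div_add_atTop_nhds_zero_nat
    simpa using h2.add h1

/-- The surface measure on the graph of `h` over a ball, in the parametrization by the base. -/
def graphMeasure (h : EuclideanSpace ℝ (Fin m) → ℝ) (L : ℝ) :
    Measure (EuclideanSpace ℝ (Fin (m + 1))) :=
  (volume.restrict (Metric.closedBall 0 L)).map (graphMap h)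

instance : IsFiniteMeasure (graphMeasure h L) := by
  have : IsFiniteMeasure ((volume : Measure (EuclideanSpace ℝ (Fin m))).restrict
      (Metric.closedBall 0 L)) := ⟨by simpa using measure_closedBall_lt_top⟩
  unfold graphMeasure
  infer_instance

theorem exists_lintegral_graphMeasure_le_of_hasCompactSupport (hm : 1 ≤ m) {η : ℝ} (hη : 0 < η)
    (hηm : 1024 * m * η ^ 2 ≤ 1) (hconc : ConcaveOn ℝ Set.univ h)
    (hlip : ∀ y z, |h y - h z| ≤ η * ‖y - z‖) (hh : Continuous h) (hL : 1 ≤ L) :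
    ∃ C : ℝ≥0, ∀ f : EuclideanSpace ℝ (Fin (m + 1)) → ℝ, Continuous f → HasCompactSupport f →
      (∀ x, 0 ≤ f x) →
      ∫⁻ p, (∫⁻ y, ‖f (p.1 - SO.rotate p.2⁻¹ y)‖ₑ ∂graphMeasure h L) ^ (m + 2)
        ∂(volume.prod (SO.haar (m + 1))) ≤
        C * (∫⁻ x, ‖f x‖ₑ ^ ((m + 2 : ℝ) / (m + 1))) ^ (m + 1) := by
  obtain ⟨ρ, hρ⟩ := exists_fourier_eq_radialCutoff (m := m + 1)
  obtain ⟨C, hC⟩ := exists_lintegral_rotConv_dyadicKernel_le hm hη hηm hconc hlip hh hL ρ hρ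
  refine ⟨C, fun f hf hfc hf0 => ?_⟩
  obtain ⟨M, hM⟩ := hfc.exists_bound_of_continuous hf
  have hM' : ∀ x, f x ≤ M := fun x => (le_abs_self _).trans (hM x)
  -- small values are cut off, since the interpolation needs bounded logarithms
  set F : ℕ → EuclideanSpace ℝ (Fin (m + 1)) → ℝ := fun J =>
    {x | 1 / ((J : ℝ) + 1) ≤ f x}.indicator f with hF
  have hs : ∀ J : ℕ, MeasurableSet {x | 1 / ((J : ℝ) + 1) ≤ f x} := fun J =>
    measurableSet_le measurable_const hf.measurable
  have hFm : ∀ J, Measurable (F J) := fun J => hf.measurable.indicator (hs J)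
  have hFi : ∀ J, Integrable (F J) := fun J =>
    (hf.integrable_of_hasCompactSupport hfc).indicator (hs J)
  have hFv : ∀ J x, F J x = 0 ∨ 1 / ((J : ℝ) + 1) ≤ F J x ∧ F J x ≤ M := fun J x => by
    by_cases hx : x ∈ {x | 1 / ((J : ℝ) + 1) ≤ f x}
    · right
      simp only [hF, Set.indicator_of_mem hx]
      exact ⟨hx, hM' x⟩
    · left
      simp only [hF, Set.indicator_of_notMem hx]
  have hFle : ∀ J x, ‖F J x‖ ≤ ‖f x‖ := fun J x => norm_indicator_le_norm_self _ _
  have hFf : ∀ (J : ℕ) x, ‖(F J x : ℂ) - f x‖ ≤ 1 / ((J : ℝ) + 1) := fun J x => by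
    rw [← Complex.ofReal_sub, Complex.norm_real]
    by_cases hx : x ∈ {x | 1 / ((J : ℝ) + 1) ≤ f x}
    · simp only [hF, Set.indicator_of_mem hx, sub_self, norm_zero]
      positivity
    · simp only [hF, Set.indicator_of_notMem hx, zero_sub, norm_neg]
      rw [Real.norm_of_nonneg (hf0 x)]
      exact (not_le.1 hx).le
  have hfcc : Continuous fun x => (f x : ℂ) := Complex.continuous_ofReal.comp hf
  have hFcm : ∀ J, Measurable fun x => (F J x : ℂ) := fun J =>
    Complex.measurable_ofReal.comp (hFm J)
  have hFM : ∀ J x, ‖(F J x : ℂ)‖ ≤ M := fun J x => by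
    rw [Complex.norm_real]
    exact (hFle J x).trans (hM x)
  have hlim : ∀ p : EuclideanSpace ℝ (Fin (m + 1)) × SO (m + 1), Tendsto (fun J : ℕ =>
      ‖rotConv (fun x => (F J x : ℂ)) (dyadicKernel ρ h L J) p‖ₑ ^ (m + 2)) atTop
      (𝓝 ((∫⁻ y, ‖f (p.1 - SO.rotate p.2⁻¹ y)‖ₑ ∂graphMeasure h L) ^ (m + 2))) := fun p => by
    have e : ∫⁻ y, ‖f (p.1 - SO.rotate p.2⁻¹ y)‖ₑ ∂graphMeasure h L =
        ‖∫ y in Metric.closedBall 0 L, (f (p.1 - SO.rotate p.2⁻¹ (graphMap h y)) : ℂ)‖ₑ := by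
      have hc : Continuous fun y => f (p.1 - SO.rotate p.2⁻¹ (graphMap h y)) := by fun_prop
      have hfx : Continuous fun y => f (p.1 - SO.rotate p.2⁻¹ y) := by fun_prop
      have hci : IntegrableOn (fun y => f (p.1 - SO.rotate p.2⁻¹ (graphMap h y)))
          (Metric.closedBall 0 L) :=
        hc.continuousOn.integrableOn_compact (isCompact_closedBall 0 L)
      rw [graphMeasure, lintegral_map hfx.enorm.measurable (by fun_prop), integral_complex_ofReal,
        ← ofReal_norm, Complex.norm_real,
        Real.norm_of_nonneg (integral_nonneg fun y => hf0 _),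
        ofReal_integral_eq_lintegral_ofReal hci (.of_forall fun y => hf0 _)]
      refine lintegral_congr fun y => ?_
      rw [← ofReal_norm, Real.norm_of_nonneg (hf0 _)]
    rw [e]
    exact ((ENNReal.continuous_pow _).tendsto _).comp
      ((tendsto_rotConv_dyadicKernel hh hρ hfcc hFcm hFM hFf p).enorm)
  calc ∫⁻ p, (∫⁻ y, ‖f (p.1 - SO.rotate p.2⁻¹ y)‖ₑ ∂graphMeasure h L) ^ (m + 2)
        ∂(volume.prod (SO.haar (m + 1)))
      = ∫⁻ p, liminf (fun J : ℕ =>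
          ‖rotConv (fun x => (F J x : ℂ)) (dyadicKernel ρ h L J) p‖ₑ ^ (m + 2)) atTop
        ∂(volume.prod (SO.haar (m + 1))) := lintegral_congr fun p => (hlim p).liminf_eq.symm
    _ ≤ liminf (fun J : ℕ => ∫⁻ p,
          ‖rotConv (fun x => (F J x : ℂ)) (dyadicKernel ρ h L J) p‖ₑ ^ (m + 2)
        ∂(volume.prod (SO.haar (m + 1)))) atTop := lintegral_liminf_le fun J =>
          (measurable_rotConv (hFcm J) (continuous_dyadicKernel ρ hh J)).enorm.pow_const _
    _ ≤ _ := by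
        refine liminf_le_of_le (by isBoundedDefault) fun b hb => ?_
        obtain ⟨J, hJ⟩ := hb.exists
        refine hJ.trans ((hC J (F J) (hFm J) (hFi J) _ M (Nat.one_div_pos_of_nat) (hFv J)).trans ?_)
        gcongr with x
        rw [← ofReal_norm, ← ofReal_norm]
        exact ENNReal.ofReal_le_ofReal (hFle J x)

end GraphBound

end

noncomputable section

/-! ### Measures with a rotation averaged bound -/

section RotationAveraged

open Filter Topology

variable {m : ℕ} {ν ν' : Measure (EuclideanSpace ℝ (Fin (m + 1)))}

/-- Null sets of `ℝⁿ` are not seen by almost all translates and rotates of `ν`, however singular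
`ν` is. -/
theorem quasiMeasurePreserving_sub_rotate {n : ℕ} (ν : Measure (EuclideanSpace ℝ (Fin n)))
    [SFinite ν] :
    Measure.QuasiMeasurePreserving
      (fun q : (EuclideanSpace ℝ (Fin n) × SO n) × EuclideanSpace ℝ (Fin n) =>
        q.1.1 - SO.rotate q.1.2⁻¹ q.2) ((volume.prod (SO.haar n)).prod ν) volume := by
  have hm : Measurable fun q : (EuclideanSpace ℝ (Fin n) × SO n) × EuclideanSpace ℝ (Fin n) =>
      q.1.1 - SO.rotate q.1.2⁻¹ q.2 := Continuous.measurable (by fun_prop)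
  refine ⟨hm, Measure.AbsolutelyContinuous.mk fun N hN hN0 => ?_⟩
  rw [Measure.map_apply hm hN, Measure.prod_apply_symm (hm hN)]
  refine (lintegral_congr fun y => ?_).trans lintegral_zero
  have hmy : Measurable fun p : EuclideanSpace ℝ (Fin n) × SO n => p.1 - SO.rotate p.2⁻¹ y :=
    Continuous.measurable (by fun_prop)
  change (volume.prod (SO.haar n)) ((fun p => p.1 - SO.rotate p.2⁻¹ y) ⁻¹' N) = 0
  rw [Measure.prod_apply_symm (hmy hN)]
  refine (lintegral_congr fun θ => ?_).trans lintegral_zero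
  change volume ((fun x => x - SO.rotate θ⁻¹ y) ⁻¹' N) = 0
  rw [(measurePreserving_sub_right volume (SO.rotate θ⁻¹ y)).measure_preimage
    hN.nullMeasurableSet, hN0]

theorem ae_ae_sub_rotate {n : ℕ} (ν : Measure (EuclideanSpace ℝ (Fin n))) [SFinite ν]
    {P : EuclideanSpace ℝ (Fin n) → Prop} (hP : ∀ᵐ x, P x) :
    ∀ᵐ p : EuclideanSpace ℝ (Fin n) × SO n ∂(volume.prod (SO.haar n)),
      ∀ᵐ y ∂ν, P (p.1 - SO.rotate p.2⁻¹ y) :=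
  Measure.ae_ae_of_ae_prod ((quasiMeasurePreserving_sub_rotate ν).ae hP)

/-- The measure `ν` satisfies the `L^{(m+2)/(m+1)} → L^{m+2}` bound for the convolution with all
its rotates, as a statement on nonnegative functions. -/
def RotationAveragedBound (ν : Measure (EuclideanSpace ℝ (Fin (m + 1)))) : Prop :=
  ∃ C : ℝ≥0, ∀ f : EuclideanSpace ℝ (Fin (m + 1)) → ℝ≥0∞, Measurable f →
    ∫⁻ x, f x ^ ((m + 2 : ℝ) / (m + 1)) ≠ ∞ →
    ∫⁻ p, (∫⁻ y, f (p.1 - SO.rotate p.2⁻¹ y) ∂ν) ^ (m + 2) ∂(volume.prod (SO.haar (m + 1))) ≤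
      C * (∫⁻ x, f x ^ ((m + 2 : ℝ) / (m + 1))) ^ (m + 1)

theorem measurable_lintegral_sub_rotate {n : ℕ} (ν : Measure (EuclideanSpace ℝ (Fin n)))
    [SFinite ν] {f : EuclideanSpace ℝ (Fin n) → ℝ≥0∞} (hf : Measurable f) :
    Measurable fun p : EuclideanSpace ℝ (Fin n) × SO n =>
      ∫⁻ y, f (p.1 - SO.rotate p.2⁻¹ y) ∂ν :=
  (hf.comp (quasiMeasurePreserving_sub_rotate ν).measurable).lintegral_prod_right'

theorem RotationAveragedBound.mono (h : RotationAveragedBound ν) {c : ℝ≥0} (hν : ν' ≤ c • ν) :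
    RotationAveragedBound ν' := by
  obtain ⟨C, hC⟩ := h
  refine ⟨c ^ (m + 2) * C, fun f hf hfp => ?_⟩
  calc ∫⁻ p, (∫⁻ y, f (p.1 - SO.rotate p.2⁻¹ y) ∂ν') ^ (m + 2) ∂(volume.prod (SO.haar (m + 1)))
      ≤ ∫⁻ p, (c : ℝ≥0∞) ^ (m + 2) * (∫⁻ y, f (p.1 - SO.rotate p.2⁻¹ y) ∂ν) ^ (m + 2)
          ∂(volume.prod (SO.haar (m + 1))) := by
        refine lintegral_mono fun p => ?_
        dsimp only
        rw [← mul_pow]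
        gcongr
        refine (lintegral_mono' hν le_rfl).trans_eq ?_
        rw [lintegral_smul_measure]
        rfl
    _ ≤ _ := by
        rw [lintegral_const_mul' _ _ (by finiteness), ENNReal.coe_mul, ENNReal.coe_pow, mul_assoc]
        gcongr
        exact hC f hf hfp

theorem RotationAveragedBound.zero :
    RotationAveragedBound (0 : Measure (EuclideanSpace ℝ (Fin (m + 1)))) :=
  ⟨0, fun f _ _ => by simp⟩

theorem RotationAveragedBound.add [SFinite ν] (h : RotationAveragedBound ν)
    (h' : RotationAveragedBound ν') : RotationAveragedBound (ν + ν') := by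
  obtain ⟨C, hC⟩ := h
  obtain ⟨C', hC'⟩ := h'
  refine ⟨2 ^ (m + 1) * (C + C'), fun f hf hfp => ?_⟩
  have hpow : ∀ a b : ℝ≥0∞, (a + b) ^ (m + 2) ≤ 2 ^ (m + 1) * (a ^ (m + 2) + b ^ (m + 2)) :=
    fun a b => by
      have := ENNReal.rpow_add_le_mul_rpow_add_rpow a b (p := ((m + 2 : ℕ) : ℝ))
        (by push_cast; linarith)
      rw [ENNReal.rpow_natCast, ENNReal.rpow_natCast, ENNReal.rpow_natCast] at this
      refine this.trans_eq ?_
      congr 1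
      rw [← ENNReal.rpow_natCast]
      congr 1
      push_cast
      ring
  calc ∫⁻ p, (∫⁻ y, f (p.1 - SO.rotate p.2⁻¹ y) ∂(ν + ν')) ^ (m + 2)
        ∂(volume.prod (SO.haar (m + 1)))
      ≤ ∫⁻ p, 2 ^ (m + 1) * ((∫⁻ y, f (p.1 - SO.rotate p.2⁻¹ y) ∂ν) ^ (m + 2) +
          (∫⁻ y, f (p.1 - SO.rotate p.2⁻¹ y) ∂ν') ^ (m + 2))
          ∂(volume.prod (SO.haar (m + 1))) := by
        refine lintegral_mono fun p => ?_
        dsimp only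
        rw [lintegral_add_measure]
        exact hpow _ _
    _ ≤ 2 ^ (m + 1) * (C * (∫⁻ x, f x ^ ((m + 2 : ℝ) / (m + 1))) ^ (m + 1) +
          C' * (∫⁻ x, f x ^ ((m + 2 : ℝ) / (m + 1))) ^ (m + 1)) := by
        rw [lintegral_const_mul' _ _ (by finiteness),
          lintegral_add_left ((measurable_lintegral_sub_rotate ν hf).pow_const _)]
        gcongr
        exacts [hC f hf hfp, hC' f hf hfp]
    _ = _ := by push_cast; ring

theorem RotationAveragedBound.sum {ι : Type*} {s : Finset ι}
    {ν : ι → Measure (EuclideanSpace ℝ (Fin (m + 1)))} [∀ i, SFinite (ν i)]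
    (h : ∀ i ∈ s, RotationAveragedBound (ν i)) : RotationAveragedBound (∑ i ∈ s, ν i) := by
  classical
  induction s using Finset.induction_on with
  | empty => simpa using RotationAveragedBound.zero
  | insert i s hi ih =>
    rw [Finset.sum_insert hi]
    exact (h i (Finset.mem_insert_self i s)).add
      (ih fun j hj => h j (Finset.mem_insert_of_mem hj))

theorem RotationAveragedBound.map_rotate [SFinite ν] (h : RotationAveragedBound ν)
    (φ : SO (m + 1)) : RotationAveragedBound (ν.map (SO.rotate φ)) := by
  obtain ⟨C, hC⟩ := h
  refine ⟨C, fun f hf hfp => (le_of_eq ?_).trans (hC f hf hfp)⟩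
  have hmap : ∀ p : EuclideanSpace ℝ (Fin (m + 1)) × SO (m + 1),
      ∫⁻ y, f (p.1 - SO.rotate p.2⁻¹ y) ∂(ν.map (SO.rotate φ)) =
      ∫⁻ y, f (p.1 - SO.rotate (φ⁻¹ * p.2)⁻¹ y) ∂ν := fun p => by
    have hfr : Measurable fun y => f (p.1 - SO.rotate p.2⁻¹ y) :=
      hf.comp (Continuous.measurable (by fun_prop))
    rw [lintegral_map hfr (SO.measurePreserving_rotate φ).measurable]
    simp only [mul_inv_rev, inv_inv, SO.rotate_mul]
  simp only [hmap]
  have hm := (measurable_lintegral_sub_rotate ν hf).pow_const (m + 2)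
  have hm' : Measurable fun p : EuclideanSpace ℝ (Fin (m + 1)) × SO (m + 1) =>
      (∫⁻ y, f (p.1 - SO.rotate (φ⁻¹ * p.2)⁻¹ y) ∂ν) ^ (m + 2) :=
    hm.comp (g := fun p : EuclideanSpace ℝ (Fin (m + 1)) × SO (m + 1) =>
      (∫⁻ y, f (p.1 - SO.rotate p.2⁻¹ y) ∂ν) ^ (m + 2))
      (Continuous.measurable (by fun_prop :
        Continuous fun p : EuclideanSpace ℝ (Fin (m + 1)) × SO (m + 1) => (p.1, φ⁻¹ * p.2)))
  rw [lintegral_prod _ hm'.aemeasurable, lintegral_prod _ hm.aemeasurable]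
  refine lintegral_congr fun x => ?_
  exact lintegral_mul_left_eq_self (μ := SO.haar (m + 1))
    (fun θ => (∫⁻ y, f (x - SO.rotate θ⁻¹ y) ∂ν) ^ (m + 2)) φ⁻¹

theorem lintegral_rpow_pow_eq_eLpNorm_pow {F : Type*} [NormedAddCommGroup F]
    (g : EuclideanSpace ℝ (Fin (m + 1)) → F) :
    (∫⁻ x, ‖g x‖ₑ ^ ((m + 2 : ℝ) / (m + 1))) ^ (m + 1) =
      eLpNorm g (ENNReal.ofReal ((m + 2 : ℝ) / (m + 1))) volume ^ (m + 2) := by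
  have h0 : (0 : ℝ) < (m + 2 : ℝ) / (m + 1) := by positivity
  rw [eLpNorm_eq_lintegral_rpow_enorm_toReal (by simpa using h0) ENNReal.ofReal_ne_top,
    ENNReal.toReal_ofReal h0.le, ← ENNReal.rpow_natCast, ← ENNReal.rpow_natCast,
    ← ENNReal.rpow_mul]
  congr 1
  push_cast
  field_simp

/-- Fatou's lemma for the powers of the convolutions with the rotates of a measure. -/
theorem lintegral_pow_sub_rotate_le_liminf {n : ℕ} (ν : Measure (EuclideanSpace ℝ (Fin n)))
    [SFinite ν] {f : EuclideanSpace ℝ (Fin n) → ℝ≥0∞}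
    {u : ℕ → EuclideanSpace ℝ (Fin n) → ℝ≥0∞} (hu : ∀ k, Measurable (u k))
    (huf : ∀ᵐ x, Tendsto (fun k => u k x) atTop (𝓝 (f x))) (k : ℕ) :
    ∫⁻ p, (∫⁻ y, f (p.1 - SO.rotate p.2⁻¹ y) ∂ν) ^ k ∂(volume.prod (SO.haar n)) ≤
      liminf (fun j => ∫⁻ p, (∫⁻ y, u j (p.1 - SO.rotate p.2⁻¹ y) ∂ν) ^ k
        ∂(volume.prod (SO.haar n))) atTop := by
  have hmono : Monotone fun t : ℝ≥0∞ => t ^ k := fun a b hab => pow_le_pow_left' hab _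
  refine le_trans (lintegral_mono_ae ((ae_ae_sub_rotate ν huf).mono fun p hp => ?_))
    (lintegral_liminf_le fun j => (measurable_lintegral_sub_rotate ν (hu j)).pow_const k)
  have h1 : ∫⁻ y, f (p.1 - SO.rotate p.2⁻¹ y) ∂ν ≤
      liminf (fun j => ∫⁻ y, u j (p.1 - SO.rotate p.2⁻¹ y) ∂ν) atTop := by
    rw [lintegral_congr_ae (hp.mono fun y hy => hy.liminf_eq.symm)]
    refine lintegral_liminf_le fun j => ?_
    exact (hu j).comp (Continuous.measurable (by fun_prop))
  have h2 := hmono.map_liminf_of_continuousAt (F := atTop)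
    (fun j => ∫⁻ y, u j (p.1 - SO.rotate p.2⁻¹ y) ∂ν) (ENNReal.continuous_pow k).continuousAt
  exact (hmono h1).trans_eq h2

/-- It suffices to bound the convolutions with continuous functions of compact support. -/
theorem RotationAveragedBound.of_hasCompactSupport [SFinite ν] {C : ℝ≥0}
    (h : ∀ f : EuclideanSpace ℝ (Fin (m + 1)) → ℝ, Continuous f → HasCompactSupport f →
      (∀ x, 0 ≤ f x) →
      ∫⁻ p, (∫⁻ y, ‖f (p.1 - SO.rotate p.2⁻¹ y)‖ₑ ∂ν) ^ (m + 2)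
        ∂(volume.prod (SO.haar (m + 1))) ≤
        C * (∫⁻ x, ‖f x‖ₑ ^ ((m + 2 : ℝ) / (m + 1))) ^ (m + 1)) : RotationAveragedBound ν := by
  refine ⟨C, fun f hf hfp => ?_⟩
  set q : ℝ := (m + 2 : ℝ) / (m + 1) with hq
  have hq1 : 1 ≤ q := by
    rw [hq, le_div_iff₀ (by positivity)]; linarith
  -- `f` is finite almost everywhere, so that no information is lost
  set g : EuclideanSpace ℝ (Fin (m + 1)) → ℝ := fun x => (f x).toReal with hg
  have hgm : Measurable g := hf.ennreal_toReal
  have hfg : ∀ᵐ x, f x = ‖g x‖ₑ := by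
    filter_upwards [ae_lt_top (hf.pow_const q) hfp] with x hx
    have : f x ≠ ⊤ := by
      rintro h
      rw [h, ENNReal.top_rpow_of_pos (by linarith)] at hx
      exact lt_irrefl _ hx
    rw [hg, ← ofReal_norm, Real.norm_of_nonneg ENNReal.toReal_nonneg, ENNReal.ofReal_toReal this]
  have hfg' : ∫⁻ x, f x ^ q = ∫⁻ x, ‖g x‖ₑ ^ q :=
    lintegral_congr_ae (hfg.mono fun x hx => by simp only [hx])
  rw [hfg'] at hfp ⊢
  rw [hq, lintegral_rpow_pow_eq_eLpNorm_pow, ← hq]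
  set P : ℝ≥0∞ := ENNReal.ofReal q with hP
  have hP1 : 1 ≤ P := by simpa [hP] using hq1
  have hgL : MemLp g P := by
    refine ⟨hgm.aestronglyMeasurable, ?_⟩
    rw [eLpNorm_lt_top_iff_lintegral_rpow_enorm_lt_top (by positivity) ENNReal.ofReal_ne_top,
      ENNReal.toReal_ofReal (by positivity)]
    exact hfp.lt_top
  choose u hu using fun k : ℕ => hgL.exists_hasCompactSupport_eLpNorm_sub_le ENNReal.ofReal_ne_top
    (ε := (k : ℝ≥0∞)⁻¹) (ENNReal.inv_ne_zero.2 (ENNReal.natCast_ne_top k))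
  have hu0 : Tendsto (fun k => eLpNorm (u k - g) P volume) atTop (𝓝 0) := by
    refine tendsto_of_tendsto_of_tendsto_of_le_of_le tendsto_const_nhds
      ENNReal.tendsto_inv_nat_nhds_zero (fun _ => zero_le) fun k => ?_
    rw [eLpNorm_sub_comm]
    exact (hu k).2.1
  have hle : ∀ k, eLpNorm (u k) P volume ≤ eLpNorm g P volume + (k : ℝ≥0∞)⁻¹ := fun k => by
    calc eLpNorm (u k) P volume = eLpNorm (g + (u k - g)) P volume := by rw [add_sub_cancel]
      _ ≤ eLpNorm g P volume + eLpNorm (u k - g) P volume :=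
        eLpNorm_add_le hgL.1 ((hu k).2.2.2.1.sub hgL.1) hP1
      _ ≤ _ := by
        rw [eLpNorm_sub_comm]
        exact add_le_add le_rfl (hu k).2.1
  have hbd : ∀ k, ∫⁻ p, (∫⁻ y, ‖u k (p.1 - SO.rotate p.2⁻¹ y)‖ₑ ∂ν) ^ (m + 2)
      ∂(volume.prod (SO.haar (m + 1))) ≤ C * eLpNorm (u k) P volume ^ (m + 2) := fun k => by
    have h1 := h (fun x => ‖u k x‖) (hu k).2.2.1.norm (hu k).1.norm fun x => norm_nonneg _
    rw [lintegral_rpow_pow_eq_eLpNorm_pow, eLpNorm_norm, ← hq, ← hP] at h1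
    simpa only [enorm_norm] using h1
  obtain ⟨ns, hns, hae⟩ := (tendstoInMeasure_of_tendsto_eLpNorm (by positivity)
    (fun k => (hu k).2.2.2.1) hgL.1 hu0).exists_seq_tendsto_ae
  have hptw : ∀ᵐ x, Tendsto (fun k => ‖u (ns k) x‖ₑ) atTop (𝓝 (f x)) := by
    filter_upwards [hae, hfg] with x hx hx'
    rw [hx']
    exact hx.enorm
  have hum : ∀ k, Measurable fun x => ‖u (ns k) x‖ₑ := fun k =>
    (hu (ns k)).2.2.1.enorm.measurable
  calc ∫⁻ p, (∫⁻ y, f (p.1 - SO.rotate p.2⁻¹ y) ∂ν) ^ (m + 2) ∂(volume.prod (SO.haar (m + 1)))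
      ≤ liminf (fun k => ∫⁻ p, (∫⁻ y, ‖u (ns k) (p.1 - SO.rotate p.2⁻¹ y)‖ₑ ∂ν) ^ (m + 2)
          ∂(volume.prod (SO.haar (m + 1)))) atTop :=
        lintegral_pow_sub_rotate_le_liminf ν hum hptw (m + 2)
    _ ≤ liminf (fun k => C * (eLpNorm g P volume + ((ns k : ℕ) : ℝ≥0∞)⁻¹) ^ (m + 2)) atTop := by
        refine liminf_le_liminf (.of_forall fun k => ?_)
        exact (hbd (ns k)).trans (mul_le_mul' le_rfl (pow_le_pow_left' (hle (ns k)) _))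
    _ = C * eLpNorm g P volume ^ (m + 2) := by
        refine Tendsto.liminf_eq (ENNReal.Tendsto.const_mul ?_ (Or.inr ENNReal.coe_ne_top))
        have h1 : Tendsto (fun k => eLpNorm g P volume + ((ns k : ℕ) : ℝ≥0∞)⁻¹) atTop
            (𝓝 (eLpNorm g P volume + 0)) :=
          tendsto_const_nhds.add (ENNReal.tendsto_inv_nat_nhds_zero.comp hns.tendsto_atTop)
        rw [add_zero] at h1
        exact ((ENNReal.continuous_pow _).tendsto _).comp h1

theorem rotationAveragedBound_graphMeasure (hm : 1 ≤ m) {η : ℝ} (hη : 0 < η)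
    (hηm : 1024 * m * η ^ 2 ≤ 1) {h : EuclideanSpace ℝ (Fin m) → ℝ}
    (hconc : ConcaveOn ℝ Set.univ h) (hlip : ∀ y z, |h y - h z| ≤ η * ‖y - z‖)
    (hh : Continuous h) {L : ℝ} (hL : 1 ≤ L) : RotationAveragedBound (graphMeasure h L) := by
  obtain ⟨C, hC⟩ :=
    exists_lintegral_graphMeasure_le_of_hasCompactSupport hm hη hηm hconc hlip hh hL
  exact .of_hasCompactSupport hC

end RotationAveraged

end

noncomputable section

/-! ### Convex hypersurfaces as finite unions of graphs -/

section ConvexHypersurface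

variable {m : ℕ}

/-- A supporting hyperplane at a boundary point, tested only on other boundary points. -/
theorem exists_unit_normal {E : Type*} [NormedAddCommGroup E] [InnerProductSpace ℝ E]
    [CompleteSpace E] {K : Set E} (hK : Convex ℝ K) (hKint : (interior K).Nonempty) {p : E}
    (hp : p ∈ frontier K) : ∃ v : E, ‖v‖ = 1 ∧ ∀ x ∈ frontier K, inner ℝ v x ≤ inner ℝ v p := by
  obtain ⟨f, hf⟩ := geometric_hahn_banach_open_point hK.interior isOpen_interior hp.2
  set w := (InnerProductSpace.toDual ℝ E).symm f with hw
  have hwf : ∀ x, inner ℝ w x = f x := fun x => InnerProductSpace.toDual_symm_apply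
  have hw0 : w ≠ 0 := by
    rintro h0
    obtain ⟨a, ha⟩ := hKint
    have := hf a ha
    rw [← hwf, ← hwf, h0, inner_zero_left, inner_zero_left] at this
    exact lt_irrefl _ this
  have hle : ∀ x ∈ closure K, f x ≤ f p := fun x hx => by
    rw [← hK.closure_interior_eq_closure_of_nonempty_interior hKint] at hx
    exact le_on_closure (fun a ha => (hf a ha).le) f.continuous.continuousOn
      continuousOn_const hx
  refine ⟨‖w‖⁻¹ • w, by rw [norm_smul, norm_inv, norm_norm, inv_mul_cancel₀ (norm_ne_zero_iff.2 hw0)],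
    fun x hx => ?_⟩
  rw [real_inner_smul_left, real_inner_smul_left, hwf, hwf]
  gcongr
  exact hle x hx.1

/-- The infimum of the supporting affine functions is a concave function whose graph contains the
given set. -/
theorem exists_concave_graph {T : Set (EuclideanSpace ℝ (Fin (m + 1)))} {η : ℝ} (hη : 0 ≤ η)
    (hT : ∀ p ∈ T, ∃ a : EuclideanSpace ℝ (Fin m), ‖a‖ ≤ η ∧
      ∀ x ∈ T, x 0 ≤ p 0 + inner ℝ a (tailE x - tailE p)) :
    ∃ h : EuclideanSpace ℝ (Fin m) → ℝ, ConcaveOn ℝ Set.univ h ∧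
      (∀ y z, |h y - h z| ≤ η * ‖y - z‖) ∧ ∀ x ∈ T, graphMap h (tailE x) = x := by
  rcases T.eq_empty_or_nonempty with rfl | ⟨x₀, hx₀⟩
  · refine ⟨0, concaveOn_const 0 convex_univ, fun y z => ?_, by simp⟩
    simp only [Pi.zero_apply, sub_self, abs_zero]
    positivity
  choose! a ha ha' using hT
  set l : T → EuclideanSpace ℝ (Fin m) → ℝ := fun p y => p.1 0 + inner ℝ (a p) (y - tailE p.1)
    with hl
  have hll : ∀ p y z, l p y ≤ l p z + η * ‖y - z‖ := fun p y z => by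
    have h1 : l p y = l p z + inner ℝ (a p) (y - z) := by
      simp only [hl, inner_sub_right]; ring
    rw [h1]
    gcongr
    refine (real_inner_le_norm _ _).trans ?_
    gcongr
    exact ha p p.2
  have hbdd : ∀ y, BddBelow (Set.range fun p => l p y) := fun y => by
    refine ⟨x₀ 0 - η * ‖tailE x₀ - y‖, ?_⟩
    rintro _ ⟨p, rfl⟩
    have h1 := ha' p p.2 x₀ hx₀
    have h2 := hll p (tailE x₀) y
    simp only [hl] at h2 ⊢
    linarith
  have : Nonempty T := ⟨⟨x₀, hx₀⟩⟩
  set h : EuclideanSpace ℝ (Fin m) → ℝ := fun y => ⨅ p, l p y with hh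
  have hhl : ∀ y z, h y ≤ h z + η * ‖y - z‖ := fun y z => by
    rw [← sub_le_iff_le_add]
    refine le_ciInf fun p => ?_
    rw [sub_le_iff_le_add]
    exact (ciInf_le (hbdd y) p).trans (hll p y z)
  refine ⟨h, ⟨convex_univ, fun y _ z _ s t hs ht hst => ?_⟩, fun y z => ?_, fun x hx => ?_⟩
  · refine le_ciInf fun p => ?_
    have h1 : l p (s • y + t • z) = s * l p y + t * l p z := by
      simp only [hl, inner_sub_right, inner_add_right, inner_smul_right]
      linear_combination (inner ℝ (a p) (tailE p.1) - p.1 0) * hst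
    rw [h1, smul_eq_mul, smul_eq_mul]
    gcongr
    exacts [ciInf_le (hbdd y) p, ciInf_le (hbdd z) p]
  · rw [abs_le]
    have h1 := hhl y z
    have h2 := hhl z y
    rw [norm_sub_rev] at h2
    constructor <;> linarith
  · have h1 : h (tailE x) = x 0 := by
      refine le_antisymm ((ciInf_le (hbdd _) ⟨x, hx⟩).trans_eq ?_) (le_ciInf fun p => ?_)
      · simp [hl]
      · exact ha' p p.2 x hx
    rw [graphMap, h1, consE_tailE]

theorem euclideanHausdorffMeasure_image_le {X Y : Type*} [EMetricSpace X] [EMetricSpace Y]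
    [MeasurableSpace X] [BorelSpace X] [MeasurableSpace Y] [BorelSpace Y] {k : ℝ≥0} {ψ : X → Y}
    (hψ : LipschitzWith k ψ) (d : ℕ) (s : Set X) :
    Measure.euclideanHausdorffMeasure d (ψ '' s) ≤
      (k : ℝ≥0∞) ^ d * Measure.euclideanHausdorffMeasure d s := by
  have h := hψ.hausdorffMeasure_image_le (d := d) d.cast_nonneg s
  rw [ENNReal.rpow_natCast] at h
  rw [Measure.euclideanHausdorffMeasure_def, Measure.euclideanHausdorffMeasure_def,
    Measure.smul_apply, Measure.smul_apply, ENNReal.smul_def, ENNReal.smul_def, smul_eq_mul,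
    smul_eq_mul, mul_left_comm]
  gcongr

theorem restrict_image_le_smul_map {X : Type*} [EMetricSpace X] [MeasurableSpace X] [BorelSpace X]
    {k : ℝ≥0} {ψ : EuclideanSpace ℝ (Fin m) → X} (hψ : LipschitzWith k ψ)
    (s : Set (EuclideanSpace ℝ (Fin m))) :
    (Measure.euclideanHausdorffMeasure m).restrict (ψ '' s) ≤
      k ^ m • (volume.restrict s).map ψ := by
  refine Measure.le_iff.2 fun A hA => ?_
  have hψm := hψ.continuous.measurable
  rw [Measure.restrict_apply hA, Measure.smul_apply, Measure.map_apply hψm hA,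
    Measure.restrict_apply (hψm hA), Set.inter_comm A, ← Set.image_inter_preimage, Set.inter_comm,
    ENNReal.smul_def, smul_eq_mul, ENNReal.coe_pow]
  refine (euclideanHausdorffMeasure_image_le hψ m _).trans_eq ?_
  rw [EuclideanSpace.euclideanHausdorffMeasure_eq_volume]

theorem lipschitzWith_graphMap {h : EuclideanSpace ℝ (Fin m) → ℝ} {η : ℝ} (hη : η ≤ 1)
    (hlip : ∀ y z, |h y - h z| ≤ η * ‖y - z‖) : LipschitzWith 2 (graphMap h) := by
  refine LipschitzWith.of_dist_le_mul fun y z => ?_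
  rw [dist_eq_norm, dist_eq_norm, graphMap, graphMap, ← consE_sub]
  refine le_of_sq_le_sq ?_ (by positivity)
  rw [norm_consE_sq, ← sq_abs (h y - h z)]
  have h1 : |h y - h z| ≤ ‖y - z‖ := (hlip y z).trans
    (mul_le_of_le_one_left (norm_nonneg _) hη)
  have h2 := pow_le_pow_left₀ (abs_nonneg _) h1 2
  push_cast
  nlinarith [norm_nonneg (y - z)]

/-- The part of a convex hypersurface with normals close to a fixed direction is a rotated graph. -/
theorem exists_rotationAveragedBound_of_normal (hm : 1 ≤ m) {T : Set (EuclideanSpace ℝ (Fin (m + 1)))}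
    (hTb : Bornology.IsBounded T) {e : EuclideanSpace ℝ (Fin (m + 1))} (he : ‖e‖ = 1)
    (hT : ∀ p ∈ T, ∃ v, ‖v - e‖ ≤ 1 / (64 * m) ∧ ∀ x ∈ T, inner ℝ v x ≤ inner ℝ v p) :
    ∃ κ : Measure (EuclideanSpace ℝ (Fin (m + 1))), IsFiniteMeasure κ ∧ RotationAveragedBound κ ∧
      (Measure.euclideanHausdorffMeasure m).restrict T ≤ κ := by
  have hm' : (1 : ℝ) ≤ m := by exact_mod_cast hm
  have he0 : ‖consE (1 : ℝ) (0 : EuclideanSpace ℝ (Fin m))‖ = 1 := by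
    rw [← sq_eq_sq₀ (norm_nonneg _) zero_le_one, norm_consE_sq]; simp
  obtain ⟨φ, hφ⟩ := SO.exists_rotate_eq hm (he.trans he0.symm)
  set η : ℝ := 1 / (32 * m) with hη
  have hη0 : 0 < η := by positivity
  have hη1 : η ≤ 1 / 32 := by
    rw [hη]; gcongr; linarith
  -- slopes of the supporting hyperplanes in the rotated coordinates
  have hslope : ∀ p ∈ SO.rotate φ '' T, ∃ a : EuclideanSpace ℝ (Fin m), ‖a‖ ≤ η ∧
      ∀ x ∈ SO.rotate φ '' T, x 0 ≤ p 0 + inner ℝ a (tailE x - tailE p) := by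
    rintro _ ⟨p, hp, rfl⟩
    obtain ⟨v, hv, hvT⟩ := hT p hp
    set w := SO.rotate φ v with hw
    have hwe : ‖w - consE 1 0‖ ≤ η / 2 := by
      rw [hw, ← hφ, ← SO.rotate_sub, SO.norm_rotate]
      refine hv.trans_eq ?_
      rw [hη]; field_simp; norm_num
    have hsplit : w - consE 1 0 = consE (w 0 - 1) (tailE w) := by
      conv_lhs => rw [← consE_tailE w, ← consE_sub, sub_zero]
    have hsq := norm_consE_sq (w 0 - 1) (tailE w)
    rw [← hsplit] at hsq
    have hw0 : |w 0 - 1| ≤ η / 2 := by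
      refine (abs_le_of_sq_le_sq ?_ (norm_nonneg _)).trans hwe |> fun h => h
      nlinarith [sq_nonneg ‖tailE w‖]
    have hw1 : ‖tailE w‖ ≤ η / 2 := by
      refine (le_of_sq_le_sq ?_ (norm_nonneg _)).trans hwe
      nlinarith [sq_nonneg (w 0 - 1)]
    have hwpos : 1 / 2 ≤ w 0 := by
      have := (abs_le.1 hw0).1
      linarith
    refine ⟨-((w 0)⁻¹ • tailE w), ?_, ?_⟩
    · rw [norm_neg, norm_smul, norm_inv, Real.norm_of_nonneg (by linarith),
        inv_mul_le_iff₀ (by linarith)]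
      nlinarith
    · rintro _ ⟨x, hx, rfl⟩
      have h1 := hvT x hx
      rw [← SO.inner_rotate_rotate φ v x, ← SO.inner_rotate_rotate φ v p, ← hw,
        ← consE_tailE (SO.rotate φ x), ← consE_tailE (SO.rotate φ p), inner_consE, inner_consE]
        at h1
      rw [inner_neg_left, real_inner_smul_left, inner_sub_right, ← sub_nonneg]
      have h2 : SO.rotate φ p 0 + -((w 0)⁻¹ * (inner ℝ (tailE w) (tailE (SO.rotate φ x)) -
          inner ℝ (tailE w) (tailE (SO.rotate φ p)))) - SO.rotate φ x 0 =
          (w 0)⁻¹ * ((w 0 * SO.rotate φ p 0 + inner ℝ (tailE w) (tailE (SO.rotate φ p))) -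
            (w 0 * SO.rotate φ x 0 + inner ℝ (tailE w) (tailE (SO.rotate φ x)))) := by
        field_simp
        ring
      rw [h2]
      exact mul_nonneg (inv_nonneg.2 (by linarith)) (sub_nonneg.2 h1)
  obtain ⟨h, hconc, hlip, hgraph⟩ := exists_concave_graph hη0.le hslope
  have hψ := lipschitzWith_graphMap (hη1.trans (by norm_num)) hlip
  have hh : Continuous h := by
    refine (LipschitzWith.of_dist_le_mul (K := ⟨η, hη0.le⟩) fun y z => ?_).continuous
    rw [Real.dist_eq, dist_eq_norm]
    exact hlip y z
  obtain ⟨R, hR⟩ := hTb.exists_norm_le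
  set L : ℝ := max R 1 with hL
  have hsub : T ⊆ (fun y => SO.rotate φ⁻¹ (graphMap h y)) '' Metric.closedBall 0 L := fun x hx => by
    refine ⟨tailE (SO.rotate φ x), ?_, ?_⟩
    · rw [mem_closedBall_zero_iff]
      have h1 := norm_consE_sq (SO.rotate φ x 0) (tailE (SO.rotate φ x))
      rw [consE_tailE, SO.norm_rotate] at h1
      have h2 : ‖tailE (SO.rotate φ x)‖ ≤ ‖x‖ := by
        refine le_of_sq_le_sq ?_ (norm_nonneg _)
        nlinarith [sq_nonneg (SO.rotate φ x 0)]
      exact h2.trans ((hR x hx).trans (le_max_left _ _))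
    · dsimp only
      rw [hgraph _ ⟨x, hx, rfl⟩, SO.rotate_inv_rotate]
  have hψ' : LipschitzWith 2 fun y => SO.rotate φ⁻¹ (graphMap h y) := by
    refine LipschitzWith.of_dist_le_mul fun y z => ?_
    rw [dist_eq_norm, ← SO.rotate_sub, SO.norm_rotate, ← dist_eq_norm]
    exact hψ.dist_le_mul y z
  have hb : 1024 * (m : ℝ) * η ^ 2 ≤ 1 := by
    rw [hη]; field_simp; nlinarith
  have hbound := (rotationAveragedBound_graphMeasure hm hη0 hb hconc hlip hh
    (le_max_right R 1)).map_rotate φ⁻¹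
  have hmap : ((volume.restrict (Metric.closedBall 0 L)).map fun y =>
      SO.rotate φ⁻¹ (graphMap h y)) = (graphMeasure h L).map (SO.rotate φ⁻¹) := by
    rw [graphMeasure, Measure.map_map (by fun_prop) (by fun_prop)]
    rfl
  refine ⟨(2 : ℝ≥0) ^ m • (graphMeasure h L).map (SO.rotate φ⁻¹), inferInstance,
    hbound.mono le_rfl, ?_⟩
  rw [← hmap]
  exact (Measure.restrict_mono hsub le_rfl).trans
    (restrict_image_le_smul_map hψ' _)

/-- The unit sphere is covered by finitely many small balls, and the points of the hypersurface are
sorted by the ball which contains one of their unit normals. -/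
theorem exists_rotationAveragedBound_surfaceMeasure (hm : 1 ≤ m)
    {K S : Set (EuclideanSpace ℝ (Fin (m + 1)))} (hK : Convex ℝ K) (hKint : (interior K).Nonempty)
    (hS : IsCompact S) (hSK : S ⊆ frontier K) :
    IsFiniteMeasure (surfaceMeasure S) ∧ RotationAveragedBound (surfaceMeasure S) := by
  have hm' : (1 : ℝ) ≤ m := by exact_mod_cast hm
  obtain ⟨t, ht, htf, hcov⟩ := (isCompact_sphere (0 : EuclideanSpace ℝ (Fin (m + 1))) 1).finite_cover_balls
    (e := 1 / (64 * m)) (by positivity)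
  set T : t → Set (EuclideanSpace ℝ (Fin (m + 1))) := fun e => {p ∈ S | ∃ v, ‖v - e.1‖ ≤ 1 / (64 * m) ∧
    ∀ x ∈ S, inner ℝ v x ≤ inner ℝ v p} with hT
  have hST : S ⊆ ⋃ e, T e := fun p hp => by
    obtain ⟨v, hv, hvS⟩ := exists_unit_normal hK hKint (hSK hp)
    have hv1 : v ∈ Metric.sphere (0 : EuclideanSpace ℝ (Fin (m + 1))) 1 := by simpa using hv
    obtain ⟨e, he, hve⟩ := Set.mem_iUnion₂.1 (hcov hv1)
    exact Set.mem_iUnion.2 ⟨⟨e, he⟩, hp, v, (mem_ball_iff_norm.1 hve).le,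
      fun x hx => hvS x (hSK hx)⟩
  have hTS : ∀ e, T e ⊆ S := fun e => Set.sep_subset _ _
  have := htf.fintype
  choose κ hκ1 hκ2 hκ3 using fun e : t => exists_rotationAveragedBound_of_normal hm
    (T := T e) (hS.isBounded.subset (hTS e)) (by simpa using ht e.2)
    fun p hp => hp.2.imp fun v hv => ⟨hv.1, fun x hx => hv.2 x (hTS e hx)⟩
  have hle : surfaceMeasure S ≤ ∑ e, κ e := by
    calc surfaceMeasure S ≤ (Measure.euclideanHausdorffMeasure m).restrict (⋃ e, T e) :=
          Measure.restrict_mono hST le_rfl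
      _ ≤ Measure.sum fun e => (Measure.euclideanHausdorffMeasure m).restrict (T e) :=
          Measure.restrict_iUnion_le
      _ ≤ _ := by
          rw [Measure.sum_fintype]
          exact Finset.sum_le_sum fun e _ => hκ3 e
  refine ⟨isFiniteMeasure_of_le _ hle, 
    (RotationAveragedBound.sum (s := Finset.univ) fun e _ => hκ2 e).mono (c := 1) ?_⟩
  rwa [one_smul]

end ConvexHypersurface

end

noncomputable section

/-! ### The bound for convolutions -/

section Convolution

variable {m : ℕ} {ν : Measure (EuclideanSpace ℝ (Fin (m + 1)))}

theorem integrable_rotatedMeasure_iff {n : ℕ} {μ : Measure (EuclideanSpace ℝ (Fin n))}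
    {f : EuclideanSpace ℝ (Fin n) → ℂ} (p : EuclideanSpace ℝ (Fin n) × SO n) :
    Integrable (fun y => f (p.1 - y)) (rotatedMeasure μ p.2) ↔
      Integrable (fun y => f (p.1 - SO.rotate p.2⁻¹ y)) μ :=
  (SO.measurableEmbedding_rotate p.2⁻¹).integrable_map_iff

theorem convMeasure_rotatedMeasure {n : ℕ} (μ : Measure (EuclideanSpace ℝ (Fin n)))
    (f : EuclideanSpace ℝ (Fin n) → ℂ) (p : EuclideanSpace ℝ (Fin n) × SO n) :
    convMeasure f (rotatedMeasure μ p.2) p.1 = ∫ y, f (p.1 - SO.rotate p.2⁻¹ y) ∂μ :=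
  (SO.measurableEmbedding_rotate p.2⁻¹).integral_map _

/-- The bound on nonnegative functions gives the absolute convergence and the bound of the
convolutions with the rotates of a measure. -/
theorem RotationAveragedBound.exists_memLp [SFinite ν] (h : RotationAveragedBound ν) :
    ∃ C : ℝ≥0, ∀ f : EuclideanSpace ℝ (Fin (m + 1)) → ℂ,
      MemLp f (ENNReal.ofReal ((m + 2 : ℝ) / (m + 1))) volume →
        (∀ᵐ p : EuclideanSpace ℝ (Fin (m + 1)) × SO (m + 1) ∂(volume.prod (SO.haar (m + 1))),
          Integrable (fun y => f (p.1 - y)) (rotatedMeasure ν p.2)) ∧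
        MemLp (fun p : EuclideanSpace ℝ (Fin (m + 1)) × SO (m + 1) =>
            convMeasure f (rotatedMeasure ν p.2) p.1)
          (m + 2 : ℕ) (volume.prod (SO.haar (m + 1))) ∧
        eLpNorm (fun p : EuclideanSpace ℝ (Fin (m + 1)) × SO (m + 1) =>
            convMeasure f (rotatedMeasure ν p.2) p.1)
          (m + 2 : ℕ) (volume.prod (SO.haar (m + 1))) ≤
          C * eLpNorm f (ENNReal.ofReal ((m + 2 : ℝ) / (m + 1))) volume := by
  obtain ⟨C, hC⟩ := h
  refine ⟨C ^ (1 / ((m + 2 : ℕ) : ℝ)), fun f hf => ?_⟩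
  set P : ℝ≥0∞ := ENNReal.ofReal ((m + 2 : ℝ) / (m + 1)) with hP
  set W := (volume : Measure (EuclideanSpace ℝ (Fin (m + 1)))).prod (SO.haar (m + 1)) with hW
  simp only [integrable_rotatedMeasure_iff, convMeasure_rotatedMeasure]
  obtain ⟨g, hg, hfg⟩ : ∃ g : EuclideanSpace ℝ (Fin (m + 1)) → ℝ≥0∞, Measurable g ∧
      ∀ᵐ x, ‖f x‖ₑ = g x := ⟨_, hf.1.enorm.measurable_mk, hf.1.enorm.ae_eq_mk⟩
  have hsm : AEStronglyMeasurable
      (fun q : (EuclideanSpace ℝ (Fin (m + 1)) × SO (m + 1)) × EuclideanSpace ℝ (Fin (m + 1)) =>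
        f (q.1.1 - SO.rotate q.1.2⁻¹ q.2)) (W.prod ν) :=
    hf.1.comp_quasiMeasurePreserving (quasiMeasurePreserving_sub_rotate ν)
  have hpow : (∫⁻ x, g x ^ ((m + 2 : ℝ) / (m + 1))) ^ (m + 1) = eLpNorm f P volume ^ (m + 2) := by
    rw [← lintegral_rpow_pow_eq_eLpNorm_pow]
    congr 1
    exact lintegral_congr_ae (hfg.mono fun x hx => by simp only [hx])
  have hfin : ∫⁻ x, g x ^ ((m + 2 : ℝ) / (m + 1)) ≠ ∞ := fun h => by
    rw [h, ENNReal.top_pow (Nat.succ_ne_zero m)] at hpow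
    exact ENNReal.pow_ne_top hf.2.ne hpow.symm
  have hae : ∀ᵐ p : EuclideanSpace ℝ (Fin (m + 1)) × SO (m + 1) ∂W,
      ∫⁻ y, ‖f (p.1 - SO.rotate p.2⁻¹ y)‖ₑ ∂ν = ∫⁻ y, g (p.1 - SO.rotate p.2⁻¹ y) ∂ν :=
    (ae_ae_sub_rotate ν hfg).mono fun p hp => lintegral_congr_ae hp
  have hbound : ∫⁻ p, (∫⁻ y, ‖f (p.1 - SO.rotate p.2⁻¹ y)‖ₑ ∂ν) ^ (m + 2) ∂W ≤
      C * eLpNorm f P volume ^ (m + 2) := by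
    rw [← hpow]
    refine (lintegral_congr_ae (hae.mono fun p hp => by simp only [hp])).trans_le (hC g hg hfin)
  have hnorm : eLpNorm (fun p : EuclideanSpace ℝ (Fin (m + 1)) × SO (m + 1) =>
      ∫ y, f (p.1 - SO.rotate p.2⁻¹ y) ∂ν) (m + 2 : ℕ) W ≤
      (C ^ (1 / ((m + 2 : ℕ) : ℝ)) : ℝ≥0) * eLpNorm f P volume := by
    rw [eLpNorm_eq_lintegral_rpow_enorm_toReal (by simp) (ENNReal.natCast_ne_top _),
      ENNReal.toReal_natCast]
    have h1 : ∫⁻ p : EuclideanSpace ℝ (Fin (m + 1)) × SO (m + 1),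
        ‖∫ y, f (p.1 - SO.rotate p.2⁻¹ y) ∂ν‖ₑ ^ ((m + 2 : ℕ) : ℝ) ∂W ≤
        C * eLpNorm f P volume ^ (m + 2) := by
      refine le_trans (lintegral_mono fun p => ?_) hbound
      rw [ENNReal.rpow_natCast]
      exact pow_le_pow_left' (enorm_integral_le_lintegral_enorm _) _
    refine (ENNReal.rpow_le_rpow h1 (by positivity)).trans_eq ?_
    rw [ENNReal.mul_rpow_of_nonneg _ _ (by positivity), ← ENNReal.rpow_natCast (eLpNorm f P volume),
      ← ENNReal.rpow_mul, mul_one_div_cancel (by positivity), ENNReal.rpow_one,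
      ENNReal.coe_rpow_of_nonneg _ (by positivity)]
  refine ⟨?_, ⟨hsm.integral_prod_right', hnorm.trans_lt (ENNReal.mul_lt_top ENNReal.coe_lt_top hf.2)⟩,
    hnorm⟩
  have hfin2 : ∀ᵐ p : EuclideanSpace ℝ (Fin (m + 1)) × SO (m + 1) ∂W,
      (∫⁻ y, g (p.1 - SO.rotate p.2⁻¹ y) ∂ν) ^ (m + 2) < ∞ := by
    refine ae_lt_top ((measurable_lintegral_sub_rotate ν hg).pow_const _)
      ((hC g hg hfin).trans_lt ?_).ne
    rw [hpow]
    exact ENNReal.mul_lt_top ENNReal.coe_lt_top (ENNReal.pow_lt_top hf.2)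
  filter_upwards [hsm.prodMk_left, hae, hfin2] with p hp1 hp2 hp3
  refine ⟨hp1, ?_⟩
  rw [hasFiniteIntegral_iff_enorm, hp2]
  rw [ENNReal.pow_lt_top_iff] at hp3
  exact hp3.resolve_right (by simp)

end Convolution

end

/-- `S` is a compact piece of the boundary of a convex set with nonempty interior, for instance
the whole boundary of a convex body; no smoothness is assumed. -/
theorem theorem2 (n : ℕ) (hn : 2 ≤ n) (K S : Set (EuclideanSpace ℝ (Fin n)))
    (hK : Convex ℝ K) (hKint : (interior K).Nonempty)
    (hS : IsCompact S) (hSK : S ⊆ frontier K) :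
    ∃ C : ℝ≥0, ∀ f : EuclideanSpace ℝ (Fin n) → ℂ,
      MemLp f (((n : ℝ≥0∞) + 1) / (n : ℝ≥0∞)) volume →
        (∀ᵐ p : EuclideanSpace ℝ (Fin n) × SO n ∂(volume.prod (SO.haar n)),
          Integrable (fun y => f (p.1 - y)) (rotatedMeasure (surfaceMeasure S) p.2)) ∧
        MemLp (fun p : EuclideanSpace ℝ (Fin n) × SO n =>
            convMeasure f (rotatedMeasure (surfaceMeasure S) p.2) p.1)
          ((n : ℝ≥0∞) + 1) (volume.prod (SO.haar n)) ∧
        eLpNorm (fun p : EuclideanSpace ℝ (Fin n) × SO n =>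
            convMeasure f (rotatedMeasure (surfaceMeasure S) p.2) p.1)
          ((n : ℝ≥0∞) + 1) (volume.prod (SO.haar n)) ≤
          C * eLpNorm f (((n : ℝ≥0∞) + 1) / (n : ℝ≥0∞)) volume := by
  obtain ⟨m, rfl⟩ : ∃ m, n = m + 1 := ⟨n - 1, by omega⟩
  obtain ⟨hfin, hbound⟩ := exists_rotationAveragedBound_surfaceMeasure (by omega) hK hKint hS hSK
  obtain ⟨C, hC⟩ := hbound.exists_memLp
  have hp : (((m + 1 : ℕ) : ℝ≥0∞) + 1) / ((m + 1 : ℕ) : ℝ≥0∞) =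
      ENNReal.ofReal ((m + 2 : ℝ) / (m + 1)) := by
    rw [ENNReal.ofReal_div_of_pos (by positivity), ← ENNReal.ofReal_natCast (m + 1),
      ← ENNReal.ofReal_one, ← ENNReal.ofReal_add (by positivity) zero_le_one]
    push_cast
    congr 2
    ring
  have hq : (((m + 1 : ℕ) : ℝ≥0∞) + 1) = ((m + 2 : ℕ) : ℝ≥0∞) := by push_cast; ring
  rw [hp, hq]
  exact ⟨C, hC⟩
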